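/- Let $N\ge 3$, $2<q<2+\frac4N$, $\mu>0$, $2^*=\frac{2N}{N-2}$, and let $H^1(\mathbb R^N)=H^1(\mathbb R^N,\mathbb K)$ with $\mathbb K=\mathbb R$ or $\mathbb K=\mathbb C$. For $u\in H^1(\mathbb R^N)$ put $$F_\mu(u)=\tfrac12\|\nabla u\|_2^2-\tfrac{\mu}{q}\|u\|_q^q-\tfrac1{2^*}\|u\|_{2^*}^{2^*},\qquad Q_\mu(u)=\|\nabla u\|_2^2-\mu\gamma_q\|u\|_q^q-\|u\|_{2^*}^{2^*},\qquad \gamma_q=\tfrac{N(q-2)}{2q}.$$ Let $\mathcal S$ be the best constant in the Sobolev inequality $\mathcal S\|f\|_{2^*}^2\le\|\nabla f\|_2^2$, $f\in\dot H^1(\mathbb R^N)$, and let $C_{N,q}$ be the best constant in the Gagliardo–Nirenberg inequality $\|f\|_q\le C_{N,q}\|\nabla f\|_2^{\beta}\|f\|_2^{1-\beta}$, $f\in H^1(\mathbb R^N)$, where $\beta=N(\frac12-\frac1q)$. Put $\alpha_0=\frac{N(q-2)}2-2$, $\alpha_1=\frac4{N-2}$, $\alpha_2=q-\frac{N(q-2)}2$,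 $$B=-\frac{\alpha_0}{\alpha_1}\,\frac{\mu}{q}C_{N,q}^q\,2^*\mathcal S^{2^*/2},\qquad K=\frac{\mu}{q}C_{N,q}^q\,B^{\frac{\alpha_0}{\alpha_1-\alpha_0}}+\frac{1}{2^*\mathcal S^{2^*/2}}\,B^{\frac{\alpha_1}{\alpha_1-\alpha_0}},$$ $$c_0=c_0(\mu)=\Big(\frac1{2K}\Big)^{N/2},\qquad \rho_0=B^{\frac{2}{\alpha_1-\alpha_0}}\,c_0^{\frac{\alpha_2}{\alpha_1-\alpha_0}}.$$ For $c>0$ let $S(c)=\{u\in H^1(\mathbb R^N):\|u\|_2^2=c\}$, let $S_r(c)$ be the set of the $u\in S(c)$ that are radially symmetric with respect to $0$, and let $$V(c)=\{u\in S(c):\|\nabla u\|_2^2<\rho_0\},\qquad m(c)=\inf_{V(c)}F_\mu,\qquad E_c=\{u\in S(c):F_\mu(u)<2m(c)\},$$ $$\Lambda(c)=\{u\in S(c):Q_\mu(u)=0\},\qquad \Lambda^-(c)=\{u\in\Lambda(c):F_\mu(u)<0\},\qquad \Lambda^+(c)=\{u\in\Lambda(c):F_\mu(u)>0\},$$ and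 $\Lambda^-_r(c)=\Lambda^-(c)\cap S_r(c)$. Let $$\Gamma^0(c)=\{g\in C([0,\infty),S_r(c)):\ g(0)\in\Lambda^-_r(c),\ \exists\, t_g\ \forall t\ge t_g:\ g(t)\in E_c\},$$ $$\Gamma(c)=\{h\in C([0,\infty),S(c)):\ h(0)\in V(c),\ F_\mu(h(0))<0,\ \exists\, t_h\ \forall t\ge t_h:\ h(t)\in E_c\},$$ $$M^0(c)=\inf_{g\in\Gamma^0(c)}\max_{t\in[0,\infty)}F_\mu(g(t)),\qquad M(c)=\inf_{h\in\Gamma(c)}\max_{t\in[0,\infty)}F_\mu(h(t)).$$ Then $c_0>0$, and for every $c\in(0,c_0)$ these levels are well defined: $\emptyset\ne\Gamma^0(c)\subset\Gamma(c)$, the maximum of $F_\mu\circ h$ on $[0,\infty)$ is attained for every $h\in\Gamma(c)$, these maxima are bounded below, and $\Lambda^+(c)$ is nonempty with $F_\mu$ bounded below on it. Moreover $$M^0(c)\le M(c),$$ and in fact $$M^0(c)=M(c)=\inf_{u\in\Lambda^+(c)}F_\mu(u).$$ -/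

import Mathlib

open MeasureTheory Set
open scoped ENNReal NNReal ContDiff

noncomputable section

namespace NormalizedNLS

/-- The Euclidean space `ℝ^N` (with Lebesgue measure `volume`). -/
abbrev Rn (N : ℕ) : Type := EuclideanSpace ℝ (Fin N)

/-! ### Weak gradients and the space `H¹(ℝ^N)` -/

/-- `g` is the weak gradient of `u`: for every real test function `φ ∈ C_c^∞(ℝ^N)` and every `i`,
`∫ (∂ᵢ φ) u = - ∫ φ gᵢ`. It is only applied to functions `u`, `g` which lie in some `L^p`, `p ≥ 1`,
so that all the integrals converge. -/
def HasWeakGradient {𝕜 : Type*} [RCLike 𝕜] {N : ℕ} (u : Rn N → 𝕜)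
    (g : Rn N → EuclideanSpace 𝕜 (Fin N)) : Prop :=
  ∀ φ : Rn N → ℝ, ContDiff ℝ ∞ φ → HasCompactSupport φ → ∀ i : Fin N,
    ∫ x, (fderiv ℝ φ x (EuclideanSpace.single i 1)) • u x = - ∫ x, φ x • g x i

/-- An `L²` function multiplied by a continuous compactly supported function is integrable. -/
theorem integrable_smul_of_Lp {N : ℕ} {G : Type*} [NormedAddCommGroup G] [NormedSpace ℝ G]
    (f : Lp G 2 (volume : Measure (Rn N))) {φ : Rn N → ℝ} (hφ : Continuous φ)
    (hc : HasCompactSupport φ) : Integrable (fun x => φ x • f x) volume :=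
  ((Lp.memLp f).locallyIntegrable (by norm_num)).integrable_smul_left_of_hasCompactSupport hφ hc

/-- A component of an `L²` vector field multiplied by a continuous compactly supported function is
integrable. -/
theorem integrable_smul_coord_of_Lp {𝕜 : Type*} [RCLike 𝕜] {N : ℕ}
    (g : Lp (EuclideanSpace 𝕜 (Fin N)) 2 (volume : Measure (Rn N))) {φ : Rn N → ℝ}
    (hφ : Continuous φ) (hc : HasCompactSupport φ) (i : Fin N) :
    Integrable (fun x => φ x • g x i) volume := by
  have h := integrable_smul_of_Lp g hφ hc
  exact ((EuclideanSpace.proj (𝕜 := 𝕜) i).restrictScalars ℝ).integrable_comp h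

theorem continuous_fderiv_dir {N : ℕ} {φ : Rn N → ℝ} (hφ : ContDiff ℝ ∞ φ) (v : Rn N) :
    Continuous fun x => fderiv ℝ φ x v :=
  (hφ.continuous_fderiv (by simp)).clm_apply continuous_const

/-- The Sobolev space `H¹(ℝ^N) = H¹(ℝ^N, 𝕜)` as a subspace of `L² ⊕ L²`: the pairs `(u, ∇u)` with `u ∈ L²` and weak gradient
`∇u ∈ L²` (which is determined by `u`). It carries the norm
`‖u‖_{H¹}² = ‖u‖₂² + ‖∇u‖₂²` of the Hilbert sum `L² ⊕ L²`. -/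
def sobolevSubmodule (𝕜 : Type*) [RCLike 𝕜] (N : ℕ) :
    Submodule 𝕜 (WithLp 2 (Lp 𝕜 2 (volume : Measure (Rn N)) ×
      Lp (EuclideanSpace 𝕜 (Fin N)) 2 (volume : Measure (Rn N)))) where
  carrier := {p | HasWeakGradient (p.fst : Rn N → 𝕜) (p.snd : Rn N → EuclideanSpace 𝕜 (Fin N))}
  zero_mem' := by
    intro φ _ _ i
    have h1 : ∫ x, (fderiv ℝ φ x (EuclideanSpace.single i 1)) •
        ((0 : Lp 𝕜 2 (volume : Measure (Rn N))) : Rn N → 𝕜) x = 0 := by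
      simp
    have h2 : ∫ x, φ x • ((0 : Lp (EuclideanSpace 𝕜 (Fin N)) 2 (volume : Measure (Rn N))) :
        Rn N → EuclideanSpace 𝕜 (Fin N)) x i = 0 := by
      simp
    simp only [WithLp.zero_fst, WithLp.zero_snd]
    rw [h1, h2, neg_zero]
  add_mem' := by
    intro a b ha hb φ hφ hc i
    have hd := continuous_fderiv_dir hφ (EuclideanSpace.single i 1)
    have hdc : HasCompactSupport fun x => fderiv ℝ φ x (EuclideanSpace.single i 1) :=
      hc.fderiv_apply (𝕜 := ℝ) _
    have h1 : ∫ x, (fderiv ℝ φ x (EuclideanSpace.single i 1)) • (a + b).fst x =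
        ∫ x, ((fderiv ℝ φ x (EuclideanSpace.single i 1)) • a.fst x +
          (fderiv ℝ φ x (EuclideanSpace.single i 1)) • b.fst x) := by
      refine integral_congr_ae ?_
      rw [WithLp.add_fst]
      filter_upwards [Lp.coeFn_add a.fst b.fst] with x hx
      simp only [hx, Pi.add_apply, smul_add]
    have h2 : ∫ x, φ x • (a + b).snd x i = ∫ x, (φ x • a.snd x i + φ x • b.snd x i) := by
      refine integral_congr_ae ?_
      rw [WithLp.add_snd]
      filter_upwards [Lp.coeFn_add a.snd b.snd] with x hx
      simp only [hx, Pi.add_apply, PiLp.add_apply, smul_add]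
    rw [h1, h2, integral_add (integrable_smul_of_Lp _ hd hdc) (integrable_smul_of_Lp _ hd hdc),
      integral_add (integrable_smul_coord_of_Lp _ hφ.continuous hc i)
        (integrable_smul_coord_of_Lp _ hφ.continuous hc i), ha φ hφ hc i, hb φ hφ hc i, neg_add]
  smul_mem' := by
    intro k a ha φ hφ hc i
    have h1 : ∫ x, (fderiv ℝ φ x (EuclideanSpace.single i 1)) • (k • a).fst x =
        ∫ x, k • ((fderiv ℝ φ x (EuclideanSpace.single i 1)) • a.fst x) := by
      refine integral_congr_ae ?_
      rw [WithLp.smul_fst]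
      filter_upwards [Lp.coeFn_smul k a.fst] with x hx
      simp only [hx, Pi.smul_apply]
      rw [smul_comm]
    have h2 : ∫ x, φ x • (k • a).snd x i = ∫ x, k • (φ x • a.snd x i) := by
      refine integral_congr_ae ?_
      rw [WithLp.smul_snd]
      filter_upwards [Lp.coeFn_smul k a.snd] with x hx
      simp only [hx, Pi.smul_apply, PiLp.smul_apply]
      rw [smul_comm]
    rw [h1, h2, integral_smul, integral_smul, ha φ hφ hc i, smul_neg]

/-- The Sobolev space `H¹(ℝ^N) = H¹(ℝ^N, 𝕜)`, for `𝕜 = ℝ` or `𝕜 = ℂ`, with its `H¹` norm. -/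
abbrev H1 (𝕜 : Type*) [RCLike 𝕜] (N : ℕ) : Type _ := sobolevSubmodule 𝕜 N

variable {𝕜 : Type*} [RCLike 𝕜] {N : ℕ}

namespace H1

/-- The underlying (almost everywhere defined) function of `u ∈ H¹(ℝ^N)`. -/
def fn (u : H1 𝕜 N) : Rn N → 𝕜 := (u : WithLp 2 (Lp 𝕜 2 (volume : Measure (Rn N)) ×
  Lp (EuclideanSpace 𝕜 (Fin N)) 2 (volume : Measure (Rn N)))).fst

/-- The weak gradient of `u ∈ H¹(ℝ^N)`. -/
def grad (u : H1 𝕜 N) : Rn N → EuclideanSpace 𝕜 (Fin N) :=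
  (u : WithLp 2 (Lp 𝕜 2 (volume : Measure (Rn N)) ×
    Lp (EuclideanSpace 𝕜 (Fin N)) 2 (volume : Measure (Rn N)))).snd

/-- The norm `‖u‖_p` of `L^p(ℝ^N)`, for a real exponent `p`. -/
def normLp (u : H1 𝕜 N) (p : ℝ) : ℝ := lpNorm u.fn (ENNReal.ofReal p) volume

/-- The norm `‖∇u‖₂`. -/
def normGrad (u : H1 𝕜 N) : ℝ := lpNorm u.grad 2 volume

/-- `u` is radially symmetric with respect to `0`: `u(x) = f(|x|)` for almost every `x`. -/
def IsRadial (u : H1 𝕜 N) : Prop := ∃ f : ℝ → 𝕜, u.fn =ᵐ[volume] fun x => f ‖x‖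

end H1

/-! ### Exponents, best constants, and the thresholds `c₀`, `ρ₀` -/

/-- The critical Sobolev exponent `2* = 2N/(N-2)`. -/
def critExp (N : ℕ) : ℝ := 2 * N / (N - 2)

variable (𝕜 N) in
/-- The best constant `𝓢` in the Sobolev inequality `𝓢 ‖f‖_{2*}² ≤ ‖∇f‖₂²` on the homogeneous
space of all `f ∈ L^{2*}(ℝ^N)` with weak gradient in `L²`. -/
def sobolevConst : ℝ :=
  sSup {s : ℝ | ∀ (f : Rn N → 𝕜) (g : Rn N → EuclideanSpace 𝕜 (Fin N)),
    MemLp f (ENNReal.ofReal (critExp N)) volume → MemLp g 2 volume → HasWeakGradient f g →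
      s * lpNorm f (ENNReal.ofReal (critExp N)) volume ^ 2 ≤ lpNorm g 2 volume ^ 2}

variable (𝕜 N) in
/-- The best constant `C_{N,q}` in the Gagliardo-Nirenberg inequality
`‖f‖_q ≤ C ‖∇f‖₂^β ‖f‖₂^(1-β)`, `β = N (1/2 - 1/q)`, on `H¹(ℝ^N)`. (The inequality is written in
`[0,∞]`, so that it contains the finiteness of `‖f‖_q`.) -/
def gagliardoNirenbergConst (q : ℝ) : ℝ :=
  sInf {C : ℝ | 0 ≤ C ∧ ∀ f : H1 𝕜 N,
    eLpNorm f.fn (ENNReal.ofReal q) volume ≤ ENNReal.ofReal (C *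
      f.normGrad ^ ((N : ℝ) * (1 / 2 - 1 / q)) *
      f.normLp 2 ^ (1 - (N : ℝ) * (1 / 2 - 1 / q)))}

/-- The exponent `α₀ = N(q-2)/2 - 2`. -/
def α₀ (N : ℕ) (q : ℝ) : ℝ := N * (q - 2) / 2 - 2

/-- The exponent `α₁ = 4/(N-2)`. -/
def α₁ (N : ℕ) : ℝ := 4 / ((N : ℝ) - 2)

/-- The exponent `α₂ = q - N(q-2)/2`. -/
def α₂ (N : ℕ) (q : ℝ) : ℝ := q - N * (q - 2) / 2

variable (𝕜 N) in
/-- `B = -(α₀/α₁) · (μ/q) C_{N,q}^q · 2* 𝓢^{2*/2}`. -/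
def constB (μ q : ℝ) : ℝ :=
  -(α₀ N q / α₁ N) * (μ / q * gagliardoNirenbergConst 𝕜 N q ^ q) *
    (critExp N * sobolevConst 𝕜 N ^ (critExp N / 2))

variable (𝕜 N) in
/-- `K = (μ/q) C_{N,q}^q B^{α₀/(α₁-α₀)} + (1/2*) 𝓢^{-2*/2} B^{α₁/(α₁-α₀)}`. -/
def constK (μ q : ℝ) : ℝ :=
  μ / q * gagliardoNirenbergConst 𝕜 N q ^ q * constB 𝕜 N μ q ^ (α₀ N q / (α₁ N - α₀ N q)) +
    1 / (critExp N * sobolevConst 𝕜 N ^ (critExp N / 2)) *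
      constB 𝕜 N μ q ^ (α₁ N / (α₁ N - α₀ N q))

variable (𝕜 N) in
/-- The explicit mass threshold `c₀ = c₀(μ) = (1/(2K))^{N/2}`. Here `1/2 - K c^{2/N}` is the
maximum over `ρ > 0` of
`f(c, ρ) = 1/2 - (μ/q) C_{N,q}^q ρ^{α₀/2} c^{α₂/2} - (1/2*) 𝓢^{-2*/2} ρ^{α₁/2}`, and
`F_μ(u) ≥ ‖∇u‖₂² f(‖u‖₂², ‖∇u‖₂²)`. -/
def c₀ (μ q : ℝ) : ℝ := (1 / (2 * constK 𝕜 N μ q)) ^ ((N : ℝ) / 2)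

variable (𝕜 N) in
/-- The gradient threshold `ρ₀ = B^{2/(α₁-α₀)} c₀^{α₂/(α₁-α₀)}`, the maximum point of
`ρ ↦ f(c₀, ρ)`. -/
def ρ₀ (μ q : ℝ) : ℝ :=
  constB 𝕜 N μ q ^ (2 / (α₁ N - α₀ N q)) * c₀ 𝕜 N μ q ^ (α₂ N q / (α₁ N - α₀ N q))

/-! ### The functionals and the sets of the variational problem -/

/-- The energy `F_μ(u) = ½ ‖∇u‖₂² - (μ/q) ‖u‖_q^q - (1/2*) ‖u‖_{2*}^{2*}`. -/
def F (μ q : ℝ) (u : H1 𝕜 N) : ℝ :=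
  1 / 2 * u.normGrad ^ 2 - μ / q * u.normLp q ^ q -
    1 / critExp N * u.normLp (critExp N) ^ critExp N

/-- `γ_q = N(q-2)/(2q)`. -/
def γ (N : ℕ) (q : ℝ) : ℝ := N * (q - 2) / (2 * q)

/-- The Pohozaev functional `Q_μ(u) = ‖∇u‖₂² - μ γ_q ‖u‖_q^q - ‖u‖_{2*}^{2*}`. -/
def Q (μ q : ℝ) (u : H1 𝕜 N) : ℝ :=
  u.normGrad ^ 2 - μ * γ N q * u.normLp q ^ q - u.normLp (critExp N) ^ critExp N

variable (𝕜 N) in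
/-- The mass constraint `S(c) = {u ∈ H¹(ℝ^N) : ‖u‖₂² = c}`. -/
def S (c : ℝ) : Set (H1 𝕜 N) := {u | u.normLp 2 ^ 2 = c}

variable (𝕜 N) in
/-- `V(c) = {u ∈ S(c) : ‖∇u‖₂² < ρ₀}`. -/
def V (μ q c : ℝ) : Set (H1 𝕜 N) := {u ∈ S 𝕜 N c | u.normGrad ^ 2 < ρ₀ 𝕜 N μ q}

variable (𝕜 N) in
/-- The ground state level `m(c) = inf_{V(c)} F_μ`. -/
def m (μ q c : ℝ) : ℝ := sInf (F μ q '' V 𝕜 N μ q c)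

variable (𝕜 N) in
/-- `E_c = {u ∈ S(c) : F_μ(u) < 2 m(c)}`. -/
def E (μ q c : ℝ) : Set (H1 𝕜 N) := {u ∈ S 𝕜 N c | F μ q u < 2 * m 𝕜 N μ q c}

variable (𝕜 N) in
/-- `Λ(c) = {u ∈ S(c) : Q_μ(u) = 0}`. -/
def Λ (μ q c : ℝ) : Set (H1 𝕜 N) := {u ∈ S 𝕜 N c | Q μ q u = 0}

variable (𝕜 N) in
/-- `Λ⁻(c) = {u ∈ Λ(c) : F_μ(u) < 0}`. -/
def Λminus (μ q c : ℝ) : Set (H1 𝕜 N) := {u ∈ Λ 𝕜 N μ q c | F μ q u < 0}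

variable (𝕜 N) in
/-- `Λ⁺(c) = {u ∈ Λ(c) : F_μ(u) > 0}`. -/
def Λplus (μ q c : ℝ) : Set (H1 𝕜 N) := {u ∈ Λ 𝕜 N μ q c | 0 < F μ q u}

variable (𝕜 N) in
/-- The radial paths `Γ⁰(c)`: continuous `g : [0,∞) → S_r(c)` with `g(0) ∈ Λ⁻_r(c)` and
`g(t) ∈ E_c` for all large `t`. -/
def Γ0 (μ q c : ℝ) : Set C(ℝ≥0, H1 𝕜 N) :=
  {g | (∀ t, g t ∈ S 𝕜 N c ∧ (g t).IsRadial) ∧ g 0 ∈ Λminus 𝕜 N μ q c ∧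
    ∃ t₁, ∀ t ≥ t₁, g t ∈ E 𝕜 N μ q c}

variable (𝕜 N) in
/-- The paths `Γ(c)`: continuous `h : [0,∞) → S(c)` with `h(0) ∈ V(c) ∩ {F_μ < 0}` and
`h(t) ∈ E_c` for all large `t`. -/
def Γ (μ q c : ℝ) : Set C(ℝ≥0, H1 𝕜 N) :=
  {h | (∀ t, h t ∈ S 𝕜 N c) ∧ (h 0 ∈ V 𝕜 N μ q c ∧ F μ q (h 0) < 0) ∧
    ∃ t₁, ∀ t ≥ t₁, h t ∈ E 𝕜 N μ q c}

/-- The set of the numbers `max_{t ∈ [0,∞)} F_μ(h(t))`, where `h` runs through a set of paths. -/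
def pathMaxima (μ q : ℝ) (P : Set C(ℝ≥0, H1 𝕜 N)) : Set ℝ :=
  (fun h : C(ℝ≥0, H1 𝕜 N) => ⨆ t : ℝ≥0, F μ q (h t)) '' P

variable (𝕜 N) in
/-- The radial mountain pass level `M⁰(c) = inf_{g ∈ Γ⁰(c)} max_{t ≥ 0} F_μ(g(t))`. -/
def M0 (μ q c : ℝ) : ℝ := sInf (pathMaxima μ q (Γ0 𝕜 N μ q c))

variable (𝕜 N) in
/-- The mountain pass level `M(c) = inf_{h ∈ Γ(c)} max_{t ≥ 0} F_μ(h(t))`. -/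
def M (μ q c : ℝ) : ℝ := sInf (pathMaxima μ q (Γ 𝕜 N μ q c))

end NormalizedNLS

end

open NormalizedNLS

noncomputable section
namespace NormalizedNLS
open Filter Topology

/-! ### The fibre function `s ↦ A s² / 2 - a s^p - b s^r` -/

/-! The dilation u ↦ s^{N/2} u(s·) stays on S(c) and turns the energy into A s²/2 − a s^p − b s^r
with A, a, b > 0 and p = N(q−2)/2 < 2 < r = 2*; s times the derivative of this function is Q_μ of
the dilated function. The Gagliardo–Nirenberg and Sobolev inequalities bound F_μ(u) from below by
‖∇u‖₂² f(c, ‖∇u‖₂²), and c₀, ρ₀ are such that f(c₀, ρ₀) = 0. For c < c₀ the energy is therefore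
positive wherever ‖∇u‖₂² = ρ₀ (`exists_barrier`). Each fibre meets that level, so its energy is
positive somewhere, and this forces exactly two critical points s₁ < s₂ (`exists_fiberShape`): a
local minimum of negative energy inside V(c), and a global maximum of positive energy. Hence Λ⁺(c)
consists exactly of the maximum points of the fibres.

Lower bound: a path of Γ(c) starts at a point with s₂ > 1 and reaches points with s₂ < 1. Both
conditions are open along the path, so by connectedness s₂ = 1 somewhere, which means that the path
meets Λ⁺(c) (`exists_mem_Λplus_of_mem_Γ`). This gives inf F_μ(Λ⁺) ≤ M, while M ≤ M⁰ because Γ⁰ ⊂ Γ.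

Upper bound: for u in Λ⁺(c) there is a radial v of the same mass whose gradient is almost no larger
and whose potential terms are almost no smaller (`exists_radial_mem_S`). The maximum of the fibre of
v then exceeds F_μ(u) by at most ε (`exists_fiber_le_add`), and the dilations of v from s₁ on form a
path of Γ⁰(c). Thus M⁰ ≤ inf F_μ(Λ⁺).

The radial competitor comes from polarization. After approximating u by a smooth φ with compact
support, one considers the nonnegative Lipschitz functions in a fixed ball having the L^p norms of φ
and at most its Dirichlet energy. This class is compact and stable under reflecting mass towards the
origin across a hyperplane; a minimizer of ∫ v|x|² over it cannot be improved by any such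
polarization, so it is radial (`exists_radial_mem_energyClass`). -/

/-- The energy along the mass preserving dilations. -/
def fiber (p r A a b s : ℝ) : ℝ := A * s ^ 2 / 2 - a * s ^ p - b * s ^ r

/-- The Pohozaev functional along the mass preserving dilations. -/
def fiberQ (p r A a b s : ℝ) : ℝ := A * s ^ 2 - p * a * s ^ p - r * b * s ^ r

/-- This is the link between the two functionals: zeros of the Pohozaev functional on a fibre are
critical points of the energy, and its sign is the sign of the slope. -/
theorem hasDerivAt_fiber {p r A a b s : ℝ} (hs : 0 < s) :
    HasDerivAt (fiber p r A a b) (fiberQ p r A a b s / s) s := by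
  have h1 : HasDerivAt (fun s : ℝ => A * s ^ 2 / 2) (A * (2 * s) / 2) s := by
    simpa using (((hasDerivAt_pow 2 s).const_mul A).div_const 2)
  have h2 := (Real.hasDerivAt_rpow_const (p := p) (Or.inl hs.ne')).const_mul a
  have h3 := (Real.hasDerivAt_rpow_const (p := r) (Or.inl hs.ne')).const_mul b
  have h := (h1.sub h2).sub h3
  refine h.congr_deriv ?_
  rw [Real.rpow_sub_one hs.ne', Real.rpow_sub_one hs.ne', fiberQ]
  field_simp

theorem continuous_fiber {p r A a b : ℝ} (hp : 0 < p) (hr : 0 < r) :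
    Continuous (fiber p r A a b) := by
  have h2 := Real.continuous_rpow_const hp.le
  have h3 := Real.continuous_rpow_const hr.le
  unfold fiber
  fun_prop

theorem continuous_fiberQ {p r A a b : ℝ} (hp : 0 < p) (hr : 0 < r) :
    Continuous (fiberQ p r A a b) := by
  have h2 := Real.continuous_rpow_const hp.le
  have h3 := Real.continuous_rpow_const hr.le
  unfold fiberQ
  fun_prop

theorem fiber_zero {p r A a b : ℝ} (hp : 0 < p) (hr : 0 < r) : fiber p r A a b 0 = 0 := by
  simp [fiber, Real.zero_rpow hp.ne', Real.zero_rpow hr.ne']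

/-- A strictly concave function on `[0,∞)` which is negative, then positive, then negative, has
exactly two sign changes. -/
theorem exists_two_zeros_of_strictConcaveOn {G : ℝ → ℝ} (hG : StrictConcaveOn ℝ (Ici 0) G)
    (hc : Continuous G) {x₀ x₁ : ℝ} (h0 : G 0 < 0) (hx₀ : 0 < x₀) (hGx₀ : 0 < G x₀) (hx₁ : x₀ < x₁)
    (hGx₁ : G x₁ < 0) :
    ∃ y z, 0 < y ∧ y < z ∧ (∀ x, 0 < x → x < y → G x < 0) ∧ (∀ x, y < x → x < z → 0 < G x) ∧
      ∀ x, z < x → G x < 0 := by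
  obtain ⟨y, ⟨hy0, hyx⟩, hy⟩ : (0 : ℝ) ∈ G '' Ioo 0 x₀ :=
    intermediate_value_Ioo hx₀.le hc.continuousOn ⟨h0, hGx₀⟩
  obtain ⟨z, ⟨hxz, hz1⟩, hz⟩ : (0 : ℝ) ∈ G '' Ioo x₀ x₁ :=
    intermediate_value_Ioo' hx₁.le hc.continuousOn ⟨hGx₁, hGx₀⟩
  -- Strict quasiconcavity is all that is used of concavity: a wrong sign at some point would put y
  -- or z between two points where `G` is nonnegative although `G` vanishes there.
  have key : ∀ u v w : ℝ, 0 ≤ u → u < v → v < w → min (G u) (G w) < G v := by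
    intro u v w hu huv hvw
    have hw : 0 < w - u := by linarith
    have := hG.2 (show u ∈ Ici (0 : ℝ) from hu) (show w ∈ Ici (0 : ℝ) by simp; linarith)
      (by linarith) (div_pos (sub_pos.2 hvw) hw) (div_pos (sub_pos.2 huv) hw)
      (by field_simp; ring)
    have e : ((w - v) / (w - u)) • u + ((v - u) / (w - u)) • w = v := by
      simp only [smul_eq_mul]; field_simp; ring
    rw [e] at this
    refine lt_of_le_of_lt ?_ this
    have hs : (w - v) / (w - u) + (v - u) / (w - u) = 1 := by field_simp; ring
    have h1 : 0 ≤ (w - v) / (w - u) := div_nonneg (by linarith) hw.le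
    have h2 : 0 ≤ (v - u) / (w - u) := div_nonneg (by linarith) hw.le
    simp only [smul_eq_mul]
    calc min (G u) (G w) = (w - v) / (w - u) * min (G u) (G w)
          + (v - u) / (w - u) * min (G u) (G w) := by rw [← add_mul, hs, one_mul]
      _ ≤ _ := by
        gcongr
        · exact min_le_left _ _
        · exact min_le_right _ _
  refine ⟨y, z, hy0, hyx.trans hxz, ?_, ?_, ?_⟩
  · intro x hx hxy
    by_contra! h
    have := key x y x₀ hx.le hxy hyx
    rw [hy] at this
    exact absurd this (not_lt.2 (le_min h hGx₀.le))
  · intro x hx hxz'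
    have := key y x z hy0.le hx hxz'
    simpa [hy, hz] using this
  · intro x hx
    by_contra! h
    have := key x₀ z x hx₀.le hxz hx
    rw [hz] at this
    exact absurd this (not_lt.2 (le_min hGx₀.le h))

/-- The supercritical power r > 2 beats the quadratic term. This is what drives the path of
dilations into E_c. -/
theorem tendsto_fiber_atBot {p r A a b : ℝ} (hr : 2 < r) (ha : 0 ≤ a) (hb : 0 < b) :
    Tendsto (fiber p r A a b) atTop atBot := by
  have h1 : Tendsto (fun s : ℝ => s ^ 2 * (A / 2 - b * s ^ (r - 2))) atTop atBot := by
    refine (tendsto_pow_atTop (two_ne_zero)).atTop_mul_atBot₀ ?_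
    refine tendsto_atBot_add_const_left _ (A / 2) ?_ |>.congr (fun s => (sub_eq_add_neg _ _).symm)
    refine tendsto_neg_atTop_atBot.comp ?_
    exact (tendsto_rpow_atTop (by linarith)).const_mul_atTop hb
  refine tendsto_atBot_mono' _ ?_ h1
  filter_upwards [eventually_gt_atTop 0] with s hs
  have h2 : s ^ r = s ^ 2 * s ^ (r - 2) := by
    rw [← Real.rpow_natCast, ← Real.rpow_add hs]; congr 1; push_cast; ring
  have h3 : 0 ≤ a * s ^ p := by positivity
  simp only [fiber, h2]
  nlinarith

/-- The geometry of the fibre function when it is positive somewhere. -/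
structure FiberShape (p r A a b s₁ s₂ : ℝ) : Prop where
  pos : 0 < s₁
  lt : s₁ < s₂
  neg_left : ∀ s, 0 < s → s < s₁ → fiberQ p r A a b s < 0
  pos_mid : ∀ s, s₁ < s → s < s₂ → 0 < fiberQ p r A a b s
  neg_right : ∀ s, s₂ < s → fiberQ p r A a b s < 0

/-- Dividing `fiberQ` by s^p and substituting x = s^{2−p} leaves A x − p a − r b x^θ with θ =
(r−p)/(2−p) > 1, a strictly concave function of x. It is negative at 0 and for large x, and positive
somewhere because the energy climbs from 0 to a positive value. -/
theorem exists_fiberShape {p r A a b s₀ : ℝ} (hp : 0 < p) (hp2 : p < 2) (hr : 2 < r)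
    (ha : 0 < a) (hb : 0 < b) (hs₀ : 0 < s₀) (hpos : 0 < fiber p r A a b s₀) :
    ∃ s₁ s₂, FiberShape p r A a b s₁ s₂ := by
  have h2p : 0 < 2 - p := by linarith
  set θ := (r - p) / (2 - p) with hθ
  have hθ1 : 1 < θ := by rw [hθ, one_lt_div h2p]; linarith
  set G : ℝ → ℝ := fun x => A * x - p * a - r * b * x ^ θ with hGdef
  have hrb : 0 < r * b := by positivity
  have hGc : StrictConcaveOn ℝ (Ici 0) G := by
    have h1 : StrictConcaveOn ℝ (Ici 0) (fun x : ℝ => -(x ^ θ)) := (strictConvexOn_rpow hθ1).neg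
    refine ⟨convex_Ici 0, fun x hx y hy hxy u v hu hv huv => ?_⟩
    have h2 := h1.2 hx hy hxy hu hv huv
    simp only [hGdef, smul_eq_mul] at h2 ⊢
    have h3 := mul_lt_mul_of_pos_left h2 hrb
    have h4 : u * (p * a) + v * (p * a) = p * a := by rw [← add_mul, huv, one_mul]
    nlinarith
  have hGcont : Continuous G := by
    have := Real.continuous_rpow_const (q := θ) (by linarith)
    simp only [hGdef]
    fun_prop
  have hrel : ∀ s : ℝ, 0 < s → fiberQ p r A a b s = s ^ p * G (s ^ (2 - p)) := by
    intro s hs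
    have e1 : (s ^ (2 - p)) ^ θ = s ^ (r - p) := by
      rw [← Real.rpow_mul hs.le, hθ]; congr 1; field_simp
    have e2 : s ^ r = s ^ p * s ^ (r - p) := by rw [← Real.rpow_add hs]; congr 1; ring
    have e3 : s ^ 2 = s ^ p * s ^ (2 - p) := by
      rw [← Real.rpow_add hs, ← Real.rpow_natCast]; congr 1; push_cast; ring
    simp only [hGdef, fiberQ, e1, e2, e3]
    ring
  have hsign : ∀ x : ℝ, 0 < x → ∃ s, 0 < s ∧ s ^ (2 - p) = x := fun x hx =>
    ⟨x ^ (2 - p)⁻¹, by positivity, by rw [← Real.rpow_mul hx.le, inv_mul_cancel₀ h2p.ne',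
      Real.rpow_one]⟩
  -- The mean value theorem on [0, s₀] yields a point of positive slope, that is, of positive
  -- `fiberQ`.
  obtain ⟨ξ, ⟨hξ0, hξ1⟩, hξ⟩ := exists_hasDerivAt_eq_slope (fiber p r A a b)
    (fun s => fiberQ p r A a b s / s) hs₀ (continuous_fiber hp (by linarith)).continuousOn
    (fun x hx => hasDerivAt_fiber hx.1)
  have hQξ : 0 < fiberQ p r A a b ξ := by
    rw [fiber_zero hp (by linarith)] at hξ
    have : 0 < fiberQ p r A a b ξ / ξ := by rw [hξ]; apply div_pos <;> linarith
    exact (div_pos_iff_of_pos_right hξ0).1 this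
  have hGx₀ : 0 < G (ξ ^ (2 - p)) := by
    rw [hrel ξ hξ0] at hQξ
    exact pos_of_mul_pos_right hQξ (by positivity)
  have hG0 : G 0 < 0 := by
    simp only [hGdef, Real.zero_rpow (by linarith : θ ≠ 0)]
    nlinarith [mul_pos hp ha]
  obtain ⟨x₁, hx₁, hGx₁⟩ : ∃ x₁, ξ ^ (2 - p) < x₁ ∧ G x₁ < 0 := by
    have h1 : Tendsto (fun x : ℝ => x * (A - r * b * x ^ (θ - 1))) atTop atBot := by
      refine tendsto_id.atTop_mul_atBot₀ ?_
      refine tendsto_atBot_add_const_left _ A ?_ |>.congr (fun s => (sub_eq_add_neg _ _).symm)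
      refine tendsto_neg_atTop_atBot.comp ?_
      exact (tendsto_rpow_atTop (by linarith)).const_mul_atTop hrb
    obtain ⟨x, hx, hx1, hx2⟩ := ((h1.eventually (eventually_lt_atBot 0)).and
      ((eventually_gt_atTop (ξ ^ (2 - p))).and (eventually_gt_atTop 0))).exists
    refine ⟨x, hx1, ?_⟩
    have e : x ^ θ = x * x ^ (θ - 1) := by
      rw [← Real.rpow_one_add' hx2.le (by linarith)]; congr 1; ring
    simp only [hGdef, e]
    nlinarith [mul_pos hp ha]
  obtain ⟨y, z, hy, hyz, hl, hm, hr'⟩ := exists_two_zeros_of_strictConcaveOn hGc hGcont hG0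
    (by positivity) hGx₀ hx₁ hGx₁
  obtain ⟨s₁, hs₁, rfl⟩ := hsign y hy
  obtain ⟨s₂, hs₂, rfl⟩ := hsign z (hy.trans hyz)
  refine ⟨s₁, s₂, hs₁, (Real.rpow_lt_rpow_iff hs₁.le hs₂.le h2p).1 hyz, ?_, ?_, ?_⟩
  · intro s hs hlt
    rw [hrel s hs]
    exact mul_neg_of_pos_of_neg (by positivity)
      (hl _ (by positivity) (Real.rpow_lt_rpow hs.le hlt h2p))
  · intro s h1 h2
    have hs := hs₁.trans h1
    rw [hrel s hs]
    exact mul_pos (by positivity)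
      (hm _ (Real.rpow_lt_rpow hs₁.le h1 h2p) (Real.rpow_lt_rpow hs.le h2 h2p))
  · intro s h1
    have hs := hs₂.trans h1
    rw [hrel s hs]
    exact mul_neg_of_pos_of_neg (by positivity) (hr' _ (Real.rpow_lt_rpow hs₂.le h1 h2p))

namespace FiberShape

variable {p r A a b s₁ s₂ : ℝ}

theorem strictAntiOn_left (h : FiberShape p r A a b s₁ s₂) (hp : 0 < p) (hr : 0 < r) :
    StrictAntiOn (fiber p r A a b) (Icc 0 s₁) := by
  refine strictAntiOn_of_deriv_neg (convex_Icc _ _) (continuous_fiber hp hr).continuousOn ?_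
  intro x hx
  rw [interior_Icc] at hx
  rw [(hasDerivAt_fiber hx.1).deriv]
  exact div_neg_of_neg_of_pos (h.neg_left x hx.1 hx.2) hx.1

theorem strictMonoOn_mid (h : FiberShape p r A a b s₁ s₂) (hp : 0 < p) (hr : 0 < r) :
    StrictMonoOn (fiber p r A a b) (Icc s₁ s₂) := by
  refine strictMonoOn_of_deriv_pos (convex_Icc _ _) (continuous_fiber hp hr).continuousOn ?_
  intro x hx
  rw [interior_Icc] at hx
  have hx0 := h.pos.trans hx.1
  rw [(hasDerivAt_fiber hx0).deriv]
  exact div_pos (h.pos_mid x hx.1 hx.2) hx0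

theorem strictAntiOn_right (h : FiberShape p r A a b s₁ s₂) (hp : 0 < p) (hr : 0 < r) :
    StrictAntiOn (fiber p r A a b) (Ici s₂) := by
  refine strictAntiOn_of_deriv_neg (convex_Ici _) (continuous_fiber hp hr).continuousOn ?_
  intro x hx
  rw [interior_Ici] at hx
  have hx0 := (h.pos.trans h.lt).trans hx
  rw [(hasDerivAt_fiber hx0).deriv]
  exact div_neg_of_neg_of_pos (h.neg_right x hx) hx0

theorem fiber_neg (h : FiberShape p r A a b s₁ s₂) (hp : 0 < p) (hr : 0 < r) {s : ℝ} (hs : 0 < s)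
    (hs₁ : s ≤ s₁) : fiber p r A a b s < 0 := by
  have := h.strictAntiOn_left hp hr ⟨le_rfl, h.pos.le⟩ ⟨hs.le, hs₁⟩ hs
  rwa [fiber_zero hp hr] at this

/-- Beyond s₁ the monotonicity makes s₂ a maximum point. Up to s₁ the energy is negative, hence
below the value at s₂ once the energy is positive at some s', which must lie beyond s₁. -/
theorem fiber_le (h : FiberShape p r A a b s₁ s₂) (hp : 0 < p) (hr : 0 < r) {s s' : ℝ}
    (hs : 0 < s) (hs' : 0 < s') (hpos : 0 < fiber p r A a b s') :
    fiber p r A a b s ≤ fiber p r A a b s₂ := by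
  have hmid := (h.strictMonoOn_mid hp hr).monotoneOn
  have hright := (h.strictAntiOn_right hp hr).antitoneOn
  have h1 : ∀ t, s₁ ≤ t → fiber p r A a b t ≤ fiber p r A a b s₂ := by
    intro t ht
    rcases le_total t s₂ with h2 | h2
    · exact hmid ⟨ht, h2⟩ ⟨h.lt.le, le_rfl⟩ h2
    · exact hright self_mem_Ici h2 h2
  rcases le_total s s₁ with h2 | h2
  · refine (h.fiber_neg hp hr hs h2).le.trans (hpos.le.trans (h1 s' ?_))
    by_contra! h3
    exact (h.fiber_neg hp hr hs' h3.le).not_gt hpos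
  · exact h1 s h2

theorem fiberQ_left (h : FiberShape p r A a b s₁ s₂) (hp : 0 < p) (hr : 0 < r) :
    fiberQ p r A a b s₁ = 0 := by
  have hc := continuous_fiberQ (A := A) (a := a) (b := b) hp hr
  refine le_antisymm ?_ ?_
  · refine le_of_tendsto (hc.tendsto s₁ |>.mono_left nhdsWithin_le_nhds)
      (?_ : ∀ᶠ s in 𝓝[<] s₁, _)
    filter_upwards [Ioo_mem_nhdsLT h.pos] with s hs using (h.neg_left s hs.1 hs.2).le
  · refine ge_of_tendsto (hc.tendsto s₁ |>.mono_left nhdsWithin_le_nhds)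
      (?_ : ∀ᶠ s in 𝓝[>] s₁, _)
    filter_upwards [Ioo_mem_nhdsGT h.lt] with s hs using (h.pos_mid s hs.1 hs.2).le

theorem fiberQ_right (h : FiberShape p r A a b s₁ s₂) (hp : 0 < p) (hr : 0 < r) :
    fiberQ p r A a b s₂ = 0 := by
  have hc := continuous_fiberQ (A := A) (a := a) (b := b) hp hr
  refine le_antisymm ?_ ?_
  · refine le_of_tendsto (hc.tendsto s₂ |>.mono_left nhdsWithin_le_nhds)
      (?_ : ∀ᶠ s in 𝓝[>] s₂, _)
    filter_upwards [self_mem_nhdsWithin] with s hs using (h.neg_right s hs).le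
  · refine ge_of_tendsto (hc.tendsto s₂ |>.mono_left nhdsWithin_le_nhds)
      (?_ : ∀ᶠ s in 𝓝[<] s₂, _)
    filter_upwards [Ioo_mem_nhdsLT h.lt] with s hs using (h.pos_mid s hs.1 hs.2).le

end FiberShape

/-- The maximum of the fibre function is upper semicontinuous in its coefficients. -/
theorem exists_fiber_le_add {p r A a b L ε : ℝ} (hp : 0 < p) (hr : 2 < r) (hA : 0 < A)
    (hb : 0 < b) (hL : 0 ≤ L) (hε : 0 < ε) (hmax : ∀ s, 0 < s → fiber p r A a b s ≤ L) :
    ∃ δ > 0, ∀ A' a' b', A' ≤ A + δ → a - δ ≤ a' → b - δ ≤ b' → 0 ≤ a' → ∀ s, 0 < s →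
      fiber p r A' a' b' s ≤ L + ε := by
  -- For s ≥ T the perturbed energy is nonpositive: b' ≥ b/2 and A' ≤ A + 1 give b' s^{r−2} ≥ A'/2.
  -- For s ≤ T the three coefficient errors add at most δ (T²/2 + T^p + T^r).
  set T : ℝ := ((A + 1) / b) ^ (r - 2)⁻¹ with hT
  have hr2 : 0 < r - 2 := by linarith
  have hT0 : 0 < T := by positivity
  set C := T ^ 2 / 2 + T ^ p + T ^ r with hC
  have hC0 : 0 < C := by positivity
  refine ⟨min 1 (min (b / 2) (ε / C)), by positivity, ?_⟩
  intro A' a' b' hA' ha' hb' ha'0 s hs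
  set δ := min 1 (min (b / 2) (ε / C)) with hδ
  have hδ1 : δ ≤ 1 := min_le_left _ _
  have hδ2 : δ ≤ b / 2 := (min_le_right _ _).trans (min_le_left _ _)
  have hδ3 : δ * C ≤ ε := (le_div_iff₀ hC0).1 ((min_le_right _ _).trans (min_le_right _ _))
  rcases le_total s T with hsT | hsT
  · have h1 := hmax s hs
    have h2 : s ^ 2 ≤ T ^ 2 := by gcongr
    have h3 : s ^ p ≤ T ^ p := by gcongr
    have h4 : s ^ r ≤ T ^ r := by gcongr
    have h2' : 0 < s ^ 2 := by positivity
    have h3' : 0 < s ^ p := by positivity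
    have h4' : 0 < s ^ r := by positivity
    have hδ0 : 0 < δ := by positivity
    have k1 : A' * s ^ 2 ≤ A * s ^ 2 + δ * T ^ 2 := by nlinarith
    have k2 : a * s ^ p - δ * T ^ p ≤ a' * s ^ p := by nlinarith
    have k3 : b * s ^ r - δ * T ^ r ≤ b' * s ^ r := by nlinarith
    simp only [fiber] at h1 ⊢
    have k4 : δ * C = δ * T ^ 2 / 2 + δ * T ^ p + δ * T ^ r := by rw [hC]; ring
    linarith
  · have h1 : (A + 1) / b ≤ s ^ (r - 2) := by
      calc (A + 1) / b = T ^ (r - 2) := by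
            rw [hT, ← Real.rpow_mul (by positivity), inv_mul_cancel₀ hr2.ne', Real.rpow_one]
        _ ≤ _ := by gcongr
    have h2 : s ^ r = s ^ 2 * s ^ (r - 2) := by
      rw [← Real.rpow_natCast, ← Real.rpow_add hs]; congr 1; push_cast; ring
    rw [div_le_iff₀ hb] at h1
    have h3 : 0 ≤ a' * s ^ p := by positivity
    have h4 : 0 < s ^ (r - 2) := by positivity
    have h5 : A' / 2 ≤ b' * s ^ (r - 2) := by nlinarith
    have h6 : 0 < s ^ 2 := by positivity
    have : fiber p r A' a' b' s ≤ 0 := by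
      simp only [fiber, h2]
      nlinarith
    linarith

end NormalizedNLS

end

noncomputable section
namespace NormalizedNLS
open Filter Topology

variable {𝕜 : Type*} [RCLike 𝕜] {N : ℕ}

/-! ### Elementary facts on weak gradients and on `H¹` -/

theorem lpNorm_congr_ae {α E : Type*} [MeasurableSpace α] {ν : Measure α} [NormedAddCommGroup E]
    {f g : α → E} (h : f =ᵐ[ν] g) {p : ℝ≥0∞} : lpNorm f p ν = lpNorm g p ν := by
  simp only [lpNorm, eLpNorm_congr_ae h]
  congr 1
  exact propext (aestronglyMeasurable_congr h)

/-- The `i`-th unit vector of `ℝ^N`. -/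
abbrev unitVec (i : Fin N) : Rn N := EuclideanSpace.single i (1 : ℝ)

theorem HasWeakGradient.congr {u u' : Rn N → 𝕜} {g g' : Rn N → EuclideanSpace 𝕜 (Fin N)}
    (h : HasWeakGradient u g) (hu : u =ᵐ[volume] u') (hg : g =ᵐ[volume] g') :
    HasWeakGradient u' g' := by
  intro φ hφ hc i
  have e : ∫ x, fderiv ℝ φ x (EuclideanSpace.single i 1) • u' x =
      ∫ x, fderiv ℝ φ x (EuclideanSpace.single i 1) • u x :=
    integral_congr_ae (hu.mono fun x hx => by simp [hx])
  rw [e, h φ hφ hc i]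
  congr 1
  exact integral_congr_ae (hg.mono fun x hx => by simp [hx])

namespace H1

theorem memLp_fn (u : H1 𝕜 N) : MemLp u.fn 2 volume := Lp.memLp _

theorem memLp_grad (u : H1 𝕜 N) : MemLp u.grad 2 volume := Lp.memLp _

theorem hasWeakGradient (u : H1 𝕜 N) : HasWeakGradient u.fn u.grad := u.2

/-- The element of `H¹` given by a pair of square integrable functions. -/
def ofMemLp (f : Rn N → 𝕜) (g : Rn N → EuclideanSpace 𝕜 (Fin N)) (hf : MemLp f 2 volume)
    (hg : MemLp g 2 volume) (h : HasWeakGradient f g) : H1 𝕜 N :=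
  ⟨WithLp.toLp 2 (hf.toLp, hg.toLp), h.congr hf.coeFn_toLp.symm hg.coeFn_toLp.symm⟩

section ofMemLp

variable {f : Rn N → 𝕜} {g : Rn N → EuclideanSpace 𝕜 (Fin N)} (hf : MemLp f 2 volume)
  (hg : MemLp g 2 volume) (h : HasWeakGradient f g)

theorem fn_ofMemLp : (ofMemLp f g hf hg h).fn =ᵐ[volume] f := hf.coeFn_toLp

theorem grad_ofMemLp : (ofMemLp f g hf hg h).grad =ᵐ[volume] g := hg.coeFn_toLp

theorem normLp_ofMemLp (p : ℝ) :
    (ofMemLp f g hf hg h).normLp p = lpNorm f (ENNReal.ofReal p) volume :=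
  lpNorm_congr_ae (fn_ofMemLp hf hg h)

theorem normGrad_ofMemLp : (ofMemLp f g hf hg h).normGrad = lpNorm g 2 volume :=
  lpNorm_congr_ae (grad_ofMemLp hf hg h)

end ofMemLp

theorem normLp_nonneg (u : H1 𝕜 N) (p : ℝ) : 0 ≤ u.normLp p := lpNorm_nonneg

theorem normGrad_nonneg (u : H1 𝕜 N) : 0 ≤ u.normGrad := lpNorm_nonneg

theorem fn_sub (u v : H1 𝕜 N) : (u - v).fn =ᵐ[volume] u.fn - v.fn := Lp.coeFn_sub _ _

theorem fn_smul (k : 𝕜) (u : H1 𝕜 N) : (k • u).fn =ᵐ[volume] k • u.fn := Lp.coeFn_smul _ _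

theorem grad_smul (k : 𝕜) (u : H1 𝕜 N) : (k • u).grad =ᵐ[volume] k • u.grad :=
  Lp.coeFn_smul _ _

theorem grad_sub (u v : H1 𝕜 N) : (u - v).grad =ᵐ[volume] u.grad - v.grad := Lp.coeFn_sub _ _

theorem normLp_smul (k : 𝕜) (u : H1 𝕜 N) (p : ℝ) : (k • u).normLp p = ‖k‖ * u.normLp p := by
  rw [normLp, lpNorm_congr_ae (fn_smul k u), lpNorm_const_smul]; rfl

theorem normGrad_smul (k : 𝕜) (u : H1 𝕜 N) : (k • u).normGrad = ‖k‖ * u.normGrad := by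
  rw [normGrad, lpNorm_congr_ae (grad_smul k u), lpNorm_const_smul]; rfl

theorem normLp_two (u : H1 𝕜 N) : u.normLp 2 = ‖(u : WithLp 2 (Lp 𝕜 2 (volume : Measure (Rn N)) ×
    Lp (EuclideanSpace 𝕜 (Fin N)) 2 (volume : Measure (Rn N)))).fst‖ := by
  rw [Lp.norm_def, toReal_eLpNorm (Lp.aestronglyMeasurable _), normLp]
  congr 1; simp

theorem normGrad_eq (u : H1 𝕜 N) : u.normGrad = ‖(u : WithLp 2 (Lp 𝕜 2 (volume : Measure (Rn N)) ×
    Lp (EuclideanSpace 𝕜 (Fin N)) 2 (volume : Measure (Rn N)))).snd‖ := by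
  rw [Lp.norm_def, toReal_eLpNorm (Lp.aestronglyMeasurable _)]; rfl

theorem norm_sq (u : H1 𝕜 N) : ‖u‖ ^ 2 = u.normLp 2 ^ 2 + u.normGrad ^ 2 := by
  rw [normLp_two, normGrad_eq, ← WithLp.prod_norm_sq_eq_of_L2]; rfl

theorem normLp_two_le (u : H1 𝕜 N) : u.normLp 2 ≤ ‖u‖ := by
  have := u.norm_sq
  have h1 := sq_nonneg u.normGrad
  exact pow_le_pow_iff_left₀ (normLp_nonneg _ _) (norm_nonneg _) two_ne_zero |>.1
    (by linarith)

theorem normGrad_le (u : H1 𝕜 N) : u.normGrad ≤ ‖u‖ := by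
  have := u.norm_sq
  have h1 := sq_nonneg (u.normLp 2)
  exact pow_le_pow_iff_left₀ (normGrad_nonneg _) (norm_nonneg _) two_ne_zero |>.1
    (by linarith)

theorem norm_le (u : H1 𝕜 N) : ‖u‖ ≤ u.normLp 2 + u.normGrad := by
  have := u.norm_sq
  have h1 := u.normLp_nonneg 2
  have h2 := u.normGrad_nonneg
  refine pow_le_pow_iff_left₀ (norm_nonneg _) (by linarith) two_ne_zero |>.1 ?_
  nlinarith [mul_nonneg h1 h2]

theorem continuous_normLp_two : Continuous fun u : H1 𝕜 N => u.normLp 2 := by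
  simp only [normLp_two]
  fun_prop

theorem continuous_normGrad : Continuous fun u : H1 𝕜 N => u.normGrad := by
  simp only [normGrad_eq]
  fun_prop

theorem IsRadial.smul {u : H1 𝕜 N} (hu : u.IsRadial) (k : 𝕜) : (k • u).IsRadial := by
  obtain ⟨f, hf⟩ := hu
  refine ⟨fun r => k * f r, ?_⟩
  filter_upwards [fn_smul k u, hf] with x h1 h2
  rw [h1, Pi.smul_apply, h2, smul_eq_mul]

end H1

/-! ### Smooth functions and cutoffs -/

/-- The gradient of a differentiable `𝕜`-valued function. -/
def smoothGrad (f : Rn N → 𝕜) (x : Rn N) : EuclideanSpace 𝕜 (Fin N) :=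
  WithLp.toLp 2 fun i => fderiv ℝ f x (unitVec i)

theorem continuous_smoothGrad {f : Rn N → 𝕜} (hf : ContDiff ℝ 1 f) :
    Continuous (smoothGrad f) := by
  refine (PiLp.continuous_toLp 2 _).comp (continuous_pi fun i => ?_)
  exact (hf.continuous_fderiv (by simp)).clm_apply continuous_const

theorem hasCompactSupport_smoothGrad {f : Rn N → 𝕜} (hc : HasCompactSupport f) :
    HasCompactSupport (smoothGrad f) := by
  refine (hc.fderiv (𝕜 := ℝ)).mono fun x hx => ?_
  contrapose! hx
  simp only [Function.mem_support, ne_eq, not_not] at hx ⊢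
  ext i
  simp [smoothGrad, hx]

theorem hasWeakGradient_smoothGrad {f : Rn N → 𝕜} (hf : ContDiff ℝ 1 f) :
    HasWeakGradient f (smoothGrad f) := by
  intro φ hφ hφc i
  have hd : Continuous fun x => fderiv ℝ f x (unitVec i) :=
    (hf.continuous_fderiv (by simp)).clm_apply continuous_const
  have hφd := continuous_fderiv_dir hφ (unitVec i)
  have hφd' : HasCompactSupport fun x => fderiv ℝ φ x (unitVec i) := hφc.fderiv_apply (𝕜 := ℝ) _
  have h := integral_smul_fderiv_eq_neg_fderiv_smul_of_integrable (μ := (volume : Measure (Rn N)))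
    (f := φ) (g := f) (v := unitVec i)
    ((hφd.smul hf.continuous).integrable_of_hasCompactSupport hφd'.smul_right)
    ((hφ.continuous.smul hd).integrable_of_hasCompactSupport hφc.smul_right)
    ((hφ.continuous.smul hf.continuous).integrable_of_hasCompactSupport hφc.smul_right)
    (fun x _ => hφ.differentiable (by simp) x) (fun x _ => hf.differentiable (by simp) x)
  simp only [smoothGrad]
  rw [h, neg_neg]

/-- A smooth compactly supported function as an element of `H¹`. -/
def H1.ofSmooth (f : Rn N → 𝕜) (hf : ContDiff ℝ ∞ f) (hc : HasCompactSupport f) : H1 𝕜 N :=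
  H1.ofMemLp f (smoothGrad f) (hf.continuous.memLp_of_hasCompactSupport hc)
    ((continuous_smoothGrad (hf.of_le (by simp))).memLp_of_hasCompactSupport
      (hasCompactSupport_smoothGrad hc))
    (hasWeakGradient_smoothGrad (hf.of_le (by simp)))

/-- The product rule for weak gradients. -/
theorem HasWeakGradient.smul_smooth {f : Rn N → 𝕜} {g : Rn N → EuclideanSpace 𝕜 (Fin N)}
    (h : HasWeakGradient f g) (hf : LocallyIntegrable f volume) (hg : LocallyIntegrable g volume)
    {χ : Rn N → ℝ} (hχ : ContDiff ℝ ∞ χ) :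
    HasWeakGradient (fun x => χ x • f x) (fun x => χ x • g x +
      WithLp.toLp 2 fun i => fderiv ℝ χ x (unitVec i) • f x) := by
  intro φ hφ hφc i
  have hφd := continuous_fderiv_dir hφ (unitVec i)
  have hφd' : HasCompactSupport fun x => fderiv ℝ φ x (unitVec i) := hφc.fderiv_apply (𝕜 := ℝ) _
  have hχd := continuous_fderiv_dir hχ (unitVec i)
  have hg' : LocallyIntegrable (fun x => g x i) volume := by
    intro x
    obtain ⟨s, hs, hi⟩ := hg x
    exact ⟨s, hs, ((EuclideanSpace.proj (𝕜 := 𝕜) i).restrictScalars ℝ).integrable_comp hi⟩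
  have key := h (fun x => φ x * χ x) (hφ.mul hχ) hφc.mul_right i
  have hder : ∀ x, fderiv ℝ (fun x => φ x * χ x) x (unitVec i) =
      φ x * fderiv ℝ χ x (unitVec i) + fderiv ℝ φ x (unitVec i) * χ x := by
    intro x
    rw [fderiv_fun_mul (hφ.differentiable (by simp) x) (hχ.differentiable (by simp) x)]
    simp [mul_comm]
  have i1 : Integrable (fun x => (fderiv ℝ φ x (unitVec i) * χ x) • f x) volume :=
    hf.integrable_smul_left_of_hasCompactSupport (hφd.mul hχ.continuous) hφd'.mul_right
  have i2 : Integrable (fun x => (φ x * fderiv ℝ χ x (unitVec i)) • f x) volume :=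
    hf.integrable_smul_left_of_hasCompactSupport (hφ.continuous.mul hχd) hφc.mul_right
  have i3 : Integrable (fun x => (φ x * χ x) • g x i) volume :=
    hg'.integrable_smul_left_of_hasCompactSupport (hφ.continuous.mul hχ.continuous) hφc.mul_right
  simp only [hder, add_smul] at key
  rw [integral_add i2 i1] at key
  have e1 : ∀ x, fderiv ℝ φ x (unitVec i) • χ x • f x =
      (fderiv ℝ φ x (unitVec i) * χ x) • f x := fun x => by rw [mul_smul]
  have e2 : ∀ x, φ x • (χ x • g x + WithLp.toLp 2 fun i => fderiv ℝ χ x (unitVec i) • f x :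
      EuclideanSpace 𝕜 (Fin N)) i = (φ x * χ x) • g x i +
      (φ x * fderiv ℝ χ x (unitVec i)) • f x := fun x => by
    simp [mul_smul]
  simp only [e1, e2]
  rw [integral_add i3 i2]
  rw [eq_neg_iff_add_eq_zero] at key ⊢
  rw [← key]
  abel

theorem norm_toLp_smul_le {L : Rn N →L[ℝ] ℝ} (z : 𝕜) :
    ‖(WithLp.toLp 2 fun i => L (unitVec i) • z : EuclideanSpace 𝕜 (Fin N))‖ ≤
      √N * ‖L‖ * ‖z‖ := by
  rw [EuclideanSpace.norm_eq, mul_assoc]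
  refine Real.sqrt_le_iff.2 ⟨by positivity, ?_⟩
  rw [mul_pow, Real.sq_sqrt (by positivity)]
  calc ∑ i : Fin N, ‖L (unitVec i) • z‖ ^ 2 ≤ ∑ i : Fin N, (‖L‖ * ‖z‖) ^ 2 := by
        gcongr with i
        rw [norm_smul]
        gcongr
        simpa using L.le_opNorm (unitVec i)
    _ = N * (‖L‖ * ‖z‖) ^ 2 := by simp

variable (N) in
/-- Smooth cutoff functions at scale `R`. -/
theorem exists_cutoff : ∃ C : ℝ, 0 ≤ C ∧ ∀ R : ℝ, 0 < R → ∃ χ : Rn N → ℝ, ContDiff ℝ ∞ χ ∧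
    HasCompactSupport χ ∧ (∀ x, 0 ≤ χ x) ∧ (∀ x, χ x ≤ 1) ∧ (∀ x, ‖x‖ ≤ R → χ x = 1) ∧
    (∀ x, 2 * R ≤ ‖x‖ → χ x = 0) ∧ (∀ x, ‖fderiv ℝ χ x‖ ≤ C / R) ∧
    (∀ x, ‖x‖ < R → fderiv ℝ χ x = 0) := by
  let b : ContDiffBump (0 : Rn N) := ⟨1, 2, one_pos, one_lt_two⟩
  have hb : ContDiff ℝ ∞ b := b.contDiff
  obtain ⟨C, hC⟩ := (hb.continuous_fderiv (by simp)).bounded_above_of_compact_support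
    (b.hasCompactSupport.fderiv (𝕜 := ℝ))
  refine ⟨C, (norm_nonneg _).trans (hC 0), fun R hR => ?_⟩
  have h0 : ContDiff ℝ ∞ fun x : Rn N => b (R⁻¹ • x) := hb.comp (contDiff_const_smul _)
  have h1 : ∀ x : Rn N, ‖x‖ ≤ R → b (R⁻¹ • x) = 1 := fun x hx => b.one_of_mem_closedBall (by
    simp only [mem_closedBall_zero_iff, norm_smul, norm_inv, Real.norm_eq_abs, abs_of_pos hR]
    rw [inv_mul_le_iff₀ hR]; simpa [b] using hx)
  have h2 : ∀ x : Rn N, 2 * R ≤ ‖x‖ → b (R⁻¹ • x) = 0 := fun x hx => b.zero_of_le_dist (by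
    simp only [dist_zero_right, norm_smul, norm_inv, Real.norm_eq_abs, abs_of_pos hR]
    rw [le_inv_mul_iff₀ hR]; simpa [b, mul_comm] using hx)
  refine ⟨fun x => b (R⁻¹ • x), h0, ?_, fun x => b.nonneg, fun x => b.le_one, h1, h2, ?_, ?_⟩
  · refine HasCompactSupport.intro (isCompact_closedBall (0 : Rn N) (2 * R)) fun x hx => h2 x ?_
    simp only [mem_closedBall_zero_iff, not_le] at hx
    exact hx.le
  · intro x
    rw [fderiv_comp_smul, norm_smul, norm_inv, Real.norm_eq_abs, abs_of_pos hR, div_eq_inv_mul]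
    gcongr
    exact hC _
  · intro x hx
    have : (fun x : Rn N => b (R⁻¹ • x)) =ᶠ[𝓝 x] fun _ => 1 := by
      filter_upwards [Metric.isOpen_ball.mem_nhds (mem_ball_zero_iff.2 hx)] with y hy
      exact h1 y (mem_ball_zero_iff.1 hy).le
    rw [this.fderiv_eq]
    simp

/-- The tails of an `L^p` function are small. -/
theorem exists_eLpNorm_tail_le {E : Type*} [NormedAddCommGroup E] [NormedSpace ℝ E]
    {f : Rn N → E} {p : ℝ≥0∞}
    (hp : p ≠ ⊤) (hf : MemLp f p volume) {ε : ℝ≥0∞} (hε : ε ≠ 0) :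
    ∃ R₀ : ℝ, ∀ R, R₀ ≤ R → eLpNorm ({x | R ≤ ‖x‖}.indicator f) p volume ≤ ε := by
  obtain ⟨g, hg, hfg, -, -⟩ := hf.exists_hasCompactSupport_eLpNorm_sub_le hp hε
  obtain ⟨R₀, hR₀⟩ := hg.isCompact.isBounded.subset_ball 0
  refine ⟨R₀, fun R hR => ?_⟩
  have : {x : Rn N | R ≤ ‖x‖}.indicator f = {x : Rn N | R ≤ ‖x‖}.indicator (f - g) := by
    refine indicator_congr fun x hx => ?_
    have : g x = 0 := by
      refine image_eq_zero_of_notMem_tsupport fun h => ?_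
      have := mem_ball_zero_iff.1 (hR₀ h)
      have hx' : R ≤ ‖x‖ := hx
      linarith
    simp [this]
  rw [this]
  exact (eLpNorm_indicator_le _).trans hfg

end NormalizedNLS

end

noncomputable section
namespace NormalizedNLS
open Filter Topology ContinuousLinearMap
open scoped Convolution

variable {𝕜 : Type*} [RCLike 𝕜] {N : ℕ}

/-! ### Mollification -/

section Mollify

variable {E : Type*} [NormedAddCommGroup E] [NormedSpace ℝ E]

theorem eLpNorm_two_sq {α E : Type*} [MeasurableSpace α] [NormedAddCommGroup E] (ν : Measure α)
    (f : α → E) : eLpNorm f 2 ν ^ (2 : ℝ) = ∫⁻ x, ‖f x‖ₑ ^ (2 : ℝ) ∂ν := by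
  simpa using eLpNorm_nnreal_pow_eq_lintegral (μ := ν) (f := f) (p := 2) two_ne_zero

theorem lintegral_enorm_normed (b : ContDiffBump (0 : Rn N)) :
    ∫⁻ t, ‖b.normed volume t‖ₑ = 1 := by
  rw [← ofReal_integral_norm_eq_lintegral_enorm b.integrable_normed]
  simp only [Real.norm_eq_abs, abs_of_nonneg (b.nonneg_normed _), b.integral_normed]
  simp

/-- Mollification is a contraction of `L²`. -/
theorem eLpNorm_mollify_le (b : ContDiffBump (0 : Rn N)) {f : Rn N → E} (hf : MemLp f 2 volume) :
    eLpNorm (b.normed volume ⋆[lsmul ℝ ℝ, volume] f) 2 volume ≤ eLpNorm f 2 volume := by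
  obtain ⟨f', hf', hff'⟩ := hf.1
  rw [convolution_congr (lsmul ℝ ℝ) (ae_eq_refl _) hff', eLpNorm_congr_ae hff']
  set η := b.normed volume with hη
  have hηm : Measurable fun t => ‖η t‖ₑ := b.continuous_normed.measurable.enorm
  -- With |η| dt as a probability measure, Jensen's inequality is the comparison of the L¹ and L²
  -- norms for `P`; integrating in x and exchanging the integrals then gives the contraction.
  set P : Measure (Rn N) := volume.withDensity fun t => ‖η t‖ₑ with hP
  have hPp : IsProbabilityMeasure P := ⟨by
    rw [hP, withDensity_apply _ MeasurableSet.univ, setLIntegral_univ, lintegral_enorm_normed]⟩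
  have hpt : ∀ x, ‖(η ⋆[lsmul ℝ ℝ, volume] f') x‖ₑ ^ (2 : ℝ) ≤
      ∫⁻ t, ‖η t‖ₑ * ‖f' (x - t)‖ₑ ^ (2 : ℝ) := by
    intro x
    have hm : StronglyMeasurable fun t => f' (x - t) :=
      hf'.comp_measurable (measurable_const.sub measurable_id)
    calc ‖(η ⋆[lsmul ℝ ℝ, volume] f') x‖ₑ ^ (2 : ℝ)
        ≤ (∫⁻ t, ‖η t‖ₑ * ‖f' (x - t)‖ₑ) ^ (2 : ℝ) := by
          gcongr
          rw [convolution_def]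
          refine (enorm_integral_le_lintegral_enorm _).trans (le_of_eq ?_)
          simp [enorm_smul]
      _ = (eLpNorm (fun t => f' (x - t)) 1 P) ^ (2 : ℝ) := by
          rw [eLpNorm_one_eq_lintegral_enorm, hP,
            lintegral_withDensity_eq_lintegral_mul _ hηm hm.enorm]
          rfl
      _ ≤ (eLpNorm (fun t => f' (x - t)) 2 P) ^ (2 : ℝ) := by
          gcongr
          exact eLpNorm_le_eLpNorm_of_exponent_le (by norm_num) hm.aestronglyMeasurable
      _ = _ := by
          rw [eLpNorm_two_sq, hP,
            lintegral_withDensity_eq_lintegral_mul _ hηm (hm.enorm.pow_const _)]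
          rfl
  rw [← ENNReal.rpow_le_rpow_iff (z := 2) two_pos, eLpNorm_two_sq, eLpNorm_two_sq]
  have hm2 : Measurable (Function.uncurry fun x t : Rn N => ‖η t‖ₑ * ‖f' (x - t)‖ₑ ^ (2 : ℝ)) := by
    refine (hηm.comp measurable_snd).mul ?_
    exact (hf'.comp_measurable (measurable_fst.sub measurable_snd)).enorm.pow_const _
  calc ∫⁻ x, ‖(η ⋆[lsmul ℝ ℝ, volume] f') x‖ₑ ^ (2 : ℝ)
      ≤ ∫⁻ x, ∫⁻ t, ‖η t‖ₑ * ‖f' (x - t)‖ₑ ^ (2 : ℝ) := lintegral_mono hpt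
    _ = ∫⁻ t, ∫⁻ x, ‖η t‖ₑ * ‖f' (x - t)‖ₑ ^ (2 : ℝ) :=
        lintegral_lintegral_swap hm2.aemeasurable
    _ = ∫⁻ t, ‖η t‖ₑ * ∫⁻ x, ‖f' x‖ₑ ^ (2 : ℝ) := by
        refine lintegral_congr fun t => ?_
        have hmt : Measurable fun x => ‖f' (x - t)‖ₑ ^ (2 : ℝ) :=
          (hf'.comp_measurable (measurable_id.sub_const t)).enorm.pow_const _
        rw [lintegral_const_mul _ hmt]
        congr 1
        exact lintegral_sub_right_eq_self (fun x => ‖f' x‖ₑ ^ (2 : ℝ)) t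
    _ = ∫⁻ x, ‖f' x‖ₑ ^ (2 : ℝ) := by
        rw [lintegral_mul_const _ hηm, lintegral_enorm_normed, one_mul]

theorem memLp_mollify (b : ContDiffBump (0 : Rn N)) {f : Rn N → E} (hf : MemLp f 2 volume) :
    MemLp (b.normed volume ⋆[lsmul ℝ ℝ, volume] f) 2 volume :=
  ⟨(b.hasCompactSupport_normed.continuous_convolution_left (lsmul ℝ ℝ) b.continuous_normed
    (hf.locallyIntegrable (by norm_num))).aestronglyMeasurable,
    (eLpNorm_mollify_le b hf).trans_lt hf.2⟩

theorem mollify_sub (b : ContDiffBump (0 : Rn N)) {f g : Rn N → E}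
    (hf : LocallyIntegrable f volume) (hg : LocallyIntegrable g volume) :
    b.normed volume ⋆[lsmul ℝ ℝ, volume] (f - g) =
      (b.normed volume ⋆[lsmul ℝ ℝ, volume] f) - (b.normed volume ⋆[lsmul ℝ ℝ, volume] g) := by
  ext x
  have h1 := (b.hasCompactSupport_normed (μ := (volume : Measure (Rn N)))).convolutionExists_left
    (lsmul ℝ ℝ) b.continuous_normed hf x
  have h2 := (b.hasCompactSupport_normed (μ := (volume : Measure (Rn N)))).convolutionExists_left
    (lsmul ℝ ℝ) b.continuous_normed hg x
  simp only [convolution_def, Pi.sub_apply, map_sub]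
  exact integral_sub h1 h2

/-- Mollifications converge in `L²`. -/
theorem exists_eLpNorm_mollify_sub_le [CompleteSpace E] {f : Rn N → E} (hf : MemLp f 2 volume) {ε : ℝ}
    (hε : 0 < ε) : ∃ δ > 0, ∀ b : ContDiffBump (0 : Rn N), b.rOut < δ →
      eLpNorm (b.normed volume ⋆[lsmul ℝ ℝ, volume] f - f) 2 volume ≤ ENNReal.ofReal ε := by
  have hε3 : 0 < ε / 3 := by positivity
  -- Three errors of size ε/3: f is replaced by a continuous g with compact support, for which the
  -- convergence is uniform on the fixed compact set `K`; the other two errors are controlled by the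
  -- contraction property.
  obtain ⟨g, hgc, hfg, hg, hgm⟩ := hf.exists_hasCompactSupport_eLpNorm_sub_le (by norm_num)
    (ENNReal.ofReal_pos.2 hε3).ne'
  set K := Metric.cthickening 1 (tsupport g) with hK
  have hKc : IsCompact K := hgc.isCompact.cthickening
  have hKm : volume K ≠ ⊤ := hKc.measure_lt_top.ne
  set m := (volume K).toReal ^ (1 / (2 : ℝ)) with hm
  have hm0 : 0 ≤ m := by positivity
  obtain ⟨δ, hδ, hgδ⟩ := Metric.uniformContinuous_iff.1
    (hgc.uniformContinuous_of_continuous hg) (ε / 3 / (m + 1)) (by positivity)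
  refine ⟨min δ 1, by positivity, fun b hb => ?_⟩
  have hli := hf.locallyIntegrable (by norm_num)
  have hlg := hgm.locallyIntegrable (by norm_num)
  have hdec : b.normed volume ⋆[lsmul ℝ ℝ, volume] f - f =
      (b.normed volume ⋆[lsmul ℝ ℝ, volume] (f - g)) +
        ((b.normed volume ⋆[lsmul ℝ ℝ, volume] g - g) - (f - g)) := by
    rw [mollify_sub b hli hlg]; abel
  have hmid : eLpNorm (b.normed volume ⋆[lsmul ℝ ℝ, volume] g - g) 2 volume ≤
      ENNReal.ofReal (ε / 3) := by
    have hdist : ∀ x, dist ((b.normed volume ⋆[lsmul ℝ ℝ, volume] g) x) (g x) ≤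
        ε / 3 / (m + 1) := fun x =>
      b.dist_normed_convolution_le hg.aestronglyMeasurable fun y hy =>
        (hgδ ((mem_ball_iff_norm.1 hy |>.trans (hb.trans_le (min_le_left _ _))) |>
          fun h => by rwa [dist_eq_norm])).le
    have hs : Function.support (b.normed volume ⋆[lsmul ℝ ℝ, volume] g) ⊆ K := by
      refine (support_convolution_subset _).trans ?_
      rintro _ ⟨y, hy, z, hz, rfl⟩
      rw [b.support_normed_eq, mem_ball_zero_iff] at hy
      refine Metric.mem_cthickening_of_dist_le _ z _ _ (subset_tsupport _ hz) ?_
      simp only [dist_eq_norm, add_sub_cancel_right]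
      exact (hy.trans (hb.trans_le (min_le_right _ _))).le
    have hs' : Function.support g ⊆ K :=
      (subset_tsupport g).trans (Metric.self_subset_cthickening _)
    refine (eLpNorm_sub_le_of_dist_bdd volume (by norm_num) hKc.measurableSet
      (by positivity) hdist hs hs').trans ?_
    have : volume K ^ (1 / (2 : ℝ≥0∞).toReal) = ENNReal.ofReal m := by
      rw [hm, ← ENNReal.ofReal_rpow_of_nonneg (by positivity) (by positivity),
        ENNReal.ofReal_toReal hKm]
      simp
    rw [this, ← ENNReal.ofReal_mul (by positivity)]
    refine ENNReal.ofReal_le_ofReal ?_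
    rw [div_mul_eq_mul_div, div_le_iff₀ (by positivity)]
    nlinarith
  rw [hdec]
  have a1 : AEStronglyMeasurable (b.normed volume ⋆[lsmul ℝ ℝ, volume] (f - g)) volume :=
    (memLp_mollify b (hf.sub hgm)).1
  have a2 : AEStronglyMeasurable (b.normed volume ⋆[lsmul ℝ ℝ, volume] g - g) volume :=
    ((memLp_mollify b hgm).sub hgm).1
  calc _ ≤ eLpNorm (b.normed volume ⋆[lsmul ℝ ℝ, volume] (f - g)) 2 volume +
        (eLpNorm (b.normed volume ⋆[lsmul ℝ ℝ, volume] g - g) 2 volume +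
          eLpNorm (f - g) 2 volume) := by
        refine (eLpNorm_add_le a1 (a2.sub (hf.sub hgm).1) (by norm_num)).trans ?_
        gcongr
        exact eLpNorm_sub_le a2 (hf.sub hgm).1 (by norm_num)
    _ ≤ ENNReal.ofReal (ε / 3) + (ENNReal.ofReal (ε / 3) + ENNReal.ofReal (ε / 3)) := by
        gcongr
        exact (eLpNorm_mollify_le b (hf.sub hgm)).trans hfg
    _ = ENNReal.ofReal ε := by
        rw [← ENNReal.ofReal_add hε3.le hε3.le, ← ENNReal.ofReal_add hε3.le (by positivity)]
        congr 1; ring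

end Mollify

/-- The gradient of the mollification is the mollification of the weak gradient. -/
theorem smoothGrad_mollify (b : ContDiffBump (0 : Rn N)) {f : Rn N → 𝕜}
    {g : Rn N → EuclideanSpace 𝕜 (Fin N)} (h : HasWeakGradient f g)
    (hf : LocallyIntegrable f volume) (hg : LocallyIntegrable g volume) :
    smoothGrad (b.normed volume ⋆[lsmul ℝ ℝ, volume] f) =
      b.normed volume ⋆[lsmul ℝ ℝ, volume] g := by
  set η := b.normed (volume : Measure (Rn N)) with hη
  have hη1 : ContDiff ℝ ∞ η := b.contDiff_normed
  have hηc : HasCompactSupport η := b.hasCompactSupport_normed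
  ext x i
  have h1 := hηc.hasFDerivAt_convolution_left (lsmul ℝ ℝ) (hη1.of_le (by simp)) hf x
  have hex := (hηc.fderiv (𝕜 := ℝ)).convolutionExists_left ((lsmul ℝ ℝ : ℝ →L[ℝ] 𝕜 →L[ℝ] 𝕜).precompL
    (Rn N)) (hη1.continuous_fderiv (by simp)) hf x
  have hex' := hηc.convolutionExists_left (lsmul ℝ ℝ) hη1.continuous hg x
  have h2 : smoothGrad (η ⋆[lsmul ℝ ℝ, volume] f) x i =
      ∫ t, fderiv ℝ η t (unitVec i) • f (x - t) := by
    simp only [smoothGrad]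
    rw [h1.fderiv, convolution_def]
    rw [ContinuousLinearMap.integral_apply hex]
    simp
  have h3 : (η ⋆[lsmul ℝ ℝ, volume] g) x i = ∫ t, η t • g (x - t) i := by
    rw [convolution_def]
    have := ((EuclideanSpace.proj (𝕜 := 𝕜) i).restrictScalars ℝ).integral_comp_comm hex'
    simp only [lsmul_apply, coe_restrictScalars', PiLp.proj_apply, PiLp.smul_apply] at this ⊢
    exact this.symm
  have h4 : ∫ t, fderiv ℝ η t (unitVec i) • f (x - t) =
      ∫ y, fderiv ℝ η (x - y) (unitVec i) • f y := by
    rw [← integral_sub_left_eq_self _ volume x]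
    simp
  have h5 : ∫ t, η t • g (x - t) i = ∫ y, η (x - y) • g y i := by
    rw [← integral_sub_left_eq_self _ volume x]
    simp
  -- The weak gradient is tested with y ↦ η(x − y); the sign from the inner derivative cancels the
  -- sign from integration by parts.
  have h6 := h (fun y => η (x - y)) (hη1.comp (contDiff_const.sub contDiff_id))
    (hηc.comp_homeomorph (Homeomorph.subLeft x)) i
  have h7 : ∀ y, fderiv ℝ (fun y => η (x - y)) y = - fderiv ℝ η (x - y) := fun y => by
    exact (((hη1.differentiable (by simp) (x - y)).hasFDerivAt.comp y
      ((hasFDerivAt_id y).const_sub x)).congr_fderiv (by ext; simp)).fderiv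
  simp only [h7, _root_.neg_apply, neg_smul, integral_neg, neg_inj] at h6
  rw [h2, h3, h4, h5]
  exact h6

/-- Elements of `H¹` with compact support are approximated by smooth functions. -/
theorem exists_smooth_approx_of_hasCompactSupport {f : Rn N → 𝕜}
    {g : Rn N → EuclideanSpace 𝕜 (Fin N)} (h : HasWeakGradient f g) (hf : MemLp f 2 volume)
    (hg : MemLp g 2 volume) (hc : HasCompactSupport f) {ε : ℝ} (hε : 0 < ε) :
    ∃ φ : Rn N → 𝕜, ContDiff ℝ ∞ φ ∧ HasCompactSupport φ ∧
      eLpNorm (φ - f) 2 volume ≤ ENNReal.ofReal ε ∧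
      eLpNorm (smoothGrad φ - g) 2 volume ≤ ENNReal.ofReal ε := by
  obtain ⟨δ₁, hδ₁, h₁⟩ := exists_eLpNorm_mollify_sub_le hf hε
  obtain ⟨δ₂, hδ₂, h₂⟩ := exists_eLpNorm_mollify_sub_le hg hε
  set δ := min δ₁ δ₂ with hδ
  have hδ0 : 0 < δ := lt_min hδ₁ hδ₂
  let b : ContDiffBump (0 : Rn N) := ⟨δ / 4, δ / 2, by positivity, by linarith⟩
  have hb : b.rOut < δ := by simp only [b]; linarith
  have hlf := hf.locallyIntegrable (by norm_num)
  have hlg := hg.locallyIntegrable (by norm_num)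
  refine ⟨b.normed volume ⋆[lsmul ℝ ℝ, volume] f, ?_, ?_, h₁ b (hb.trans_le (min_le_left _ _)), ?_⟩
  · exact b.hasCompactSupport_normed.contDiff_convolution_left _ b.contDiff_normed hlf
  · exact b.hasCompactSupport_normed.convolution _ hc
  · rw [smoothGrad_mollify b h hlf hlg]
    exact h₂ b (hb.trans_le (min_le_right _ _))

end NormalizedNLS

end

noncomputable section
namespace NormalizedNLS
open Filter Topology

variable {𝕜 : Type*} [RCLike 𝕜] {N : ℕ}

/-! ### Density of smooth functions and the Sobolev inequality -/

/-- The correction term in the gradient of `χ • f`. -/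
def cutoffTerm (χ : Rn N → ℝ) (f : Rn N → 𝕜) (x : Rn N) : EuclideanSpace 𝕜 (Fin N) :=
  WithLp.toLp 2 fun i => fderiv ℝ χ x (unitVec i) • f x

theorem aestronglyMeasurable_cutoffTerm {χ : Rn N → ℝ} {f : Rn N → 𝕜} (hχ : ContDiff ℝ ∞ χ)
    (hf : AEStronglyMeasurable f volume) : AEStronglyMeasurable (cutoffTerm χ f) volume := by
  have h : AEMeasurable (fun x => fun i => fderiv ℝ χ x (unitVec i) • f x) volume :=
    aemeasurable_pi_lambda _ fun i =>
      ((continuous_fderiv_dir hχ (unitVec i)).aestronglyMeasurable.smul hf).aemeasurable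
  exact ((PiLp.continuous_toLp 2 (fun _ : Fin N => 𝕜)).measurable.comp_aemeasurable
    h).aestronglyMeasurable

theorem norm_cutoffTerm_le (χ : Rn N → ℝ) (f : Rn N → 𝕜) (x : Rn N) :
    ‖cutoffTerm χ f x‖ ≤ √N * ‖fderiv ℝ χ x‖ * ‖f x‖ := norm_toLp_smul_le _

theorem norm_cutoff_sub_le {E : Type*} [NormedAddCommGroup E] [NormedSpace ℝ E] {χ : Rn N → ℝ}
    {R : ℝ} (h0 : ∀ x, 0 ≤ χ x) (h1 : ∀ x, χ x ≤ 1) (hR : ∀ x, ‖x‖ ≤ R → χ x = 1) (f : Rn N → E)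
    (x : Rn N) : ‖χ x • f x - f x‖ ≤ ‖{x | R ≤ ‖x‖}.indicator f x‖ := by
  rcases le_or_gt R ‖x‖ with h | h
  · rw [indicator_of_mem (by exact h)]
    have : χ x • f x - f x = (χ x - 1) • f x := by rw [sub_smul, one_smul]
    rw [this, norm_smul]
    refine mul_le_of_le_one_left (norm_nonneg _) ?_
    rw [Real.norm_eq_abs, abs_le]
    constructor <;> linarith [h0 x, h1 x]
  · rw [hR x h.le]
    simp

/-- Smooth compactly supported functions are dense in `H¹`. -/
theorem H1.exists_smooth_approx (u : H1 𝕜 N) {ε : ℝ} (hε : 0 < ε) :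
    ∃ φ : Rn N → 𝕜, ContDiff ℝ ∞ φ ∧ HasCompactSupport φ ∧
      eLpNorm (φ - u.fn) 2 volume ≤ ENNReal.ofReal ε ∧
      eLpNorm (smoothGrad φ - u.grad) 2 volume ≤ ENNReal.ofReal ε := by
  have hε4 : 0 < ε / 4 := by positivity
  obtain ⟨C, hC, hcut⟩ := exists_cutoff N
  obtain ⟨R₁, hR₁⟩ := exists_eLpNorm_tail_le (by norm_num) u.memLp_fn
    (ENNReal.ofReal_pos.2 hε4).ne'
  obtain ⟨R₂, hR₂⟩ := exists_eLpNorm_tail_le (by norm_num) u.memLp_grad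
    (ENNReal.ofReal_pos.2 hε4).ne'
  set T := √N * C * u.normLp 2 with hT
  have hT0 : 0 ≤ T := mul_nonneg (by positivity) (u.normLp_nonneg 2)
  -- Beyond this radius the tails of u and ∇u are below ε/4, and the term u∇χ has norm at most T/R ≤
  -- ε/4.
  set R := max 1 (max (max R₁ R₂) (T / (ε / 4))) with hR
  have hR0 : 0 < R := lt_of_lt_of_le one_pos (le_max_left _ _)
  have hRR₁ : R₁ ≤ R := (le_max_left _ _).trans ((le_max_left _ _).trans (le_max_right _ _))
  have hRR₂ : R₂ ≤ R := (le_max_right _ _).trans ((le_max_left _ _).trans (le_max_right _ _))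
  have hRT : T / R ≤ ε / 4 := by
    rw [div_le_comm₀ hR0 hε4]
    exact (le_max_right _ _).trans (le_max_right _ _)
  obtain ⟨χ, hχ, hχc, h0, h1, hin, -, hd, -⟩ := hcut R hR0
  have hlf := u.memLp_fn.locallyIntegrable (by norm_num)
  have hlg := u.memLp_grad.locallyIntegrable (by norm_num)
  have hweak := u.hasWeakGradient.smul_smooth hlf hlg hχ
  have hsub1 : eLpNorm ((fun x => χ x • u.fn x) - u.fn) 2 volume ≤ ENNReal.ofReal (ε / 4) :=
    (eLpNorm_mono (norm_cutoff_sub_le h0 h1 hin u.fn)).trans (hR₁ R hRR₁)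
  have hsub2 : eLpNorm ((fun x => χ x • u.grad x) - u.grad) 2 volume ≤ ENNReal.ofReal (ε / 4) :=
    (eLpNorm_mono (norm_cutoff_sub_le h0 h1 hin u.grad)).trans (hR₂ R hRR₂)
  have hterm : eLpNorm (cutoffTerm χ u.fn) 2 volume ≤ ENNReal.ofReal (ε / 4) := by
    refine (eLpNorm_le_mul_eLpNorm_of_ae_le_mul (c := √N * (C / R)) (g := u.fn) ?_ 2).trans ?_
    · filter_upwards with x
      refine (norm_cutoffTerm_le χ u.fn x).trans ?_
      gcongr
      exact hd x
    · rw [← ofReal_lpNorm u.memLp_fn, ← ENNReal.ofReal_mul (by positivity)]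
      refine ENNReal.ofReal_le_ofReal (le_trans (le_of_eq ?_) hRT)
      rw [hT, H1.normLp]
      norm_num
      ring
  have hm1 : MemLp (fun x => χ x • u.fn x) 2 volume := by
    have hmm : MemLp ((fun x => χ x • u.fn x) - u.fn) 2 volume :=
      ⟨(hχ.continuous.aestronglyMeasurable.smul u.memLp_fn.1).sub u.memLp_fn.1,
        hsub1.trans_lt ENNReal.ofReal_lt_top⟩
    simpa using hmm.add u.memLp_fn
  have hm2 : MemLp (fun x => χ x • u.grad x) 2 volume := by
    have hmm : MemLp ((fun x => χ x • u.grad x) - u.grad) 2 volume :=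
      ⟨(hχ.continuous.aestronglyMeasurable.smul u.memLp_grad.1).sub u.memLp_grad.1,
        hsub2.trans_lt ENNReal.ofReal_lt_top⟩
    simpa using hmm.add u.memLp_grad
  have hm3 : MemLp (cutoffTerm χ u.fn) 2 volume :=
    ⟨aestronglyMeasurable_cutoffTerm hχ u.memLp_fn.1, hterm.trans_lt ENNReal.ofReal_lt_top⟩
  obtain ⟨φ, hφ, hφc, hφ1, hφ2⟩ := exists_smooth_approx_of_hasCompactSupport hweak hm1
    (hm2.add hm3) hχc.smul_right hε4
  refine ⟨φ, hφ, hφc, ?_, ?_⟩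
  · have e : φ - u.fn = (φ - fun x => χ x • u.fn x) + ((fun x => χ x • u.fn x) - u.fn) := by abel
    rw [e]
    refine (eLpNorm_add_le (hφ.continuous.aestronglyMeasurable.sub hm1.1)
      (hm1.1.sub u.memLp_fn.1) (by norm_num)).trans ((add_le_add hφ1 hsub1).trans ?_)
    rw [← ENNReal.ofReal_add hε4.le hε4.le]
    exact ENNReal.ofReal_le_ofReal (by linarith)
  · have e : smoothGrad φ - u.grad = (smoothGrad φ - fun x => χ x • u.grad x + cutoffTerm χ u.fn x)
        + (((fun x => χ x • u.grad x) - u.grad) + cutoffTerm χ u.fn) := by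
      ext x : 1
      simp only [Pi.sub_apply, Pi.add_apply]
      abel
    have ma : AEStronglyMeasurable (smoothGrad φ) volume :=
      (continuous_smoothGrad (hφ.of_le (by simp))).aestronglyMeasurable
    rw [e]
    refine (eLpNorm_add_le (ma.sub (hm2.add hm3).1)
      ((hm2.1.sub u.memLp_grad.1).add hm3.1) (by norm_num)).trans ?_
    refine (add_le_add hφ2 ((eLpNorm_add_le (hm2.1.sub u.memLp_grad.1) hm3.1
      (by norm_num)).trans (add_le_add hsub2 hterm))).trans ?_
    rw [← ENNReal.ofReal_add hε4.le hε4.le, ← ENNReal.ofReal_add hε4.le (by positivity)]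
    exact ENNReal.ofReal_le_ofReal (by linarith)

/-- Cauchy–Schwarz in coordinates. It converts a Sobolev inequality for the operator norm of the
derivative into one for the Euclidean norm of the gradient. -/
theorem norm_fderiv_le_norm_smoothGrad (f : Rn N → 𝕜) (x : Rn N) :
    ‖fderiv ℝ f x‖ ≤ ‖smoothGrad f x‖ := by
  refine ContinuousLinearMap.opNorm_le_bound _ (norm_nonneg _) fun v => ?_
  have hv : v = ∑ i, v i • unitVec i := by
    ext j
    simp [Finset.sum_apply, Pi.single_apply]
  have h1 : fderiv ℝ f x v = ∑ i, v i • fderiv ℝ f x (unitVec i) := by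
    conv_lhs => rw [hv]
    simp [map_sum]
  rw [h1, EuclideanSpace.norm_eq, EuclideanSpace.norm_eq]
  calc ‖∑ i, v i • fderiv ℝ f x (unitVec i)‖ ≤ ∑ i, ‖smoothGrad f x i‖ * ‖v i‖ := by
        refine (norm_sum_le _ _).trans (Finset.sum_le_sum fun i _ => ?_)
        rw [norm_smul, mul_comm]; rfl
    _ ≤ _ := Real.sum_mul_le_sqrt_mul_sqrt _ _ _

theorem critExp_pos (hN : 3 ≤ N) : 2 < critExp N := by
  have : (3 : ℝ) ≤ N := by exact_mod_cast hN
  rw [critExp, lt_div_iff₀ (by linarith)]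
  linarith

theorem critExp_inv (hN : 3 ≤ N) : (critExp N)⁻¹ = 2⁻¹ - (N : ℝ)⁻¹ := by
  have : (3 : ℝ) ≤ N := by exact_mod_cast hN
  have h2 : (N : ℝ) - 2 ≠ 0 := by linarith
  rw [critExp]
  field_simp

variable (𝕜) in
/-- The Sobolev inequality on `H¹`. -/
theorem H1.exists_sobolev (hN : 3 ≤ N) : ∃ C : ℝ≥0, ∀ u : H1 𝕜 N,
    eLpNorm u.fn (ENNReal.ofReal (critExp N)) volume ≤ C * eLpNorm u.grad 2 volume := by
  have hcrit := critExp_pos hN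
  set C := SNormLESNormFDerivOfEqConst 𝕜 (volume : Measure (Rn N)) (2 : ℝ≥0) with hC
  refine ⟨C, fun u => ?_⟩
  have hsm : ∀ φ : Rn N → 𝕜, ContDiff ℝ ∞ φ → HasCompactSupport φ →
      eLpNorm φ (ENNReal.ofReal (critExp N)) volume ≤ C * eLpNorm (smoothGrad φ) 2 volume := by
    intro φ hφ hφc
    refine (eLpNorm_le_eLpNorm_fderiv_of_eq (F := 𝕜) (volume : Measure (Rn N))
      (hφ.of_le (by simp)) hφc (p := 2) (p' := (critExp N).toNNReal) (by norm_num)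
      (by simp; omega) ?_).trans ?_
    · rw [Real.coe_toNNReal _ (by linarith), critExp_inv hN]
      simp
    · exact mul_le_mul' le_rfl (eLpNorm_mono (norm_fderiv_le_norm_smoothGrad φ))
  choose! φ hφ hφc h1 h2 using fun n : ℕ =>
    u.exists_smooth_approx (ε := 1 / ((n : ℝ) + 1)) (by positivity)
  have ht : Tendsto (fun n : ℕ => ENNReal.ofReal (1 / ((n : ℝ) + 1))) atTop (𝓝 0) := by
    rw [← ENNReal.ofReal_zero]
    exact ENNReal.tendsto_ofReal tendsto_one_div_add_atTop_nhds_zero_nat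
  -- L² convergence gives an almost everywhere convergent subsequence, and Fatou's lemma carries the
  -- inequality to u without knowing beforehand that u lies in L^{2*}.
  have hmeas : TendstoInMeasure volume φ atTop u.fn :=
    tendstoInMeasure_of_tendsto_eLpNorm (p := 2) (by norm_num)
      (fun n => (hφ n).continuous.aestronglyMeasurable) u.memLp_fn.1
      (tendsto_of_tendsto_of_tendsto_of_le_of_le tendsto_const_nhds ht (fun _ => zero_le)
        h1)
  obtain ⟨ns, hns, hae⟩ := hmeas.exists_seq_tendsto_ae
  refine (Lp.eLpNorm_lim_le_liminf_eLpNorm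
    (fun n => (hφ (ns n)).continuous.aestronglyMeasurable) _ hae).trans ?_
  have hlim : Tendsto (fun n => C * (eLpNorm u.grad 2 volume +
      ENNReal.ofReal (1 / ((ns n : ℝ) + 1)))) atTop (𝓝 (C * (eLpNorm u.grad 2 volume + 0))) :=
    ENNReal.Tendsto.const_mul (tendsto_const_nhds.add (ht.comp hns.tendsto_atTop))
      (Or.inr ENNReal.coe_ne_top)
  rw [add_zero] at hlim
  rw [← hlim.liminf_eq]
  refine liminf_le_liminf (Eventually.of_forall fun n => ?_)
  refine (hsm _ (hφ _) (hφc _)).trans ?_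
  gcongr
  have ma : AEStronglyMeasurable (smoothGrad (φ (ns n))) volume :=
    (continuous_smoothGrad ((hφ _).of_le (by simp))).aestronglyMeasurable
  have e : smoothGrad (φ (ns n)) = u.grad + (smoothGrad (φ (ns n)) - u.grad) := by abel
  calc eLpNorm (smoothGrad (φ (ns n))) 2 volume ≤ eLpNorm u.grad 2 volume +
        eLpNorm (smoothGrad (φ (ns n)) - u.grad) 2 volume := by
        conv_lhs => rw [e]
        exact eLpNorm_add_le u.memLp_grad.1 (ma.sub u.memLp_grad.1) (by norm_num)
    _ ≤ _ := by gcongr; exact h2 _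

end NormalizedNLS

end

noncomputable section
namespace NormalizedNLS
open Filter Topology

variable {𝕜 : Type*} [RCLike 𝕜] {N : ℕ}

/-! ### The best constants -/

variable (𝕜) in
/-- The Sobolev inequality on the homogeneous Sobolev space. -/
theorem exists_sobolev_homogeneous (hN : 3 ≤ N) : ∃ C : ℝ≥0, ∀ (f : Rn N → 𝕜)
    (g : Rn N → EuclideanSpace 𝕜 (Fin N)), MemLp f (ENNReal.ofReal (critExp N)) volume →
    MemLp g 2 volume → HasWeakGradient f g →
    eLpNorm f (ENNReal.ofReal (critExp N)) volume ≤ C * eLpNorm g 2 volume := by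
  obtain ⟨C, hC⟩ := H1.exists_sobolev 𝕜 hN
  refine ⟨C, fun f g hf hg h => ?_⟩
  have hcrit := critExp_pos hN
  have hN0 : (0 : ℝ) < N := by exact_mod_cast (by omega : 0 < N)
  set r := ENNReal.ofReal (critExp N) with hr
  have hr2 : 2 ≤ r := by
    rw [hr, show (2 : ℝ≥0∞) = ENNReal.ofReal 2 by simp]
    exact ENNReal.ofReal_le_ofReal hcrit.le
  have hr1 : 1 ≤ r := le_trans (by norm_num) hr2
  have hlf := hf.locallyIntegrable hr1
  have hlg := hg.locallyIntegrable (by norm_num)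
  obtain ⟨D, hD, hcut⟩ := exists_cutoff N
  set v := volume (Metric.ball (0 : Rn N) 1) with hv
  have hv1 : v ≠ ⊤ := measure_ball_lt_top.ne
  -- `K` is independent of R: |∇χ| ≤ D/R, while Hölder's inequality from L^{2*} to L² on a set
  -- inside the ball of radius 2R costs its volume to the power 1/2 − 1/2* = 1/N, at most 2R
  -- v^{1/N}. The powers of R cancel.
  set K : ℝ≥0∞ := ENNReal.ofReal (√N * D * 2) * v ^ ((N : ℝ)⁻¹) with hK
  have hK1 : K ≠ ⊤ := ENNReal.mul_ne_top ENNReal.ofReal_ne_top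
    (ENNReal.rpow_ne_top_of_nonneg (by positivity) hv1)
  have hmain : ∀ ε : ℝ≥0∞, ε ≠ 0 → ε ≠ ⊤ →
      eLpNorm f r volume ≤ C * (eLpNorm g 2 volume + K * ε) + ε := by
    intro ε hε hε'
    obtain ⟨R₀, hR₀⟩ := exists_eLpNorm_tail_le ENNReal.ofReal_ne_top hf hε
    set R := max R₀ 1 with hR
    have hRpos : 0 < R := lt_of_lt_of_le one_pos (le_max_right _ _)
    have htail := hR₀ R (le_max_left _ _)
    obtain ⟨χ, hχ, hχc, h0, h1, hin, hout, hd, hdin⟩ := hcut R hRpos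
    -- The gradient of χ lives on this annulus, so the cutoff term only sees the tail of f, whose
    -- L^{2*} norm is at most ε.
    set A : Set (Rn N) := Metric.closedBall 0 (2 * R) ∩ {x | R ≤ ‖x‖} with hA
    have hAm : MeasurableSet A := measurableSet_closedBall.inter
      (measurableSet_le measurable_const measurable_norm)
    have hdA : ∀ x, x ∉ A → fderiv ℝ χ x = 0 := by
      intro x hx
      by_cases h3 : ‖x‖ < R
      · exact hdin x h3
      · have h4 : 2 * R < ‖x‖ := by
          by_contra! h5
          exact hx ⟨mem_closedBall_zero_iff.2 h5, not_lt.1 h3⟩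
        have : χ =ᶠ[𝓝 x] fun _ => 0 := by
          filter_upwards [(isOpen_lt continuous_const continuous_norm).mem_nhds h4] with y hy
          exact hout y (le_of_lt hy)
        rw [this.fderiv_eq]; simp
    have hterm : eLpNorm (cutoffTerm χ f) 2 volume ≤ K * ε := by
      have e1 : eLpNorm (cutoffTerm χ f) 2 volume ≤
          ENNReal.ofReal (√N * (D / R)) * eLpNorm (A.indicator f) 2 volume := by
        refine eLpNorm_le_mul_eLpNorm_of_ae_le_mul (Eventually.of_forall fun x => ?_) 2
        refine (norm_cutoffTerm_le χ f x).trans ?_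
        by_cases hx : x ∈ A
        · rw [indicator_of_mem hx]
          gcongr
          exact hd x
        · simp [hdA x hx, hx]
      have e2 : eLpNorm (A.indicator f) 2 volume ≤
          ε * (ENNReal.ofReal (2 * R) * v ^ ((N : ℝ)⁻¹)) := by
        rw [eLpNorm_indicator_eq_eLpNorm_restrict hAm]
        refine (eLpNorm_le_eLpNorm_mul_rpow_measure_univ hr2 hf.1.restrict).trans ?_
        rw [← eLpNorm_indicator_eq_eLpNorm_restrict hAm, Measure.restrict_apply_univ]
        gcongr
        · refine le_trans ?_ htail
          refine eLpNorm_mono fun x => ?_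
          by_cases hx : x ∈ A
          · rw [indicator_of_mem hx, indicator_of_mem (by exact hx.2)]
          · rw [indicator_of_notMem hx]; simp
        · have e3 : 1 / (2 : ℝ≥0∞).toReal - 1 / r.toReal = (N : ℝ)⁻¹ := by
            rw [hr, ENNReal.toReal_ofReal (by linarith), one_div, one_div, critExp_inv hN]
            simp
          rw [e3]
          calc volume A ^ (N : ℝ)⁻¹ ≤ (ENNReal.ofReal (2 * R) ^ (N : ℝ) * v) ^ (N : ℝ)⁻¹ := by
                gcongr
                refine (measure_mono inter_subset_left).trans ?_
                rw [Measure.addHaar_closedBall _ _ (by positivity),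
                  ENNReal.rpow_natCast, ENNReal.ofReal_pow (by positivity)]
                simp [hv]
            _ = _ := by
                rw [ENNReal.mul_rpow_of_nonneg _ _ (by positivity), ENNReal.rpow_rpow_inv hN0.ne']
      refine (e1.trans (mul_le_mul_right e2 _)).trans (le_of_eq ?_)
      have e4 : √N * D * 2 = √N * (D / R) * (2 * R) := by field_simp
      rw [hK, e4, ENNReal.ofReal_mul (p := √N * (D / R)) (by positivity)]
      ring
    have hm3 : MemLp (cutoffTerm χ f) 2 volume :=
      ⟨aestronglyMeasurable_cutoffTerm hχ hf.1,
        hterm.trans_lt (ENNReal.mul_lt_top hK1.lt_top hε'.lt_top)⟩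
    have hχg : ∀ x, ‖χ x • g x‖ ≤ ‖g x‖ := fun x => by
      rw [norm_smul, Real.norm_eq_abs, abs_of_nonneg (h0 x)]
      exact mul_le_of_le_one_left (norm_nonneg _) (h1 x)
    have hm2 : MemLp (fun x => χ x • g x) 2 volume :=
      hg.of_le (hχ.continuous.aestronglyMeasurable.smul hg.1) (Eventually.of_forall hχg)
    have hm1r : MemLp (fun x => χ x • f x) r volume := by
      refine hf.of_le (hχ.continuous.aestronglyMeasurable.smul hf.1) (Eventually.of_forall
        fun x => ?_)
      rw [norm_smul, Real.norm_eq_abs, abs_of_nonneg (h0 x)]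
      exact mul_le_of_le_one_left (norm_nonneg _) (h1 x)
    -- The cut-off function vanishes outside a ball of finite measure, where L^{2*} is contained in
    -- L²; this places it in H¹.
    have hm1 : MemLp (fun x => χ x • f x) 2 volume := by
      have hfin : IsFiniteMeasure (volume.restrict (Metric.closedBall (0 : Rn N) (2 * R))) :=
        ⟨by simpa using measure_closedBall_lt_top⟩
      have h3 : MemLp (fun x => χ x • f x) 2
          (volume.restrict (Metric.closedBall (0 : Rn N) (2 * R))) :=
        hm1r.restrict _ |>.mono_exponent hr2
      rw [← memLp_indicator_iff_restrict measurableSet_closedBall] at h3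
      refine (memLp_congr_ae (Eventually.of_forall fun x => ?_)).1 h3
      by_cases hx : x ∈ Metric.closedBall (0 : Rn N) (2 * R)
      · rw [indicator_of_mem hx]
      · rw [indicator_of_notMem hx, hout x, zero_smul]
        rw [mem_closedBall_zero_iff, not_le] at hx
        exact hx.le
    set w := H1.ofMemLp _ _ hm1 (hm2.add hm3) (h.smul_smooth hlf hlg hχ)
    have hsob := hC w
    have hw1 : w.fn =ᵐ[volume] fun x => χ x • f x := H1.fn_ofMemLp _ _ _
    have hw2 : w.grad =ᵐ[volume] (fun x => χ x • g x) + cutoffTerm χ f := H1.grad_ofMemLp _ _ _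
    rw [eLpNorm_congr_ae hw1, eLpNorm_congr_ae hw2] at hsob
    have hsub : eLpNorm (f - fun x => χ x • f x) r volume ≤ ε := by
      rw [eLpNorm_sub_comm]
      exact (eLpNorm_mono (norm_cutoff_sub_le h0 h1 hin f)).trans htail
    have e : f = (fun x => χ x • f x) + (f - fun x => χ x • f x) := by abel
    calc eLpNorm f r volume ≤ eLpNorm (fun x => χ x • f x) r volume +
          eLpNorm (f - fun x => χ x • f x) r volume := by
          conv_lhs => rw [e]
          exact eLpNorm_add_le hm1r.1 (hf.1.sub hm1r.1) hr1
      _ ≤ C * (eLpNorm g 2 volume + K * ε) + ε := by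
          gcongr
          refine hsob.trans ?_
          gcongr
          refine (eLpNorm_add_le hm2.1 hm3.1 (by norm_num)).trans ?_
          gcongr
          exact eLpNorm_mono hχg
  have hlim : Tendsto (fun n : ℕ => C * (eLpNorm g 2 volume + K * (n + 1 : ℝ≥0∞)⁻¹) +
      (n + 1 : ℝ≥0∞)⁻¹) atTop (𝓝 (C * (eLpNorm g 2 volume + K * 0) + 0)) := by
    have ht : Tendsto (fun n : ℕ => (n + 1 : ℝ≥0∞)⁻¹) atTop (𝓝 0) := by
      have := (tendsto_add_atTop_iff_nat 1).2 ENNReal.tendsto_inv_nat_nhds_zero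
      simpa using this
    refine Tendsto.add (ENNReal.Tendsto.const_mul (tendsto_const_nhds.add
      (ENNReal.Tendsto.const_mul ht (Or.inr hK1))) (Or.inr ENNReal.coe_ne_top)) ht
  rw [mul_zero, add_zero, add_zero] at hlim
  exact ge_of_tendsto' hlim fun n => hmain _ (by simp) (by simp)

variable (𝕜 N) in
/-- There is a function in `H¹` with positive norms. -/
theorem H1.exists_pos (hN : 3 ≤ N) : ∃ u : H1 𝕜 N, 0 < u.normLp 2 ∧ 0 < u.normGrad ∧
    ∀ p : ℝ, 0 < p → MemLp u.fn (ENNReal.ofReal p) volume ∧ 0 < u.normLp p := by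
  let b : ContDiffBump (0 : Rn N) := ⟨1, 2, one_pos, one_lt_two⟩
  set f : Rn N → 𝕜 := fun x => (b x : 𝕜) with hf
  have hbs : ContDiff ℝ ∞ b := b.contDiff
  have hfs : ContDiff ℝ ∞ f := (RCLike.ofRealCLM (K := 𝕜)).contDiff.comp hbs
  have hfc : HasCompactSupport f := b.hasCompactSupport.comp_left (g := fun x : ℝ => (x : 𝕜))
    (by simp)
  have hne : ¬ f =ᵐ[volume] 0 := by
    rw [hfs.continuous.ae_eq_iff_eq volume continuous_zero]
    intro h
    have h1 := congrFun h 0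
    have h2 : b (0 : Rn N) = 1 := b.one_of_mem_closedBall (by simp [b])
    simp [hf, h2] at h1
  set u := H1.ofSmooth f hfs hfc with hu
  have hfn : u.fn =ᵐ[volume] f := H1.fn_ofMemLp _ _ _
  have hall : ∀ p : ℝ, 0 < p → MemLp u.fn (ENNReal.ofReal p) volume ∧ 0 < u.normLp p := by
    intro p hp
    have hm : MemLp u.fn (ENNReal.ofReal p) volume :=
      (memLp_congr_ae hfn).2 (hfs.continuous.memLp_of_hasCompactSupport hfc)
    refine ⟨hm, lt_of_le_of_ne (u.normLp_nonneg p) fun h => hne ?_⟩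
    exact hfn.symm.trans ((lpNorm_eq_zero hm (by simpa using hp)).1 h.symm)
  -- A vanishing gradient would make the critical norm vanish, by the Sobolev inequality.
  refine ⟨u, (hall 2 two_pos).2, lt_of_le_of_ne u.normGrad_nonneg fun h => ?_, hall⟩
  obtain ⟨C, hC⟩ := H1.exists_sobolev 𝕜 hN
  have h1 := hC u
  have hcr := critExp_pos hN
  have h2 := hall (critExp N) (by linarith)
  rw [← ofReal_lpNorm u.memLp_grad, ← ofReal_lpNorm h2.1] at h1
  have h3 : lpNorm u.grad 2 volume = 0 := h.symm
  rw [h3] at h1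
  simp only [ENNReal.ofReal_zero, mul_zero, nonpos_iff_eq_zero, ENNReal.ofReal_eq_zero] at h1
  exact absurd h2.2 (not_lt.2 h1)

variable (𝕜) in
-- The supremum is a genuine one: the homogeneous Sobolev inequality supplies a positive admissible
-- constant, and a test function bounds the admissible constants above. The inequality passes to the
-- supremum because, for fixed f, it is a closed condition on s.
theorem sobolevConst_spec (hN : 3 ≤ N) : 0 < sobolevConst 𝕜 N ∧
    ∀ (f : Rn N → 𝕜) (g : Rn N → EuclideanSpace 𝕜 (Fin N)),
    MemLp f (ENNReal.ofReal (critExp N)) volume → MemLp g 2 volume → HasWeakGradient f g →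
      sobolevConst 𝕜 N * lpNorm f (ENNReal.ofReal (critExp N)) volume ^ 2 ≤
        lpNorm g 2 volume ^ 2 := by
  obtain ⟨C, hC⟩ := exists_sobolev_homogeneous 𝕜 hN
  have hcr := critExp_pos hN
  set T := {s : ℝ | ∀ (f : Rn N → 𝕜) (g : Rn N → EuclideanSpace 𝕜 (Fin N)),
    MemLp f (ENNReal.ofReal (critExp N)) volume → MemLp g 2 volume → HasWeakGradient f g →
      s * lpNorm f (ENNReal.ofReal (critExp N)) volume ^ 2 ≤ lpNorm g 2 volume ^ 2} with hT
  obtain ⟨u, -, -, hu⟩ := H1.exists_pos 𝕜 N hN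
  obtain ⟨hm, hpos⟩ := hu (critExp N) (by linarith)
  have hbdd : BddAbove T := by
    refine ⟨u.normGrad ^ 2 / u.normLp (critExp N) ^ 2, fun s hs => ?_⟩
    rw [le_div_iff₀ (by positivity)]
    exact hs _ _ hm u.memLp_grad u.hasWeakGradient
  have hmem : 1 / ((C : ℝ) + 1) ^ 2 ∈ T := by
    intro f g hf hg h
    have h1 := hC f g hf hg h
    rw [← ofReal_lpNorm hf, ← ofReal_lpNorm hg, ← ENNReal.ofReal_coe_nnreal,
      ← ENNReal.ofReal_mul C.coe_nonneg, ENNReal.ofReal_le_ofReal_iff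
        (mul_nonneg C.coe_nonneg lpNorm_nonneg)] at h1
    have h2 : lpNorm f (ENNReal.ofReal (critExp N)) volume ≤ (C + 1) * lpNorm g 2 volume :=
      h1.trans (mul_le_mul_of_nonneg_right (by linarith) lpNorm_nonneg)
    have h3 := pow_le_pow_left₀ lpNorm_nonneg h2 2
    rw [div_mul_eq_mul_div, one_mul, div_le_iff₀ (by positivity)]
    linarith
  refine ⟨lt_of_lt_of_le (by positivity) (le_csSup hbdd hmem), fun f g hf hg h => ?_⟩
  change sSup T * _ ≤ _
  rcases eq_or_lt_of_le (lpNorm_nonneg (f := f) (p := ENNReal.ofReal (critExp N))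
    (μ := (volume : Measure (Rn N)))) with h0 | h0
  · rw [← h0]; simp
  · rw [← le_div_iff₀ (by positivity)]
    refine csSup_le ⟨_, hmem⟩ fun s hs => ?_
    rw [le_div_iff₀ (by positivity)]
    exact hs f g hf hg h

theorem H1.memLp_critExp (hN : 3 ≤ N) (u : H1 𝕜 N) :
    MemLp u.fn (ENNReal.ofReal (critExp N)) volume := by
  obtain ⟨C, hC⟩ := H1.exists_sobolev 𝕜 hN
  exact ⟨u.memLp_fn.1, (hC u).trans_lt (ENNReal.mul_lt_top ENNReal.coe_lt_top u.memLp_grad.2)⟩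

theorem H1.sobolev (hN : 3 ≤ N) (u : H1 𝕜 N) :
    sobolevConst 𝕜 N * u.normLp (critExp N) ^ 2 ≤ u.normGrad ^ 2 :=
  (sobolevConst_spec 𝕜 hN).2 _ _ (u.memLp_critExp hN) u.memLp_grad u.hasWeakGradient

/-- Interpolation of the `L^p` seminorms. -/
theorem eLpNorm_le_rpow_mul_rpow {α E : Type*} [MeasurableSpace α] {ν : Measure α}
    [NormedAddCommGroup E] {f : α → E} (hf : AEStronglyMeasurable f ν) {q s t θ : ℝ} (hq : 0 < q)
    (hs : 0 < s) (ht : 0 < t) (hθ0 : 0 ≤ θ) (hθ1 : θ ≤ 1) (h : 1 / q = (1 - θ) / s + θ / t) :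
    eLpNorm f (ENNReal.ofReal q) ν ≤
      eLpNorm f (ENNReal.ofReal s) ν ^ (1 - θ) * eLpNorm f (ENNReal.ofReal t) ν ^ θ := by
  have hpow : ∀ p : ℝ, 0 < p →
      eLpNorm f (ENNReal.ofReal p) ν ^ p = ∫⁻ x, ‖f x‖ₑ ^ p ∂ν := by
    intro p hp
    have := eLpNorm_nnreal_pow_eq_lintegral (μ := ν) (f := f) (p := p.toNNReal)
      (by simpa using hp)
    rwa [Real.coe_toNNReal _ hp.le] at this
  have h1 : q * (1 - θ) / s + q * θ / t = 1 := by
    have : q * (1 - θ) / s + q * θ / t = q * ((1 - θ) / s + θ / t) := by ring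
    rw [this, ← h]; field_simp
  rw [← ENNReal.rpow_le_rpow_iff hq, hpow q hq, ENNReal.mul_rpow_of_nonneg _ _ hq.le]
  have h1θ : 0 ≤ 1 - θ := by linarith
  have hh := ENNReal.lintegral_mul_norm_pow_le (μ := ν) (f := fun x => ‖f x‖ₑ ^ s)
    (g := fun x => ‖f x‖ₑ ^ t) (hf.enorm.pow_const _) (hf.enorm.pow_const _)
    (p := q * (1 - θ) / s) (q := q * θ / t) (by positivity) (by positivity) h1
  rw [← hpow s hs, ← hpow t ht] at hh
  have e1 : s * (q * (1 - θ) / s) = (1 - θ) * q := by field_simp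
  have e2 : t * (q * θ / t) = θ * q := by field_simp
  simp only [← ENNReal.rpow_mul, e1, e2] at hh
  rw [← ENNReal.rpow_mul, ← ENNReal.rpow_mul]
  refine le_trans (le_of_eq (lintegral_congr fun x => ?_)) hh
  rw [← ENNReal.rpow_add_of_nonneg _ _ (by positivity) (by positivity)]
  congr 1; ring

/-- The Gagliardo-Nirenberg exponent `β = N (1/2 - 1/q)`. -/
abbrev gnExp (N : ℕ) (q : ℝ) : ℝ := (N : ℝ) * (1 / 2 - 1 / q)

theorem gnExp_mem (hN : 3 ≤ N) {q : ℝ} (hq : 2 ≤ q) (hq' : q ≤ critExp N) :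
    0 ≤ gnExp N q ∧ gnExp N q ≤ 1 := by
  have hN0 : (0 : ℝ) < N := by exact_mod_cast (by omega : 0 < N)
  have h1 : 1 / q ≤ 1 / 2 := one_div_le_one_div_of_le two_pos hq
  have h2 : 1 / critExp N ≤ 1 / q := one_div_le_one_div_of_le (by linarith) hq'
  refine ⟨mul_nonneg hN0.le (by linarith), ?_⟩
  rw [one_div, critExp_inv hN] at h2
  calc (N : ℝ) * (1 / 2 - 1 / q) ≤ N * (N : ℝ)⁻¹ := by
        gcongr
        linarith
    _ = 1 := mul_inv_cancel₀ hN0.ne'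

/-- Interpolation between L² and L^{2*} with weight β, followed by the Sobolev inequality on the
second factor. -/
theorem exists_gagliardoNirenberg (hN : 3 ≤ N) {q : ℝ} (hq : 2 ≤ q) (hq' : q ≤ critExp N) :
    ∃ C : ℝ, 0 ≤ C ∧ ∀ f : H1 𝕜 N,
    eLpNorm f.fn (ENNReal.ofReal q) volume ≤ ENNReal.ofReal (C *
      f.normGrad ^ (gnExp N q) * f.normLp 2 ^ (1 - gnExp N q)) := by
  obtain ⟨C, hC⟩ := H1.exists_sobolev 𝕜 hN
  have hcr := critExp_pos hN
  have hN0 : (0 : ℝ) < N := by exact_mod_cast (by omega : 0 < N)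
  obtain ⟨h0, h1⟩ := gnExp_mem hN hq hq'
  set β := gnExp N q with hβ
  refine ⟨(C : ℝ) ^ β, by positivity, fun f => ?_⟩
  have h2 := eLpNorm_le_rpow_mul_rpow f.memLp_fn.1 (q := q) (s := 2) (t := critExp N) (θ := β)
    (by linarith) two_pos (by linarith) h0 h1 (by
      rw [div_eq_mul_inv β, critExp_inv hN, hβ, gnExp]; field_simp; ring)
  refine h2.trans ?_
  calc eLpNorm f.fn (ENNReal.ofReal 2) volume ^ (1 - β) *
        eLpNorm f.fn (ENNReal.ofReal (critExp N)) volume ^ β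
      ≤ eLpNorm f.fn (ENNReal.ofReal 2) volume ^ (1 - β) *
        (C * eLpNorm f.grad 2 volume) ^ β := by gcongr; exact hC f
    _ = _ := by
      rw [← ofReal_lpNorm f.memLp_grad, ← ofReal_lpNorm (p := ENNReal.ofReal 2)
        (by simpa using f.memLp_fn), ← ENNReal.ofReal_coe_nnreal, ← ENNReal.ofReal_mul C.coe_nonneg,
        ENNReal.ofReal_rpow_of_nonneg lpNorm_nonneg (by linarith),
        ENNReal.ofReal_rpow_of_nonneg (mul_nonneg C.coe_nonneg lpNorm_nonneg) h0,
        ← ENNReal.ofReal_mul (Real.rpow_nonneg lpNorm_nonneg _),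
        Real.mul_rpow C.coe_nonneg lpNorm_nonneg]
      congr 1
      change f.normLp 2 ^ (1 - β) * ((C : ℝ) ^ β * f.normGrad ^ β) = _
      ring

theorem H1.memLp (hN : 3 ≤ N) {q : ℝ} (hq : 2 ≤ q) (hq' : q ≤ critExp N) (u : H1 𝕜 N) :
    MemLp u.fn (ENNReal.ofReal q) volume := by
  obtain ⟨C, -, hC⟩ := exists_gagliardoNirenberg (𝕜 := 𝕜) hN hq hq'
  exact ⟨u.memLp_fn.1, (hC u).trans_lt ENNReal.ofReal_lt_top⟩

/-- If the product of norms on the right is positive, dividing by it lets the inequality pass to the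
infimum; if it is zero, any admissible constant already forces the left side to vanish. Positivity
follows by testing with a function all of whose norms are positive. -/
theorem gagliardoNirenbergConst_spec (hN : 3 ≤ N) {q : ℝ} (hq : 2 ≤ q) (hq' : q ≤ critExp N) :
    0 < gagliardoNirenbergConst 𝕜 N q ∧ ∀ f : H1 𝕜 N, f.normLp q ≤
      gagliardoNirenbergConst 𝕜 N q * f.normGrad ^ (gnExp N q) *
        f.normLp 2 ^ (1 - gnExp N q) := by
  obtain ⟨C₀, hC₀⟩ := exists_gagliardoNirenberg (𝕜 := 𝕜) hN hq hq'
  have hspec : ∀ f : H1 𝕜 N, f.normLp q ≤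
      gagliardoNirenbergConst 𝕜 N q * f.normGrad ^ (gnExp N q) *
        f.normLp 2 ^ (1 - gnExp N q) := by
    intro f
    have hx : 0 ≤ f.normGrad ^ (gnExp N q) * f.normLp 2 ^ (1 - gnExp N q) :=
      mul_nonneg (Real.rpow_nonneg f.normGrad_nonneg _) (Real.rpow_nonneg (f.normLp_nonneg 2) _)
    have key : ∀ C, 0 ≤ C → eLpNorm f.fn (ENNReal.ofReal q) volume ≤ ENNReal.ofReal (C *
        f.normGrad ^ (gnExp N q) * f.normLp 2 ^ (1 - gnExp N q)) →
        f.normLp q ≤ C * (f.normGrad ^ (gnExp N q) * f.normLp 2 ^ (1 - gnExp N q)) := by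
      intro C hC h
      rw [← ofReal_lpNorm (f.memLp hN hq hq'), mul_assoc,
        ENNReal.ofReal_le_ofReal_iff (by positivity)] at h
      exact h
    rw [mul_assoc]
    rcases eq_or_lt_of_le hx with h0 | h0
    · have := key C₀ hC₀.1 (hC₀.2 f)
      rw [← h0] at this ⊢
      simpa using this
    · rw [← div_le_iff₀ h0]
      refine le_csInf ⟨C₀, hC₀⟩ fun C hC => ?_
      rw [div_le_iff₀ h0]
      exact key C hC.1 (hC.2 f)
  refine ⟨?_, hspec⟩
  obtain ⟨u, h2, hg, hu⟩ := H1.exists_pos 𝕜 N hN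
  have h3 := (hu q (by linarith)).2.trans_le (hspec u)
  have h4 : 0 < u.normGrad ^ (gnExp N q) * u.normLp 2 ^ (1 - gnExp N q) := by positivity
  rw [mul_assoc] at h3
  exact pos_of_mul_pos_left h3 h4.le

/-- The embedding `H¹ ⊂ L^q` is continuous. -/
theorem H1.continuous_normLp (hN : 3 ≤ N) {q : ℝ} (hq : 2 ≤ q) (hq' : q ≤ critExp N) :
    Continuous fun u : H1 𝕜 N => u.normLp q := by
  obtain ⟨hC, hspec⟩ := gagliardoNirenbergConst_spec (𝕜 := 𝕜) hN hq hq'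
  obtain ⟨h0, h1⟩ := gnExp_mem hN hq hq'
  set C := gagliardoNirenbergConst 𝕜 N q
  set β := gnExp N q
  have hle : ∀ u : H1 𝕜 N, u.normLp q ≤ C * ‖u‖ := by
    intro u
    refine (hspec u).trans ?_
    rw [mul_assoc]
    gcongr
    calc u.normGrad ^ β * u.normLp 2 ^ (1 - β) ≤ ‖u‖ ^ β * ‖u‖ ^ (1 - β) := by
          have := u.normGrad_nonneg
          have := u.normLp_nonneg 2
          have := u.normGrad_le
          have := u.normLp_two_le
          have : 0 ≤ 1 - β := by linarith
          gcongr
      _ = ‖u‖ := by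
          rw [← Real.rpow_add_of_nonneg (norm_nonneg _) h0 (by linarith)]
          simp
  have h1q : 1 ≤ ENNReal.ofReal q := by
    rw [ENNReal.one_le_ofReal]; linarith
  have htri : ∀ u v : H1 𝕜 N, u.normLp q ≤ v.normLp q + C * ‖u - v‖ := by
    intro u v
    refine le_trans ?_ (add_le_add_right (hle (u - v)) _)
    have e : u.fn =ᵐ[volume] v.fn + (u - v).fn := by
      filter_upwards [H1.fn_sub u v] with x hx
      simp [hx]
    rw [H1.normLp, lpNorm_congr_ae e]
    exact lpNorm_add_le (v.memLp hN hq hq') h1q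
  refine LipschitzWith.continuous (K := C.toNNReal) (LipschitzWith.of_dist_le_mul fun u v => ?_)
  rw [Real.coe_toNNReal _ hC.le, Real.dist_eq, dist_eq_norm, abs_le]
  have a1 := htri u v
  have a2 := htri v u
  rw [norm_sub_rev v u] at a2
  constructor <;> linarith

end NormalizedNLS

end

noncomputable section
namespace NormalizedNLS
open Filter Topology

variable {𝕜 : Type*} [RCLike 𝕜] {N : ℕ}

/-! ### Dilations -/

theorem aestronglyMeasurable_comp_smul {E : Type*} [NormedAddCommGroup E] {s : ℝ} (hs : 0 < s)
    {f : Rn N → E}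
    (hf : AEStronglyMeasurable f volume) : AEStronglyMeasurable (fun x => f (s • x)) volume :=
  hf.comp_quasiMeasurePreserving (Measure.quasiMeasurePreserving_smul volume hs.ne')

section DilFn

variable {E : Type*} [NormedAddCommGroup E] [NormedSpace ℝ E]

/-- The dilation `x ↦ s^a f(s x)`. -/
def dilFn (a s : ℝ) (f : Rn N → E) (x : Rn N) : E := s ^ a • f (s • x)

theorem aestronglyMeasurable_dilFn (a : ℝ) {s : ℝ} (hs : 0 < s) {f : Rn N → E}
    (hf : AEStronglyMeasurable f volume) : AEStronglyMeasurable (dilFn a s f) volume :=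
  (aestronglyMeasurable_comp_smul hs hf).const_smul _

theorem eLpNorm_dilFn (a : ℝ) {s p : ℝ} (hs : 0 < s) (hp : 0 < p) {f : Rn N → E}
    (hf : AEStronglyMeasurable f volume) :
    eLpNorm (dilFn a s f) (ENNReal.ofReal p) volume =
      ENNReal.ofReal (s ^ (a - N / p)) * eLpNorm f (ENNReal.ofReal p) volume := by
  have h1 : eLpNorm (fun x => f (s • x)) (ENNReal.ofReal p) volume =
      ENNReal.ofReal (s ^ (-(N / p))) * eLpNorm f (ENNReal.ofReal p) volume := by
    have hmap := Measure.map_addHaar_smul (volume : Measure (Rn N)) hs.ne'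
    have h2 := eLpNorm_map_measure (p := ENNReal.ofReal p) (μ := (volume : Measure (Rn N)))
      (f := fun x : Rn N => s • x) (g := f) (by
        rw [hmap]; exact hf.smul_measure _) (measurable_const_smul s).aemeasurable
    rw [hmap, eLpNorm_smul_measure_of_ne_top ENNReal.ofReal_ne_top] at h2
    have e : (fun x => f (s • x)) = f ∘ fun x : Rn N => s • x := rfl
    rw [e, ← h2, smul_eq_mul]
    congr 1
    have e2 : (1 / ENNReal.ofReal p).toReal = 1 / p := by
      rw [ENNReal.toReal_div, ENNReal.toReal_ofReal hp.le]; simp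
    rw [e2, ENNReal.ofReal_rpow_of_nonneg (abs_nonneg _) (by positivity)]
    congr 1
    rw [abs_of_pos (by positivity), Real.inv_rpow (by positivity), finrank_euclideanSpace_fin,
      ← Real.rpow_natCast, ← Real.rpow_mul hs.le, Real.rpow_neg hs.le]
    congr 2; ring
  have h3 : dilFn a s f = (s ^ a) • fun x => f (s • x) := rfl
  rw [h3, eLpNorm_const_smul, h1, ← mul_assoc]
  congr 1
  rw [Real.enorm_eq_ofReal (by positivity), ← ENNReal.ofReal_mul (by positivity),
    ← Real.rpow_add hs]
  congr 2

theorem lpNorm_dilFn (a : ℝ) {s p : ℝ} (hs : 0 < s) (hp : 0 < p) {f : Rn N → E}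
    (hf : AEStronglyMeasurable f volume) :
    lpNorm (dilFn a s f) (ENNReal.ofReal p) volume =
      s ^ (a - N / p) * lpNorm f (ENNReal.ofReal p) volume := by
  rw [← toReal_eLpNorm hf, ← toReal_eLpNorm (aestronglyMeasurable_dilFn a hs hf),
    eLpNorm_dilFn a hs hp hf, ENNReal.toReal_mul, ENNReal.toReal_ofReal (by positivity)]

theorem memLp_dilFn (a : ℝ) {s : ℝ} (hs : 0 < s) {f : Rn N → E}
    (hf : MemLp f 2 volume) : MemLp (dilFn a s f) 2 volume := by
  refine ⟨aestronglyMeasurable_dilFn a hs hf.1, ?_⟩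
  have := eLpNorm_dilFn a hs two_pos hf.1
  simp only [ENNReal.ofReal_ofNat] at this
  rw [this]
  exact ENNReal.mul_lt_top ENNReal.ofReal_lt_top hf.2

theorem dilFn_sub (a s : ℝ) (f g : Rn N → E) : dilFn a s (f - g) = dilFn a s f - dilFn a s g := by
  ext x
  simp [dilFn, smul_sub]

/-- Dominated convergence: for s > s₀/2 all the dilations vanish outside the ball of radius 2R/s₀,
and for s close to s₀ they are uniformly bounded on it. -/
theorem tendsto_dilFn_of_continuous (a : ℝ) {s₀ : ℝ} (hs₀ : 0 < s₀) {f : Rn N → E}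
    (hf : Continuous f) (hc : HasCompactSupport f) :
    Tendsto (fun s => eLpNorm (dilFn a s f - dilFn a s₀ f) 2 volume) (𝓝 s₀) (𝓝 0) := by
  obtain ⟨M, hM⟩ := hf.bounded_above_of_compact_support hc
  obtain ⟨R, hR⟩ := hc.isCompact.isBounded.subset_ball 0
  have hsa : ContinuousAt (fun s : ℝ => s ^ a) s₀ := Real.continuousAt_rpow_const _ _ (Or.inl hs₀.ne')
  have hM0 : 0 ≤ M := (norm_nonneg _).trans (hM 0)
  set K := Metric.closedBall (0 : Rn N) (2 * R / s₀) with hK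
  set B : ℝ≥0∞ := ENNReal.ofReal (((s₀ ^ a + 1) * M) + s₀ ^ a * M) ^ (2 : ℝ) with hB
  have hzero : ∀ s, s₀ / 2 < s → ∀ x, x ∉ K → f (s • x) = 0 := by
    intro s hs x hx
    refine image_eq_zero_of_notMem_tsupport fun h => hx ?_
    have h1 := mem_ball_zero_iff.1 (hR h)
    rw [norm_smul, Real.norm_eq_abs, abs_of_pos (by linarith)] at h1
    rw [hK, mem_closedBall_zero_iff, le_div_iff₀ hs₀]
    nlinarith [norm_nonneg x]
  have hlim : Tendsto (fun s => ∫⁻ x, ‖(dilFn a s f - dilFn a s₀ f) x‖ₑ ^ (2 : ℝ)) (𝓝 s₀)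
      (𝓝 (∫⁻ x : Rn N, 0)) := by
    refine tendsto_lintegral_filter_of_dominated_convergence' (K.indicator fun _ => B) ?_ ?_ ?_ ?_
    · filter_upwards [Ioi_mem_nhds hs₀] with s hs
      exact ((aestronglyMeasurable_dilFn a hs hf.aestronglyMeasurable).sub
        (aestronglyMeasurable_dilFn a hs₀ hf.aestronglyMeasurable)).enorm.pow_const _
    · filter_upwards [Ioi_mem_nhds (half_lt_self hs₀),
        hsa.eventually (Iio_mem_nhds (lt_add_one (s₀ ^ a)))] with s hs hsa'
      have hs' : 0 < s := lt_trans (by positivity) hs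
      refine Eventually.of_forall fun x => ?_
      by_cases hx : x ∈ K
      · rw [indicator_of_mem hx, hB]
        gcongr
        rw [← ofReal_norm]
        refine ENNReal.ofReal_le_ofReal ((norm_sub_le _ _).trans ?_)
        simp only [dilFn, norm_smul, Real.norm_eq_abs, abs_of_pos (Real.rpow_pos_of_pos hs' a),
          abs_of_pos (Real.rpow_pos_of_pos hs₀ a)]
        exact add_le_add (mul_le_mul (le_of_lt hsa') (hM _) (norm_nonneg _) (by positivity))
          (mul_le_mul_of_nonneg_left (hM _) (by positivity))
      · rw [indicator_of_notMem hx]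
        simp [dilFn, hzero s hs x hx, hzero s₀ (half_lt_self hs₀) x hx]
    · rw [lintegral_indicator_const measurableSet_closedBall]
      exact (ENNReal.mul_lt_top (ENNReal.rpow_lt_top_of_nonneg (by norm_num) ENNReal.ofReal_ne_top)
        measure_closedBall_lt_top).ne
    · refine Eventually.of_forall fun x => ?_
      have h1 : ContinuousAt (fun s : ℝ => s ^ a • f (s • x) - s₀ ^ a • f (s₀ • x)) s₀ :=
        (hsa.smul (hf.comp (continuous_id.smul continuous_const)).continuousAt).sub
          continuousAt_const
      have h2 := (ENNReal.continuous_rpow_const (y := 2)).continuousAt.comp h1.enorm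
      have h3 := h2.tendsto
      simpa [dilFn, Function.comp_def] using h3
  have h2 := (ENNReal.continuous_rpow_const (y := 1 / 2)).tendsto _ |>.comp hlim
  simp only [lintegral_zero, ENNReal.zero_rpow_of_pos (by norm_num : (0 : ℝ) < 1 / 2)] at h2
  refine h2.congr fun s => ?_
  simp only [Function.comp_apply]
  rw [← eLpNorm_two_sq, ← ENNReal.rpow_mul]
  norm_num

/-- Dilations depend continuously on the scale. -/
theorem tendsto_dilFn (a : ℝ) {s₀ : ℝ} (hs₀ : 0 < s₀) {f : Rn N → E} (hf : MemLp f 2 volume) :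
    Tendsto (fun s => eLpNorm (dilFn a s f - dilFn a s₀ f) 2 volume) (𝓝 s₀) (𝓝 0) := by
  set κ := s₀ ^ (a - N / 2) with hκ
  have hκ0 : 0 < κ := by positivity
  have hsa : ContinuousAt (fun s : ℝ => s ^ (a - N / 2)) s₀ :=
    Real.continuousAt_rpow_const _ _ (Or.inl hs₀.ne')
  refine ENNReal.tendsto_nhds_zero.2 fun ε hε => ?_
  rcases eq_or_ne ε ⊤ with rfl | hε'
  · simp
  have hε3 : 0 < ε.toReal / 3 := by have := ENNReal.toReal_pos hε.ne' hε'; positivity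
  -- A dilation multiplies L² norms by s^{a−N/2}, which stays below κ + 1 near s₀; an approximation
  -- error η therefore becomes at most ε/3 after dilation.
  set η := ε.toReal / 3 / (κ + 1) with hη
  have hη0 : 0 < η := by positivity
  have hηκ : (κ + 1) * η = ε.toReal / 3 := by rw [hη]; field_simp
  obtain ⟨g, hgc, hfg, hg, hgm⟩ := hf.exists_hasCompactSupport_eLpNorm_sub_le (by norm_num)
    (ENNReal.ofReal_pos.2 hη0).ne'
  have hsmall : ∀ s, 0 < s → s ^ (a - N / 2) < κ + 1 →
      eLpNorm (dilFn a s (f - g)) 2 volume ≤ ENNReal.ofReal (ε.toReal / 3) := by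
    intro s hs h
    have := eLpNorm_dilFn a hs two_pos (hf.sub hgm).1
    simp only [ENNReal.ofReal_ofNat] at this
    rw [this, ← hηκ, ENNReal.ofReal_mul (by positivity)]
    gcongr
  filter_upwards [Ioi_mem_nhds hs₀, hsa.eventually (Iio_mem_nhds (lt_add_one κ)),
    ENNReal.tendsto_nhds_zero.1 (tendsto_dilFn_of_continuous a hs₀ hg hgc)
      (ENNReal.ofReal (ε.toReal / 3)) (ENNReal.ofReal_pos.2 hε3)] with s hs hsκ hsg
  have hs' : 0 < s := hs
  have e : dilFn a s f - dilFn a s₀ f =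
      dilFn a s (f - g) + ((dilFn a s g - dilFn a s₀ g) - dilFn a s₀ (f - g)) := by
    rw [dilFn_sub, dilFn_sub]; abel
  have m1 := (memLp_dilFn a hs' (hf.sub hgm)).1
  have m2 := ((memLp_dilFn a hs' hgm).sub (memLp_dilFn a hs₀ hgm)).1
  have m3 := (memLp_dilFn a hs₀ (hf.sub hgm)).1
  rw [e]
  refine (eLpNorm_add_le m1 (m2.sub m3) (by norm_num)).trans ?_
  refine (add_le_add (hsmall s hs' hsκ) ((eLpNorm_sub_le m2 m3 (by norm_num)).trans
    (add_le_add hsg (hsmall s₀ hs₀ (lt_add_one κ))))).trans ?_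
  rw [← ENNReal.ofReal_add hε3.le hε3.le, ← ENNReal.ofReal_add hε3.le (by positivity)]
  refine ENNReal.ofReal_le_of_le_toReal (by linarith)

end DilFn

/-- The weak gradient of f is tested with y ↦ φ(y/s), and the variable is changed by y = s x. -/
theorem HasWeakGradient.dilFn {f : Rn N → 𝕜} {g : Rn N → EuclideanSpace 𝕜 (Fin N)}
    (h : HasWeakGradient f g) (a : ℝ) {s : ℝ} (hs : 0 < s) :
    HasWeakGradient (NormalizedNLS.dilFn a s f) (NormalizedNLS.dilFn (a + 1) s g) := by
  intro φ hφ hc i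
  have hss : s * s⁻¹ = 1 := mul_inv_cancel₀ hs.ne'
  have h1 := h (fun y => φ (s⁻¹ • y)) (hφ.comp (contDiff_const_smul _))
    (hc.comp_homeomorph (Homeomorph.smulOfNeZero s⁻¹ (inv_ne_zero hs.ne'))) i
  have h2 : ∀ y, fderiv ℝ (fun y => φ (s⁻¹ • y)) y (EuclideanSpace.single i 1) =
      s⁻¹ * fderiv ℝ φ (s⁻¹ • y) (EuclideanSpace.single i 1) := fun y => by
    rw [fderiv_comp_smul]; simp
  simp only [h2] at h1
  have e1 : ∀ x : Rn N, fderiv ℝ φ x (EuclideanSpace.single i 1) • NormalizedNLS.dilFn a s f x =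
      s ^ (a + 1) • ((fun y => (s⁻¹ * fderiv ℝ φ (s⁻¹ • y) (EuclideanSpace.single i 1)) • f y)
        (s • x)) := by
    intro x
    simp only [NormalizedNLS.dilFn, smul_smul, inv_mul_cancel₀ hs.ne', one_smul]
    congr 1
    rw [Real.rpow_add_one hs.ne']
    field_simp
  have e2 : ∀ x : Rn N, φ x • NormalizedNLS.dilFn (a + 1) s g x i =
      s ^ (a + 1) • ((fun y => φ (s⁻¹ • y) • g y i) (s • x)) := by
    intro x
    simp only [NormalizedNLS.dilFn, smul_smul, inv_mul_cancel₀ hs.ne', one_smul,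
      PiLp.smul_apply]
    rw [mul_comm]
  simp_rw [e1, e2]
  rw [integral_smul, integral_smul,
    Measure.integral_comp_smul volume
      (fun y => (s⁻¹ * fderiv ℝ φ (s⁻¹ • y) (EuclideanSpace.single i 1)) • f y),
    Measure.integral_comp_smul volume (fun y => φ (s⁻¹ • y) • g y i), h1, smul_neg, smul_neg]

namespace H1

/-- The mass preserving dilation `u ↦ s^{N/2} u(s ·)`, for `s > 0`. -/
def dil (s : ℝ) (u : H1 𝕜 N) : H1 𝕜 N :=
  if hs : 0 < s then ofMemLp (dilFn (N / 2) s u.fn) (dilFn (N / 2 + 1) s u.grad)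
    (memLp_dilFn _ hs u.memLp_fn) (memLp_dilFn _ hs u.memLp_grad)
    (u.hasWeakGradient.dilFn _ hs) else u

theorem fn_dil {s : ℝ} (hs : 0 < s) (u : H1 𝕜 N) :
    (dil s u).fn =ᵐ[volume] dilFn (N / 2) s u.fn := by
  rw [dil, dif_pos hs]; exact fn_ofMemLp _ _ _

theorem grad_dil {s : ℝ} (hs : 0 < s) (u : H1 𝕜 N) :
    (dil s u).grad =ᵐ[volume] dilFn (N / 2 + 1) s u.grad := by
  rw [dil, dif_pos hs]; exact grad_ofMemLp _ _ _

theorem normLp_dil {s p : ℝ} (hs : 0 < s) (hp : 0 < p) (u : H1 𝕜 N) :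
    (dil s u).normLp p = s ^ ((N : ℝ) / 2 - N / p) * u.normLp p := by
  rw [normLp, lpNorm_congr_ae (fn_dil hs u), lpNorm_dilFn _ hs hp u.memLp_fn.1]; rfl

theorem normLp_two_dil {s : ℝ} (hs : 0 < s) (u : H1 𝕜 N) :
    (dil s u).normLp 2 = u.normLp 2 := by
  rw [normLp_dil hs two_pos]; simp

theorem normGrad_dil {s : ℝ} (hs : 0 < s) (u : H1 𝕜 N) :
    (dil s u).normGrad = s * u.normGrad := by
  have := lpNorm_dilFn ((N : ℝ) / 2 + 1) hs two_pos u.memLp_grad.1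
  simp only [ENNReal.ofReal_ofNat] at this
  rw [normGrad, lpNorm_congr_ae (grad_dil hs u), this]
  simp [normGrad]

theorem IsRadial.dil {u : H1 𝕜 N} (hu : u.IsRadial) (s : ℝ) : (dil s u).IsRadial := by
  by_cases hs : 0 < s
  · obtain ⟨f, hf⟩ := hu
    refine ⟨fun r => s ^ ((N : ℝ) / 2) • f (s * r), ?_⟩
    have h1 := (Measure.quasiMeasurePreserving_smul (volume : Measure (Rn N)) hs.ne').ae hf
    filter_upwards [fn_dil hs u, h1] with x h2 h3
    rw [h2, dilFn, h3, norm_smul, Real.norm_eq_abs, abs_of_pos hs]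
  · rw [H1.dil, dif_neg hs]; exact hu

theorem continuousAt_dil (u : H1 𝕜 N) {s₀ : ℝ} (hs₀ : 0 < s₀) :
    ContinuousAt (fun s => dil s u) s₀ := by
  rw [ContinuousAt, tendsto_iff_norm_sub_tendsto_zero]
  have h1 := (ENNReal.continuousAt_toReal ENNReal.zero_ne_top).tendsto.comp
    (tendsto_dilFn ((N : ℝ) / 2) hs₀ u.memLp_fn)
  have h2 := (ENNReal.continuousAt_toReal ENNReal.zero_ne_top).tendsto.comp
    (tendsto_dilFn ((N : ℝ) / 2 + 1) hs₀ u.memLp_grad)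
  have h3 := h1.add h2
  simp only [ENNReal.toReal_zero, add_zero] at h3
  refine squeeze_zero' (Eventually.of_forall fun s => norm_nonneg _) ?_ h3
  filter_upwards [Ioi_mem_nhds hs₀] with s hs
  have hs' : 0 < s := hs
  refine (norm_le _).trans (le_of_eq ?_)
  simp only [Function.comp_apply]
  congr 1
  · rw [toReal_eLpNorm ((memLp_dilFn _ hs' u.memLp_fn).sub (memLp_dilFn _ hs₀ u.memLp_fn)).1,
      normLp, ENNReal.ofReal_ofNat]
    refine lpNorm_congr_ae ?_
    filter_upwards [fn_sub (dil s u) (dil s₀ u), fn_dil hs' u, fn_dil hs₀ u] with x e1 e2 e3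
    rw [e1, Pi.sub_apply, Pi.sub_apply, e2, e3]
  · rw [toReal_eLpNorm ((memLp_dilFn _ hs' u.memLp_grad).sub (memLp_dilFn _ hs₀ u.memLp_grad)).1,
      normGrad]
    refine lpNorm_congr_ae ?_
    filter_upwards [grad_sub (dil s u) (dil s₀ u), grad_dil hs' u, grad_dil hs₀ u] with x e1 e2 e3
    rw [e1, Pi.sub_apply, Pi.sub_apply, e2, e3]

end H1

end NormalizedNLS

end

noncomputable section
namespace NormalizedNLS
open Filter Topology
open scoped RealInnerProductSpace

variable {N : ℕ}

/-! ### Polarization with respect to a half-space -/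

namespace Polarization

/-- The signed distance to the hyperplane `⟪x, e⟫ = t`. -/
def ell (e : Rn N) (t : ℝ) (x : Rn N) : ℝ := ⟪x, e⟫ - t

/-- The reflection in the hyperplane `⟪x, e⟫ = t`, for a unit vector `e`. -/
def refl (e : Rn N) (t : ℝ) (x : Rn N) : Rn N := x - (2 * ell e t x) • e

/-- The polarization of `v` with respect to the half-space `⟪x, e⟫ ≤ t`. -/
def pol (e : Rn N) (t : ℝ) (v : Rn N → ℝ) (x : Rn N) : ℝ :=
  if ell e t x ≤ 0 then max (v x) (v (refl e t x)) else min (v x) (v (refl e t x))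

variable {e : Rn N} {t : ℝ}

theorem continuous_ell : Continuous (ell e t) := by
  unfold ell; fun_prop

theorem ell_refl (he : ‖e‖ = 1) (x : Rn N) : ell e t (refl e t x) = -ell e t x := by
  simp only [ell, refl, inner_sub_left, inner_smul_left, real_inner_self_eq_norm_sq, he]
  simp
  ring

theorem refl_refl (he : ‖e‖ = 1) (x : Rn N) : refl e t (refl e t x) = x := by
  rw [refl, ell_refl he, refl]
  module

theorem refl_of_ell_eq_zero {x : Rn N} (h : ell e t x = 0) : refl e t x = x := by
  simp [refl, h]

/-- For t > 0 the origin lies on the side `ell` < 0, and reflecting a point of that side moves it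
away from the origin. This is why polarization lowers the second moment. -/
theorem norm_refl_sq (he : ‖e‖ = 1) (x : Rn N) :
    ‖refl e t x‖ ^ 2 = ‖x‖ ^ 2 - 4 * t * ell e t x := by
  rw [refl, norm_sub_sq_real, norm_smul, he, inner_smul_right, mul_one, Real.norm_eq_abs, sq_abs,
    ell]
  ring

theorem norm_sub_refl_sq (he : ‖e‖ = 1) (x y : Rn N) :
    ‖x - refl e t y‖ ^ 2 = ‖x - y‖ ^ 2 + 4 * ell e t x * ell e t y := by
  have h : x - refl e t y = (x - y) + (2 * ell e t y) • e := by rw [refl]; abel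
  rw [h, norm_add_sq_real, norm_smul, he, inner_smul_right, mul_one, Real.norm_eq_abs, sq_abs,
    inner_sub_left, ell, ell]
  ring

theorem norm_refl_sub_refl (he : ‖e‖ = 1) (x y : Rn N) :
    ‖refl e t x - refl e t y‖ = ‖x - y‖ := by
  have h1 := norm_sub_refl_sq (t := t) he (refl e t x) y
  have h2 := norm_sub_refl_sq (t := t) he y x
  rw [norm_sub_rev (refl e t x) y, h2, ell_refl he, norm_sub_rev y x] at h1
  exact (pow_left_inj₀ (norm_nonneg _) (norm_nonneg _) two_ne_zero).1 (by linarith)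

/-- The linear part of the reflection. -/
def reflLin (he : ‖e‖ = 1) : Rn N ≃ₗᵢ[ℝ] Rn N :=
  LinearIsometry.toLinearIsometryEquiv
    { toFun := refl e 0
      map_add' := fun x y => by simp only [refl, ell, inner_add_left]; module
      map_smul' := fun c x => by
        simp only [refl, ell, inner_smul_left, RingHom.id_apply]; simp; module
      norm_map' := fun x => by
        have := norm_refl_sub_refl (t := 0) he x 0
        simpa [refl, ell] using this } rfl

theorem refl_eq (he : ‖e‖ = 1) (t : ℝ) (x : Rn N) : refl e t x = reflLin he x + (2 * t) • e := by
  have : reflLin he x = refl e 0 x := rfl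
  rw [this, refl, refl, ell, ell]
  module

theorem measurePreserving_refl (he : ‖e‖ = 1) (t : ℝ) :
    MeasurePreserving (refl e t) (volume : Measure (Rn N)) volume := by
  have h := (measurePreserving_add_right (volume : Measure (Rn N)) ((2 * t) • e)).comp
    (reflLin he).measurePreserving
  have h2 : refl e t = (fun x => x + (2 * t) • e) ∘ reflLin he := funext (refl_eq he t)
  rwa [h2]

theorem continuous_refl : Continuous (refl e t) := by
  unfold refl
  have := continuous_ell (e := e) (t := t)
  fun_prop

theorem measurableEmbedding_refl (he : ‖e‖ = 1) (t : ℝ) : MeasurableEmbedding (refl e t) :=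
  (Homeomorph.mk ⟨refl e t, refl e t, refl_refl he, refl_refl he⟩ continuous_refl
    continuous_refl).measurableEmbedding

/-- The reflection preserves Lebesgue measure, so the integral is half the integral of the sum over
the pairs {x, σx}. -/
theorem integral_eq_of_add_eq (he : ‖e‖ = 1) (t : ℝ) {h k : Rn N → ℝ} (hh : Integrable h volume)
    (hk : Integrable k volume) (heq : ∀ x, h x + h (refl e t x) = k x + k (refl e t x)) :
    ∫ x, h x = ∫ x, k x := by
  have hm := measurePreserving_refl he t
  have hme := measurableEmbedding_refl he t
  have h1 : ∀ f : Rn N → ℝ, Integrable f volume →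
      ∫ x, (f x + f (refl e t x)) = 2 * ∫ x, f x := by
    intro f hf
    have hfr : Integrable (fun x => f (refl e t x)) volume := (hm.integrable_comp_emb hme).2 hf
    rw [integral_add hf hfr, hm.integral_comp hme]
    ring
  have h2 := h1 h hh
  rw [integral_congr_ae (Eventually.of_forall heq), h1 k hk] at h2
  linarith

theorem lintegral_eq_of_add_eq (he : ‖e‖ = 1) (t : ℝ) {h k : Rn N → ℝ≥0∞} (hh : Measurable h)
    (hk : Measurable k) (heq : ∀ᵐ x, h x + h (refl e t x) = k x + k (refl e t x)) :
    ∫⁻ x, h x = ∫⁻ x, k x := by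
  have hm := measurePreserving_refl he t
  have h1 : ∀ f : Rn N → ℝ≥0∞, Measurable f →
      ∫⁻ x, (f x + f (refl e t x)) = 2 * ∫⁻ x, f x := by
    intro f hf
    rw [lintegral_add_left hf, hm.lintegral_comp hf]
    ring
  have h2 := h1 h hh
  rw [lintegral_congr_ae heq, h1 k hk] at h2
  exact ((ENNReal.mul_right_inj (by norm_num) (by norm_num)).1 h2).symm

theorem pol_of_nonpos {v : Rn N → ℝ} {x : Rn N} (h : ell e t x ≤ 0) :
    pol e t v x = max (v x) (v (refl e t x)) := if_pos h

theorem pol_of_pos {v : Rn N → ℝ} {x : Rn N} (h : 0 < ell e t x) :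
    pol e t v x = min (v x) (v (refl e t x)) := if_neg (not_le.2 h)

/-- On each pair {x, σx} polarization either keeps the two values or exchanges them; every conserved
quantity comes from this. -/
theorem pol_pair (he : ‖e‖ = 1) (v : Rn N → ℝ) (x : Rn N) :
    (pol e t v x = v x ∧ pol e t v (refl e t x) = v (refl e t x)) ∨
      (pol e t v x = v (refl e t x) ∧ pol e t v (refl e t x) = v x) := by
  rcases lt_trichotomy (ell e t x) 0 with h | h | h
  · rw [pol_of_nonpos h.le, pol_of_pos (by rw [ell_refl he]; linarith), refl_refl he]
    rcases le_total (v x) (v (refl e t x)) with h1 | h1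
    · right; simp [h1]
    · left; simp [h1]
  · left
    rw [refl_of_ell_eq_zero h, pol_of_nonpos h.le, refl_of_ell_eq_zero h]
    simp
  · rw [pol_of_pos h, pol_of_nonpos (by rw [ell_refl he]; linarith), refl_refl he]
    rcases le_total (v x) (v (refl e t x)) with h1 | h1
    · left; simp [h1]
    · right; simp [h1]

theorem comp_pol_add (he : ‖e‖ = 1) (v : Rn N → ℝ) (g : ℝ → ℝ) (x : Rn N) :
    g (pol e t v x) + g (pol e t v (refl e t x)) = g (v x) + g (v (refl e t x)) := by
  rcases pol_pair (t := t) he v x with ⟨h1, h2⟩ | ⟨h1, h2⟩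
  · rw [h1, h2]
  · rw [h1, h2, add_comm]

theorem pol_nonneg {v : Rn N → ℝ} (hv : ∀ x, 0 ≤ v x) (x : Rn N) : 0 ≤ pol e t v x := by
  unfold pol
  split_ifs
  · exact le_max_of_le_left (hv _)
  · exact le_min (hv _) (hv _)

theorem pol_eq_zero (he : ‖e‖ = 1) (ht : 0 < t) {v : Rn N → ℝ} (hv : ∀ x, 0 ≤ v x) {R : ℝ}
    (hvR : ∀ x, R ≤ ‖x‖ → v x = 0) {x : Rn N} (hx : R ≤ ‖x‖) : pol e t v x = 0 := by
  rcases le_or_gt (ell e t x) 0 with h | h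
  · have h1 : R ≤ ‖refl e t x‖ := by
      have h2 := norm_refl_sq (t := t) he x
      refine hx.trans ((pow_le_pow_iff_left₀ (norm_nonneg _) (norm_nonneg _) two_ne_zero).1 ?_)
      nlinarith
    rw [pol_of_nonpos h, hvR x hx, hvR _ h1, max_self]
  · rw [pol_of_pos h, hvR x hx]
    exact min_eq_left (hv _)

/-- On one side of the hyperplane this is stability of Lipschitz bounds under max and min. Across
it, ‖x − σy‖ ≤ ‖x − y‖, so each value in the pair of x is within L‖x − y‖ of each value in the pair
of y. -/
theorem lipschitzWith_pol (he : ‖e‖ = 1) {v : Rn N → ℝ} {L : ℝ≥0} (hv : LipschitzWith L v) :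
    LipschitzWith L (pol e t v) := by
  have hd : ∀ x y, |v x - v y| ≤ L * ‖x - y‖ := fun x y => by
    simpa [Real.dist_eq, dist_eq_norm] using hv.dist_le_mul x y
  have hmaxmin : ∀ a a' b b' K : ℝ, |a - b| ≤ K → |a' - b'| ≤ K →
      |max a a' - max b b'| ≤ K ∧ |min a a' - min b b'| ≤ K := fun a a' b b' K h1 h2 =>
    ⟨(abs_max_sub_max_le_max _ _ _ _).trans (max_le h1 h2),
      (abs_min_sub_min_le_max _ _ _ _).trans (max_le h1 h2)⟩
  have hcross : ∀ x y, ell e t x ≤ 0 → 0 < ell e t y →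
      |pol e t v x - pol e t v y| ≤ L * ‖x - y‖ := by
    intro x y hx hy
    have h1 : ‖x - refl e t y‖ ≤ ‖x - y‖ := by
      refine (pow_le_pow_iff_left₀ (norm_nonneg _) (norm_nonneg _) two_ne_zero).1 ?_
      rw [norm_sub_refl_sq he]
      nlinarith
    have h2 : ‖refl e t x - y‖ ≤ ‖x - y‖ := by
      rw [← norm_refl_sub_refl (t := t) he, refl_refl he]
      exact h1
    have hL : (0 : ℝ) ≤ L := L.2
    have a1 := abs_le.1 (hd x y)
    have a2 := abs_le.1 ((hd x (refl e t y)).trans (mul_le_mul_of_nonneg_left h1 hL))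
    have a3 := abs_le.1 ((hd (refl e t x) y).trans (mul_le_mul_of_nonneg_left h2 hL))
    have a4 := abs_le.1 ((hd (refl e t x) (refl e t y)).trans
      (le_of_eq (by rw [norm_refl_sub_refl he])))
    rw [pol_of_nonpos hx, pol_of_pos hy, abs_le]
    rcases max_choice (v x) (v (refl e t x)) with hm | hm <;>
    rcases min_choice (v y) (v (refl e t y)) with hn | hn <;>
    rw [hm, hn] <;> constructor <;> linarith
  refine LipschitzWith.of_dist_le_mul fun x y => ?_
  rw [Real.dist_eq, dist_eq_norm]
  rcases le_or_gt (ell e t x) 0 with hx | hx <;> rcases le_or_gt (ell e t y) 0 with hy | hy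
  · rw [pol_of_nonpos hx, pol_of_nonpos hy]
    refine (hmaxmin _ _ _ _ _ (hd x y) ?_).1
    rw [← norm_refl_sub_refl (t := t) he x y]
    exact hd _ _
  · exact hcross x y hx hy
  · rw [abs_sub_comm, norm_sub_rev]
    exact hcross y x hy hx
  · rw [pol_of_pos hx, pol_of_pos hy]
    refine (hmaxmin _ _ _ _ _ (hd x y) ?_).2
    rw [← norm_refl_sub_refl (t := t) he x y]
    exact hd _ _

theorem ae_ell_ne_zero (he : ‖e‖ = 1) (t : ℝ) : ∀ᵐ x : Rn N, ell e t x ≠ 0 := by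
  set K : Submodule ℝ (Rn N) := LinearMap.ker (innerSL ℝ e).toLinearMap with hK
  have hne : K ≠ ⊤ := by
    intro h
    have : e ∈ K := h ▸ Submodule.mem_top
    rw [hK, LinearMap.mem_ker] at this
    simp [he] at this
  have h0 := Measure.addHaar_submodule (volume : Measure (Rn N)) K hne
  have h1 : (fun x : Rn N => x + (-(t • e))) ⁻¹' K = {x | ell e t x = 0} := by
    ext x
    simp only [mem_preimage, SetLike.mem_coe, hK, LinearMap.mem_ker, Set.mem_ofPred_eq, ell]
    simp [inner_add_right, inner_smul_right, he, real_inner_comm,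
      sub_eq_add_neg]
  rw [ae_iff]
  simp only [ne_eq, not_not]
  rw [← h1, measure_preimage_add_right, h0]

/-- The difference g − f has a local minimum at x. This replaces any separate treatment of the
contact set {v = v ∘ σ} when a maximum or minimum is differentiated. -/
theorem fderiv_eq_of_le_of_eq {f g : Rn N → ℝ} {x : Rn N} (hf : DifferentiableAt ℝ f x)
    (hg : DifferentiableAt ℝ g x) (hle : ∀ᶠ y in 𝓝 x, f y ≤ g y) (heq : f x = g x) :
    fderiv ℝ f x = fderiv ℝ g x := by
  have hmin : IsLocalMin (fun y => g y - f y) x := by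
    filter_upwards [hle] with y hy
    linarith
  have := hmin.fderiv_eq_zero
  rw [fderiv_fun_sub hg hf, sub_eq_zero] at this
  exact this.symm

theorem norm_fderiv_comp_refl (he : ‖e‖ = 1) {v : Rn N → ℝ} {x : Rn N}
    (hv : DifferentiableAt ℝ v (refl e t x)) :
    ‖fderiv ℝ (fun y => v (refl e t y)) x‖ = ‖fderiv ℝ v (refl e t x)‖ := by
  have h1 : HasFDerivAt (refl e t) ((reflLin he).toContinuousLinearEquiv : Rn N →L[ℝ] Rn N) x := by
    have h2 : refl e t = fun y => (reflLin he).toContinuousLinearEquiv y + (2 * t) • e :=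
      funext (refl_eq he t)
    rw [h2]
    exact ((reflLin he).toContinuousLinearEquiv.hasFDerivAt).add_const _
  have h3 : fderiv ℝ (fun y => v (refl e t y)) x =
      (fderiv ℝ v (refl e t x)).comp ((reflLin he).toContinuousLinearEquiv : Rn N →L[ℝ] Rn N) :=
    (hv.hasFDerivAt.comp x h1).fderiv
  rw [h3]
  exact ContinuousLinearMap.opNorm_comp_linearIsometryEquiv _ _

/-- Near x the polarization dominates both v and v ∘ σ and touches one of them at x, hence shares
its derivative; near σx it lies below both and touches the complementary one. Since σ is an
isometry, the gradient norms are kept or exchanged, as the values are. -/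
theorem norm_fderiv_pol_pair (he : ‖e‖ = 1) {v : Rn N → ℝ} {x : Rn N} (hx : ell e t x < 0)
    (h1 : DifferentiableAt ℝ v x) (h2 : DifferentiableAt ℝ v (refl e t x))
    (h3 : DifferentiableAt ℝ (pol e t v) x) (h4 : DifferentiableAt ℝ (pol e t v) (refl e t x)) :
    (‖fderiv ℝ (pol e t v) x‖ = ‖fderiv ℝ v x‖ ∧
      ‖fderiv ℝ (pol e t v) (refl e t x)‖ = ‖fderiv ℝ v (refl e t x)‖) ∨
    (‖fderiv ℝ (pol e t v) x‖ = ‖fderiv ℝ v (refl e t x)‖ ∧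
      ‖fderiv ℝ (pol e t v) (refl e t x)‖ = ‖fderiv ℝ v x‖) := by
  have hx' : 0 < ell e t (refl e t x) := by rw [ell_refl he]; linarith
  have hdr : ∀ z, Differentiable ℝ (refl e t) ∧ (DifferentiableAt ℝ v (refl e t z) →
      DifferentiableAt ℝ (fun y => v (refl e t y)) z) := fun z => by
    have hd : Differentiable ℝ (refl e t) := by
      have h2 : refl e t = fun y => (reflLin he).toContinuousLinearEquiv y + (2 * t) • e :=
        funext (refl_eq he t)
      rw [h2]
      exact ((reflLin he).toContinuousLinearEquiv.differentiable).add_const _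
    exact ⟨hd, fun h => h.comp z (hd z)⟩
  have hn : ∀ᶠ y in 𝓝 x, ell e t y ≤ 0 := by
    filter_upwards [continuous_ell.continuousAt.eventually (Iio_mem_nhds hx)] with y hy
    exact le_of_lt hy
  have hp : ∀ᶠ y in 𝓝 (refl e t x), 0 < ell e t y :=
    continuous_ell.continuousAt.eventually (Ioi_mem_nhds hx')
  have h1' : DifferentiableAt ℝ v (refl e t (refl e t x)) := by rwa [refl_refl he]
  rcases le_total (v (refl e t x)) (v x) with h | h
  · left
    constructor
    · rw [← fderiv_eq_of_le_of_eq h1 h3 ?_ ?_]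
      · filter_upwards [hn] with y hy
        rw [pol_of_nonpos hy]; exact le_max_left _ _
      · rw [pol_of_nonpos hx.le, max_eq_left h]
    · rw [fderiv_eq_of_le_of_eq h4 h2 ?_ ?_]
      · filter_upwards [hp] with y hy
        rw [pol_of_pos hy]; exact min_le_left _ _
      · rw [pol_of_pos hx', refl_refl he, min_eq_left h]
  · right
    constructor
    · rw [← norm_fderiv_comp_refl he h2,
        ← fderiv_eq_of_le_of_eq ((hdr x).2 h2) h3 ?_ ?_]
      · filter_upwards [hn] with y hy
        rw [pol_of_nonpos hy]; exact le_max_right _ _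
      · rw [pol_of_nonpos hx.le, max_eq_right h]
    · rw [fderiv_eq_of_le_of_eq h4 ((hdr (refl e t x)).2 h1') ?_ ?_]
      · rw [norm_fderiv_comp_refl he h1', refl_refl he]
      · filter_upwards [hp] with y hy
        rw [pol_of_pos hy]; exact min_le_right _ _
      · rw [pol_of_pos hx', min_eq_right]
        rwa [refl_refl he]

/-- Polarization preserves the Dirichlet energy. -/
theorem lintegral_fderiv_pol (he : ‖e‖ = 1) (t : ℝ) {v : Rn N → ℝ} {L : ℝ≥0}
    (hv : LipschitzWith L v) :
    ∫⁻ x, ‖fderiv ℝ (pol e t v) x‖ₑ ^ (2 : ℝ) = ∫⁻ x, ‖fderiv ℝ v x‖ₑ ^ (2 : ℝ) := by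
  refine lintegral_eq_of_add_eq he t ((measurable_fderiv ℝ _).enorm.pow_const _)
    ((measurable_fderiv ℝ _).enorm.pow_const _) ?_
  have hm := (measurePreserving_refl he t).quasiMeasurePreserving
  have d1 := hv.ae_differentiableAt (μ := (volume : Measure (Rn N)))
  have d3 := (lipschitzWith_pol (t := t) he hv).ae_differentiableAt
    (μ := (volume : Measure (Rn N)))
  -- By Rademacher's theorem v and its polarization are differentiable at almost every x, and also
  -- at σx because σ preserves null sets.
  filter_upwards [ae_ell_ne_zero he t, d1, hm.ae d1, d3, hm.ae d3] with x h0 h1 h2 h3 h4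
  simp only [← ofReal_norm]
  rcases lt_or_gt_of_ne h0 with h | h
  · rcases norm_fderiv_pol_pair he h h1 h2 h3 h4 with ⟨k1, k2⟩ | ⟨k1, k2⟩
    · rw [k1, k2]
    · rw [k1, k2, add_comm]
  · rcases norm_fderiv_pol_pair he (x := refl e t x) (by rw [ell_refl he]; linarith) h2
      (by rwa [refl_refl he]) h4 (by rwa [refl_refl he]) with ⟨k1, k2⟩ | ⟨k1, k2⟩
    · rw [refl_refl he] at k2
      rw [k1, k2]
    · rw [refl_refl he] at k1 k2
      rw [k1, k2, add_comm]

/-- If polarization does not decrease the second moment, then `v` is already polarized. -/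
theorem le_of_integral_le (he : ‖e‖ = 1) (ht : 0 < t) {v : Rn N → ℝ} {L : ℝ≥0}
    (hv : LipschitzWith L v) (hi : Integrable (fun x => v x * ‖x‖ ^ 2) volume)
    (hi' : Integrable (fun x => pol e t v x * ‖x‖ ^ 2) volume)
    (hle : ∫ x, v x * ‖x‖ ^ 2 ≤ ∫ x, pol e t v x * ‖x‖ ^ 2) {x : Rn N} (hx : ell e t x < 0) :
    v (refl e t x) ≤ v x := by
  have hm := measurePreserving_refl he t
  have hme := measurableEmbedding_refl he t
  set k : Rn N → ℝ := fun x => v x * ‖x‖ ^ 2 - pol e t v x * ‖x‖ ^ 2 with hk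
  have hki : Integrable k volume := hi.sub hi'
  set d : Rn N → ℝ := fun x => k x + k (refl e t x) with hd
  have hdi : Integrable d volume := hki.add ((hm.integrable_comp_emb hme).2 hki)
  -- Both factors are nonpositive on the near side and nonnegative on the far side, so d ≥ 0,
  -- whereas ∫ d = 2 ∫ k ≤ 0 by hypothesis. As d is continuous, it vanishes everywhere and not
  -- merely almost everywhere.
  have hd' : ∀ x, d x = (v x - pol e t v x) * (4 * t * ell e t x) := by
    intro x
    have h1 := comp_pol_add (t := t) he v id x
    simp only [id] at h1
    have h2 := norm_refl_sq (t := t) he x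
    simp only [hd, hk, h2]
    linear_combination (-(‖x‖ ^ 2 - 4 * t * ell e t x)) * h1
  have hd0 : ∀ x, 0 ≤ d x := by
    intro x
    rw [hd']
    rcases le_or_gt (ell e t x) 0 with h | h
    · refine mul_nonneg_of_nonpos_of_nonpos ?_ (by nlinarith)
      rw [pol_of_nonpos h, sub_nonpos]; exact le_max_left _ _
    · refine mul_nonneg ?_ (by positivity)
      rw [pol_of_pos h, sub_nonneg]; exact min_le_left _ _
  have hdint : ∫ x, d x = 0 := by
    refine le_antisymm ?_ (integral_nonneg hd0)
    have : ∫ x, d x = (∫ x, k x) + ∫ x, k (refl e t x) :=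
      integral_add hki ((hm.integrable_comp_emb hme).2 hki)
    rw [this, hm.integral_comp hme, hk, integral_sub hi hi']
    linarith
  have hdc : Continuous d := by
    have h1 := hv.continuous
    have h2 := (lipschitzWith_pol (t := t) he hv).continuous
    have h3 := continuous_ell (e := e) (t := t)
    have : d = fun x => (v x - pol e t v x) * (4 * t * ell e t x) := funext hd'
    rw [this]
    fun_prop
  have hdz : d = 0 := by
    have := (integral_eq_zero_iff_of_nonneg hd0 hdi).1 hdint
    exact (hdc.ae_eq_iff_eq volume continuous_zero).1 this
  have h1 := congrFun hdz x
  rw [hd', Pi.zero_apply, mul_eq_zero] at h1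
  have h2 : pol e t v x = v x := by
    rcases h1 with h1 | h1
    · linarith
    · nlinarith
  rw [← h2, pol_of_nonpos hx.le]
  exact le_max_right _ _

end Polarization

end NormalizedNLS

end

noncomputable section
namespace NormalizedNLS
open Filter Topology
open scoped RealInnerProductSpace

/-! ### Radial competitors -/

/-! ### Lipschitz functions supported in a ball as elements of H¹ -/

section Lipschitz

variable {N : ℕ} {v : Rn N → ℝ} {L : ℝ≥0} {R : ℝ}

/-- Moving by 2R along an axis from a point of the ball of radius R leaves the open ball, where v is
zero. -/
theorem abs_le_of_lipschitz (hN : 0 < N) (hv : LipschitzWith L v)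
    (hvR : ∀ x, R ≤ ‖x‖ → v x = 0) (hR : 0 ≤ R) (x : Rn N) : |v x| ≤ L * (2 * R) := by
  rcases le_or_gt R ‖x‖ with h | h
  · rw [hvR x h, abs_zero]; positivity
  · set y := x + (2 * R) • unitVec (⟨0, hN⟩ : Fin N) with hy
    have h1 : ‖(2 * R) • unitVec (⟨0, hN⟩ : Fin N)‖ = 2 * R := by
      rw [norm_smul]; simp [abs_of_nonneg hR]
    have h2 : R ≤ ‖y‖ := by
      have := norm_sub_norm_le ((2 * R) • unitVec (⟨0, hN⟩ : Fin N)) (-x)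
      rw [sub_neg_eq_add, add_comm _ x, norm_neg, h1] at this
      linarith
    have h3 := hv.dist_le_mul x y
    rw [hvR y h2, Real.dist_eq, sub_zero, hy, dist_self_add_right, h1] at h3
    exact h3

theorem fderiv_eq_zero_of_norm_gt (hvR : ∀ x, R ≤ ‖x‖ → v x = 0) {x : Rn N} (hx : R < ‖x‖) :
    fderiv ℝ v x = 0 := by
  have : v =ᶠ[𝓝 x] fun _ => 0 := by
    filter_upwards [(isOpen_lt continuous_const continuous_norm).mem_nhds hx] with y hy
    exact hvR y (le_of_lt hy)
  rw [this.fderiv_eq]; simp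

/-- For real values the derivative applied to the gradient itself gives the missing inequality. -/
theorem norm_smoothGrad_real (v : Rn N → ℝ) (x : Rn N) : ‖smoothGrad v x‖ = ‖fderiv ℝ v x‖ := by
  refine le_antisymm ?_ (norm_fderiv_le_norm_smoothGrad v x)
  have hv : smoothGrad v x = ∑ i, smoothGrad v x i • unitVec i := by
    ext j
    simp [Finset.sum_apply, Pi.single_apply]
  have h1 : fderiv ℝ v x (smoothGrad v x) = ‖smoothGrad v x‖ ^ 2 := by
    conv_lhs => rw [hv]
    rw [map_sum, EuclideanSpace.norm_sq_eq]
    refine Finset.sum_congr rfl fun i _ => ?_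
    rw [map_smul, smul_eq_mul, Real.norm_eq_abs, sq_abs, sq]
    rfl
  have h2 := (fderiv ℝ v x).le_opNorm (smoothGrad v x)
  rw [h1, Real.norm_eq_abs, abs_of_nonneg (by positivity)] at h2
  rcases eq_or_lt_of_le (norm_nonneg (smoothGrad v x)) with h | h
  · rw [← h]; positivity
  · rw [sq] at h2
    exact le_of_mul_le_mul_right h2 h

theorem aestronglyMeasurable_smoothGrad_real (v : Rn N → ℝ) :
    AEStronglyMeasurable (smoothGrad v) volume := by
  have h : Measurable (fun x => fun i => fderiv ℝ v x (unitVec i)) :=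
    measurable_pi_lambda _ fun i => measurable_fderiv_apply_const ℝ v _
  exact ((PiLp.continuous_toLp 2 (fun _ : Fin N => ℝ)).measurable.comp h).aestronglyMeasurable

theorem memLp_smoothGrad_of_lipschitz (hv : LipschitzWith L v)
    (hvR : ∀ x, R ≤ ‖x‖ → v x = 0) : MemLp (smoothGrad v) 2 volume := by
  have h1 : MemLp ((Metric.closedBall (0 : Rn N) R).indicator fun _ => (L : ℝ)) 2 volume :=
    memLp_indicator_const 2 measurableSet_closedBall _ (Or.inr measure_closedBall_lt_top.ne)
  refine h1.of_le (aestronglyMeasurable_smoothGrad_real v) (Eventually.of_forall fun x => ?_)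
  rw [norm_smoothGrad_real]
  by_cases hx : x ∈ Metric.closedBall (0 : Rn N) R
  · rw [indicator_of_mem hx]
    refine (norm_fderiv_le_of_lipschitz ℝ hv).trans ?_
    simp
  · rw [mem_closedBall_zero_iff, not_le] at hx
    rw [fderiv_eq_zero_of_norm_gt hvR hx]
    simp

theorem hasWeakGradient_of_lipschitz (hv : LipschitzWith L v) :
    HasWeakGradient v (smoothGrad v) := by
  intro φ hφ hc i
  obtain ⟨D, hD⟩ := hφ.lipschitzWith_of_hasCompactSupport hc (by simp)
  have h := hv.integral_lineDeriv_mul_eq (μ := (volume : Measure (Rn N))) hD hc (unitVec i)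
  have e1 : ∫ x, lineDeriv ℝ v x (unitVec i) * φ x = ∫ x, φ x • smoothGrad v x i := by
    refine integral_congr_ae ?_
    filter_upwards [hv.ae_differentiableAt (μ := (volume : Measure (Rn N)))] with x hx
    rw [hx.lineDeriv_eq_fderiv, smul_eq_mul, mul_comm]
    rfl
  have e2 : ∫ x, lineDeriv ℝ φ x (-unitVec i) * v x =
      -∫ x, fderiv ℝ φ x (unitVec i) • v x := by
    rw [← integral_neg]
    refine integral_congr_ae (Eventually.of_forall fun x => ?_)
    have := (hφ.differentiable (by simp) x).lineDeriv_eq_fderiv (v := -unitVec i)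
    simp only [this, map_neg, smul_eq_mul, neg_mul]
  rw [e1, e2] at h
  rw [h, neg_neg]

end Lipschitz

/-! ### Lower semicontinuity of the Dirichlet energy by duality -/

section LowerSemicontinuity

variable {N : ℕ}

theorem inner_toLp_eq {f : Rn N → ℝ} {g Φ : Rn N → EuclideanSpace ℝ (Fin N)}
    (h : HasWeakGradient f g) (hg : MemLp g 2 volume) (hΦ : ContDiff ℝ ∞ Φ)
    (hc : HasCompactSupport Φ) (hΦm : MemLp Φ 2 volume) :
    ⟪hg.toLp, hΦm.toLp⟫ = -∑ i, ∫ x, fderiv ℝ (fun y => Φ y i) x (unitVec i) • f x := by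
  have hΦi : ∀ i, ContDiff ℝ ∞ fun y => Φ y i := fun i =>
    (EuclideanSpace.proj (𝕜 := ℝ) i).contDiff.comp hΦ
  have hci : ∀ i, HasCompactSupport fun y => Φ y i := fun i =>
    hc.comp_left (g := fun z : EuclideanSpace ℝ (Fin N) => z i) rfl
  rw [L2.inner_def]
  have e1 : ∫ x, ⟪(hg.toLp : Rn N → EuclideanSpace ℝ (Fin N)) x,
      (hΦm.toLp : Rn N → EuclideanSpace ℝ (Fin N)) x⟫ = ∫ x, ∑ i, Φ x i • g x i := by
    refine integral_congr_ae ?_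
    filter_upwards [hg.coeFn_toLp, hΦm.coeFn_toLp] with x h1 h2
    rw [h1, h2, PiLp.inner_apply]
    simp
  rw [e1, integral_finsetSum, ← Finset.sum_neg_distrib]
  · refine Finset.sum_congr rfl fun i _ => ?_
    rw [h _ (hΦi i) (hci i) i, neg_neg]
  · intro i _
    have h1 := integrable_smul_coord_of_Lp hg.toLp (hΦi i).continuous (hci i) i
    refine h1.congr ?_
    filter_upwards [hg.coeFn_toLp] with x hx
    rw [hx]

/-- Lower semicontinuity of the Dirichlet energy. -/
theorem eLpNorm_grad_le_of_tendsto {f : ℕ → Rn N → ℝ} {g : ℕ → Rn N → EuclideanSpace ℝ (Fin N)}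
    {f₀ : Rn N → ℝ} {g₀ : Rn N → EuclideanSpace ℝ (Fin N)} (h : ∀ n, HasWeakGradient (f n) (g n))
    (hg : ∀ n, MemLp (g n) 2 volume) {B : ℝ≥0} (hB : ∀ n, eLpNorm (g n) 2 volume ≤ B)
    (h₀ : HasWeakGradient f₀ g₀) (hg₀ : MemLp g₀ 2 volume)
    (hlim : ∀ φ : Rn N → ℝ, ContDiff ℝ ∞ φ → HasCompactSupport φ → ∀ i,
      Tendsto (fun n => ∫ x, fderiv ℝ φ x (unitVec i) • f n x) atTop
        (𝓝 (∫ x, fderiv ℝ φ x (unitVec i) • f₀ x))) :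
    eLpNorm g₀ 2 volume ≤ B := by
  -- Pairing with a smooth vector field moves the derivatives onto the field, so the bound ⟨g n, Φ⟩
  -- ≤ B‖Φ‖ survives the limit. By density it holds for every L² field, in particular for g₀ itself.
  have hsub : {Ψ : Lp (EuclideanSpace ℝ (Fin N)) 2 (volume : Measure (Rn N)) |
      ∃ Φ : Rn N → EuclideanSpace ℝ (Fin N), Ψ =ᵐ[volume] Φ ∧ HasCompactSupport Φ ∧
        ContDiff ℝ ∞ Φ} ⊆ {Ψ | ⟪hg₀.toLp, Ψ⟫ ≤ B * ‖Ψ‖} := by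
    rintro Ψ ⟨Φ, hΨ, hc, hΦ⟩
    have hΦm : MemLp Φ 2 volume := hΦ.continuous.memLp_of_hasCompactSupport hc
    have hΦi : ∀ i, ContDiff ℝ ∞ fun y => Φ y i := fun i =>
      (EuclideanSpace.proj (𝕜 := ℝ) i).contDiff.comp hΦ
    have hci : ∀ i, HasCompactSupport fun y => Φ y i := fun i =>
      hc.comp_left (g := fun z : EuclideanSpace ℝ (Fin N) => z i) rfl
    have e : Ψ = hΦm.toLp := Lp.ext (hΨ.trans hΦm.coeFn_toLp.symm)
    have ht : Tendsto (fun n => ⟪(hg n).toLp, hΦm.toLp⟫) atTop (𝓝 ⟪hg₀.toLp, hΦm.toLp⟫) := by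
      simp only [inner_toLp_eq (h _) (hg _) hΦ hc hΦm, inner_toLp_eq h₀ hg₀ hΦ hc hΦm]
      exact (tendsto_finsetSum _ fun i _ => hlim _ (hΦi i) (hci i) i).neg
    rw [e]
    refine le_of_tendsto' ht fun n => (real_inner_le_norm _ _).trans ?_
    gcongr
    rw [Lp.norm_toLp]
    exact ENNReal.toReal_le_of_le_ofReal B.2 (by simpa using hB n)
  have hclosed : IsClosed {Ψ : Lp (EuclideanSpace ℝ (Fin N)) 2 (volume : Measure (Rn N)) |
      ⟪hg₀.toLp, Ψ⟫ ≤ B * ‖Ψ‖} :=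
    isClosed_le (continuous_const.inner continuous_id) (continuous_const.mul continuous_norm)
  have hdense := Lp.dense_hasCompactSupport_contDiff (E := Rn N)
    (F := EuclideanSpace ℝ (Fin N)) (μ := (volume : Measure (Rn N))) (p := 2) (by norm_num)
  have hmem : hg₀.toLp ∈ {Ψ : Lp (EuclideanSpace ℝ (Fin N)) 2 (volume : Measure (Rn N)) |
      ⟪hg₀.toLp, Ψ⟫ ≤ B * ‖Ψ‖} := closure_minimal hsub hclosed (hdense _)
  have h1 : ‖hg₀.toLp‖ ^ 2 ≤ B * ‖hg₀.toLp‖ := by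
    rw [← real_inner_self_eq_norm_sq]; exact hmem
  have h2 : ‖hg₀.toLp‖ ≤ B := by
    rcases eq_or_lt_of_le (norm_nonneg (hg₀.toLp)) with h | h
    · rw [← h]; exact B.2
    · rw [sq] at h1
      exact le_of_mul_le_mul_right h1 h
  rw [Lp.norm_toLp] at h2
  rw [← ENNReal.ofReal_coe_nnreal]
  exact ENNReal.le_ofReal_iff_toReal_le hg₀.2.ne B.2 |>.2 h2

end LowerSemicontinuity

/-! ### Compact classes of Lipschitz functions and minimization of the second moment -/

section Compactness

variable {N : ℕ}

/-- Nonnegative `L`-Lipschitz functions supported in the ball of radius `R`. -/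
def lipClass (N : ℕ) (L : ℝ≥0) (R : ℝ) : Set C(Rn N, ℝ) :=
  {v | LipschitzWith L v ∧ (∀ x, 0 ≤ v x) ∧ ∀ x, R ≤ ‖x‖ → v x = 0}

/-- Arzelà–Ascoli for the compact-open topology: the three defining conditions are closed under
pointwise convergence, the values are uniformly bounded, and the common Lipschitz constant gives
equicontinuity. -/
theorem isCompact_lipClass (hN : 0 < N) (L : ℝ≥0) {R : ℝ} (hR : 0 ≤ R) :
    IsCompact (lipClass N L R) := by
  refine ArzelaAscoli.isCompact_of_equicontinuous _ ?_ ?_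
  · have hK : IsCompact (Set.pi univ fun _ : Rn N => Icc (-(L * (2 * R))) (L * (2 * R))) :=
      isCompact_univ_pi fun _ => isCompact_Icc
    have himage : ContinuousMap.toFun '' lipClass N L R =
        {f : Rn N → ℝ | LipschitzWith L f} ∩ {f | (∀ x, 0 ≤ f x)} ∩
          {f | ∀ x, R ≤ ‖x‖ → f x = 0} := by
      ext f
      constructor
      · rintro ⟨v, ⟨h1, h2, h3⟩, rfl⟩
        exact ⟨⟨h1, h2⟩, h3⟩
      · rintro ⟨⟨h1, h2⟩, h3⟩
        exact ⟨⟨f, h1.continuous⟩, ⟨h1, h2, h3⟩, rfl⟩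
    rw [himage]
    refine hK.of_isClosed_subset ?_ ?_
    · refine (IsClosed.inter ?_ ?_).inter ?_
      · simp only [lipschitzWith_iff_dist_le_mul, ofPred_forall]
        exact isClosed_iInter fun x => isClosed_iInter fun y =>
          isClosed_le ((continuous_apply x).dist (continuous_apply y)) continuous_const
      · simp only [ofPred_forall]
        exact isClosed_iInter fun x => isClosed_le continuous_const (continuous_apply x)
      · simp only [ofPred_forall]
        exact isClosed_iInter fun x => isClosed_iInter fun _ =>
          isClosed_eq (continuous_apply x) continuous_const
    · rintro f ⟨⟨h1, -⟩, h3⟩ x -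
      exact abs_le.1 (abs_le_of_lipschitz hN h1 h3 hR x)
  · exact (LipschitzWith.uniformEquicontinuous _ L fun v => v.2.1).equicontinuous

/-- Dominated convergence with a constant on the ball of radius R. The weight w and the nonlinearity
h cover the L^p integrals, the second moment and the pairings with derivatives of test functions. -/
theorem tendsto_integral_of_lipClass (hN : 0 < N) {L : ℝ≥0} {R : ℝ} (hR : 0 ≤ R) {ι : Type*}
    {l : Filter ι} [l.IsCountablyGenerated] {f : ι → Rn N → ℝ} {f₀ : Rn N → ℝ}
    (hL : ∀ᶠ n in l, LipschitzWith L (f n)) (hz : ∀ᶠ n in l, ∀ x, R ≤ ‖x‖ → f n x = 0)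
    (hlim : ∀ x, Tendsto (fun n => f n x) l (𝓝 (f₀ x))) {h : ℝ → ℝ} (hh : Continuous h)
    (h0 : h 0 = 0) {w : Rn N → ℝ} (hw : Continuous w) :
    Tendsto (fun n => ∫ x, h (f n x) * w x) l (𝓝 (∫ x, h (f₀ x) * w x)) := by
  obtain ⟨A, hA⟩ := (isCompact_Icc (a := -(L * (2 * R))) (b := L * (2 * R))).exists_bound_of_continuousOn
    hh.continuousOn
  obtain ⟨B, hB⟩ := (isCompact_closedBall (0 : Rn N) R).exists_bound_of_continuousOn hw.continuousOn
  refine tendsto_integral_filter_of_dominated_convergence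
    ((Metric.closedBall (0 : Rn N) R).indicator fun _ => A * B) ?_ ?_ ?_ ?_
  · filter_upwards [hL] with n hn
    exact ((hh.comp hn.continuous).mul hw).aestronglyMeasurable
  · filter_upwards [hL, hz] with n hn hzn
    refine Eventually.of_forall fun x => ?_
    by_cases hx : x ∈ Metric.closedBall (0 : Rn N) R
    · rw [indicator_of_mem hx, norm_mul]
      have h1 := hA (f n x) (abs_le.1 (abs_le_of_lipschitz hN hn hzn hR x))
      exact mul_le_mul h1 (hB x hx) (norm_nonneg _) ((norm_nonneg _).trans h1)
    · rw [indicator_of_notMem hx]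
      rw [mem_closedBall_zero_iff, not_le] at hx
      rw [hzn x hx.le, h0]
      simp
  · exact (integrable_indicator_iff measurableSet_closedBall).2
      (integrableOn_const measure_closedBall_lt_top.ne)
  · exact Eventually.of_forall fun x => ((hh.tendsto _).comp (hlim x)).mul_const _

/-- The functions of `lipClass` with prescribed `L^p` norms and bounded energy. -/
def energyClass (N : ℕ) (L : ℝ≥0) (R : ℝ) (I : ℝ → ℝ) (B : ℝ≥0) : Set C(Rn N, ℝ) :=
  {v | v ∈ lipClass N L R ∧ (∀ p, 0 < p → ∫ x, v x ^ p = I p) ∧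
    eLpNorm (smoothGrad v) 2 volume ≤ B}

/-- The L^p integrals are continuous on the compact class, but the Dirichlet energy is only lower
semicontinuous; this is why the class bounds the energy instead of prescribing it. -/
theorem isCompact_energyClass (hN : 0 < N) (L : ℝ≥0) {R : ℝ} (hR : 0 ≤ R) (I : ℝ → ℝ) (B : ℝ≥0) :
    IsCompact (energyClass N L R I B) := by
  have hcompact := isCompact_lipClass hN L hR
  refine hcompact.of_isClosed_subset (IsSeqClosed.isClosed ?_) fun v hv => hv.1
  intro f f₀ hf hlim
  have hpt : ∀ x, Tendsto (fun n => f n x) atTop (𝓝 (f₀ x)) := fun x =>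
    ((continuous_eval_const x).tendsto f₀).comp hlim
  have hf₀ : f₀ ∈ lipClass N L R := hcompact.isClosed.mem_of_tendsto hlim
    (Eventually.of_forall fun n => (hf n).1)
  have hI : ∀ {h : ℝ → ℝ} (hh : Continuous h) (h0 : h 0 = 0) {w : Rn N → ℝ} (hw : Continuous w),
      Tendsto (fun n => ∫ x, h (f n x) * w x) atTop (𝓝 (∫ x, h (f₀ x) * w x)) := fun hh h0 _ hw =>
    tendsto_integral_of_lipClass hN hR (Eventually.of_forall fun n => (hf n).1.1)
      (Eventually.of_forall fun n => (hf n).1.2.2) hpt hh h0 hw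
  refine ⟨hf₀, fun p hp => ?_, ?_⟩
  · have h1 := hI (Real.continuous_rpow_const hp.le) (Real.zero_rpow hp.ne')
      (continuous_const (y := (1 : ℝ)))
    simp only [mul_one] at h1
    refine tendsto_nhds_unique h1 ?_
    simp only [fun n => (hf n).2.1 p hp]
    exact tendsto_const_nhds
  · refine eLpNorm_grad_le_of_tendsto (f := fun n => f n) (g := fun n => smoothGrad (f n))
      (fun n => hasWeakGradient_of_lipschitz (hf n).1.1)
      (fun n => memLp_smoothGrad_of_lipschitz (hf n).1.1 (hf n).1.2.2) (fun n => (hf n).2.2)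
      (hasWeakGradient_of_lipschitz hf₀.1) (memLp_smoothGrad_of_lipschitz hf₀.1 hf₀.2.2) ?_
    intro φ hφ hc i
    have h1 := hI continuous_id rfl (continuous_fderiv_dir hφ (unitVec i))
    simpa only [id, smul_eq_mul, mul_comm] using h1

theorem integrable_of_lipClass {v : C(Rn N, ℝ)} {L : ℝ≥0} {R : ℝ} (hv : v ∈ lipClass N L R)
    {h : ℝ → ℝ} (hh : Continuous h) (h0 : h 0 = 0) {w : Rn N → ℝ} (hw : Continuous w) :
    Integrable (fun x => h (v x) * w x) volume := by
  refine Continuous.integrable_of_hasCompactSupport ((hh.comp v.continuous).mul hw) ?_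
  refine HasCompactSupport.intro (isCompact_closedBall (0 : Rn N) R) fun x hx => ?_
  rw [mem_closedBall_zero_iff, not_le] at hx
  rw [hv.2.2 x hx.le, h0, zero_mul]

open Polarization in
-- The condition t > 0 keeps the support in the ball: the origin is on the side that receives the
-- larger values.
theorem pol_mem_energyClass {v : C(Rn N, ℝ)} {L : ℝ≥0} {R : ℝ} {I : ℝ → ℝ} {B : ℝ≥0}
    (hv : v ∈ energyClass N L R I B) {e : Rn N} (he : ‖e‖ = 1) {t : ℝ} (ht : 0 < t) :
    ∃ w ∈ energyClass N L R I B, ⇑w = pol e t v := by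
  obtain ⟨hv1, hv2, hv3⟩ := hv
  have hlip := lipschitzWith_pol (t := t) he hv1.1
  have hw : (⟨pol e t v, hlip.continuous⟩ : C(Rn N, ℝ)) ∈ lipClass N L R :=
    ⟨hlip, pol_nonneg hv1.2.1, fun x hx => pol_eq_zero he ht hv1.2.1 hv1.2.2 hx⟩
  refine ⟨⟨pol e t v, hlip.continuous⟩, ⟨hw, fun p hp => ?_, ?_⟩, rfl⟩
  · rw [← hv2 p hp]
    have hc := Real.continuous_rpow_const hp.le
    have hz := Real.zero_rpow hp.ne'
    have i1 := integrable_of_lipClass hw hc hz (continuous_const (y := (1 : ℝ)))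
    have i2 := integrable_of_lipClass hv1 hc hz (continuous_const (y := (1 : ℝ)))
    simp only [mul_one] at i1 i2
    exact integral_eq_of_add_eq he t i1 i2 fun x => comp_pol_add he v (fun s => s ^ p) x
  · refine le_trans (le_of_eq ?_) hv3
    refine (ENNReal.rpow_left_injective two_ne_zero) ?_
    simp only [eLpNorm_two_sq, ← ofReal_norm, norm_smoothGrad_real]
    simp only [ofReal_norm]
    exact lintegral_fderiv_pol he t hv1.1

open Polarization in
/-- A minimizer of the second moment is radial. -/
theorem exists_radial_mem_energyClass (hN : 0 < N) {L : ℝ≥0} {R : ℝ} (hR : 0 ≤ R) {I : ℝ → ℝ}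
    {B : ℝ≥0} (hne : (energyClass N L R I B).Nonempty) :
    ∃ v ∈ energyClass N L R I B, ∀ x y, ‖x‖ = ‖y‖ → v x = v y := by
  have hsq : Continuous fun x : Rn N => ‖x‖ ^ 2 := by fun_prop
  have hcont : ContinuousOn (fun v : C(Rn N, ℝ) => ∫ x, v x * ‖x‖ ^ 2) (energyClass N L R I B) := by
    intro v hv
    refine tendsto_integral_of_lipClass hN hR (h := id) ?_ ?_ ?_ continuous_id rfl hsq (L := L)
    · filter_upwards [self_mem_nhdsWithin] with w hw using hw.1.1
    · filter_upwards [self_mem_nhdsWithin] with w hw using hw.1.2.2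
    · exact fun x => ((continuous_eval_const x).tendsto v).mono_left nhdsWithin_le_nhds
  obtain ⟨v, hv, hmin⟩ := (isCompact_energyClass hN L hR I B).exists_isMinOn hne hcont
  have hlt : ∀ a b : Rn N, ‖a‖ < ‖b‖ → v b ≤ v a := by
    intro a b hab
    have hne : b - a ≠ 0 := by
      intro h
      rw [sub_eq_zero] at h
      rw [h] at hab
      exact lt_irrefl _ hab
    set d := ‖b - a‖ with hd
    have hd0 : 0 < d := norm_pos_iff.2 hne
    -- The hyperplane is the perpendicular bisector of a and b. Its offset t is positive since ‖a‖ <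
    -- ‖b‖, so a lies on the side of the origin and b is its mirror image.
    set e : Rn N := d⁻¹ • (b - a) with he
    have he1 : ‖e‖ = 1 := by
      rw [he, norm_smul, norm_inv, norm_norm, ← hd, inv_mul_cancel₀ hd0.ne']
    set t : ℝ := (‖b‖ ^ 2 - ‖a‖ ^ 2) / (2 * d) with ht
    have ht0 : 0 < t := by
      refine div_pos ?_ (by positivity)
      nlinarith [norm_nonneg a]
    have hell : ell e t a = -(d / 2) := by
      have h1 : d ^ 2 = ‖b‖ ^ 2 - 2 * ⟪b, a⟫ + ‖a‖ ^ 2 := norm_sub_sq_real b a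
      rw [ell, he, ht, inner_smul_right, inner_sub_right, real_inner_self_eq_norm_sq,
        real_inner_comm b a]
      field_simp
      linarith
    have hrefl : refl e t a = b := by
      have h2 : 2 * -(d / 2) * d⁻¹ = -1 := by field_simp
      show a - (2 * ell e t a) • e = b
      rw [hell, he, smul_smul, h2]
      module
    obtain ⟨w, hw, hwv⟩ := pol_mem_energyClass hv he1 ht0
    -- The polarized function is a competitor in the same class, so it cannot lower the second
    -- moment, and v must already be polarized.
    have hle : ∫ x, v x * ‖x‖ ^ 2 ≤ ∫ x, w x * ‖x‖ ^ 2 := hmin hw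
    have i1 := integrable_of_lipClass hv.1 continuous_id rfl hsq
    have i2 := integrable_of_lipClass hw.1 continuous_id rfl hsq
    simp only [id, hwv] at i1 i2 hle
    have := le_of_integral_le he1 ht0 hv.1.1 i1 i2 hle (x := a) (by rw [hell]; linarith)
    rwa [hrefl] at this
  have hle : ∀ a b : Rn N, ‖a‖ = ‖b‖ → v b ≤ v a := by
    intro a b hab
    rcases eq_or_ne b 0 with rfl | hb
    · rw [norm_zero, norm_eq_zero] at hab
      rw [hab]
    -- Points of equal norm are reached by pushing b slightly outwards, where the strict case
    -- applies, and using continuity.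
    · have h1 : Tendsto (fun s : ℝ => v (s • b)) (𝓝[>] 1) (𝓝 (v b)) := by
        have : ContinuousAt (fun s : ℝ => v (s • b)) 1 :=
          (v.continuous.comp (continuous_id.smul continuous_const)).continuousAt
        have h2 := this.tendsto
        rw [one_smul] at h2
        exact h2.mono_left nhdsWithin_le_nhds
      refine le_of_tendsto h1 ?_
      filter_upwards [self_mem_nhdsWithin] with s hs
      have hs' : 1 < s := hs
      refine hlt a _ ?_
      rw [norm_smul, Real.norm_eq_abs, abs_of_pos (by linarith), hab]
      have : 0 < ‖b‖ := norm_pos_iff.2 hb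
      nlinarith
  exact ⟨v, hv, fun x y h => le_antisymm (hle y x h.symm) (hle x y h)⟩

end Compactness

/-! ### Radial competitors for smooth functions and for elements of H¹ -/

section Competitor

variable {𝕜 : Type*} [RCLike 𝕜] {N : ℕ}

/-- The modulus of a function does not increase the gradient. -/
theorem norm_fderiv_norm_le {f : Rn N → 𝕜} {x : Rn N} (hf : DifferentiableAt ℝ f x) :
    ‖fderiv ℝ (fun y => ‖f y‖) x‖ ≤ ‖fderiv ℝ f x‖ := by
  by_cases hd : DifferentiableAt ℝ (fun y => ‖f y‖) x
  · refine ContinuousLinearMap.opNorm_le_bound _ (norm_nonneg _) fun v => ?_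
    refine le_trans ?_ ((fderiv ℝ f x).le_opNorm v)
    have h1 := (hd.hasFDerivAt.hasLineDerivAt v).tendsto_slope_zero.norm
    have h2 := (hf.hasFDerivAt.hasLineDerivAt v).tendsto_slope_zero.norm
    refine le_of_tendsto_of_tendsto' h1 h2 fun s => ?_
    rw [norm_smul, norm_smul]
    gcongr
    exact abs_norm_sub_norm_le _ _
  · rw [fderiv_zero_of_not_differentiableAt hd]
    simp

theorem H1.lpNorm_rpow {f : Rn N → 𝕜} (hf : AEStronglyMeasurable f volume) {p : ℝ} (hp : 0 < p) :
    lpNorm f (ENNReal.ofReal p) volume = (∫ x, ‖f x‖ ^ p) ^ p⁻¹ := by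
  rw [lpNorm_eq_integral_norm_rpow_toReal (by simpa using hp) ENNReal.ofReal_ne_top hf,
    ENNReal.toReal_ofReal hp.le]

/-- Every smooth compactly supported function has a radial competitor. -/
theorem exists_radial_of_smooth (hN : 0 < N) {φ : Rn N → 𝕜} (hφ : ContDiff ℝ ∞ φ)
    (hc : HasCompactSupport φ) : ∃ v : H1 𝕜 N, v.IsRadial ∧
      (∀ p, 0 < p → v.normLp p = lpNorm φ (ENNReal.ofReal p) volume) ∧
      v.normGrad ≤ lpNorm (smoothGrad φ) 2 volume := by
  obtain ⟨L, hL⟩ := hφ.lipschitzWith_of_hasCompactSupport hc (by simp)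
  have hu : LipschitzWith L fun x => ‖φ x‖ :=
    LipschitzWith.of_dist_le_mul fun x y => by
      rw [Real.dist_eq]
      exact (abs_norm_sub_norm_le _ _).trans
        (by simpa only [dist_eq_norm] using hL.dist_le_mul x y)
  obtain ⟨R, hR0, hR⟩ : ∃ R : ℝ, 0 ≤ R ∧ ∀ x, R ≤ ‖x‖ → φ x = 0 := by
    obtain ⟨R, hR⟩ := hc.isCompact.isBounded.subset_ball 0
    refine ⟨max R 0, le_max_right _ _, fun x hx => image_eq_zero_of_notMem_tsupport fun h => ?_⟩
    have := mem_ball_zero_iff.1 (hR h)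
    have := le_max_left R 0
    linarith
  have hm : MemLp (smoothGrad φ) 2 volume :=
    (continuous_smoothGrad (hφ.of_le (by simp))).memLp_of_hasCompactSupport
      (hasCompactSupport_smoothGrad hc)
  set B : ℝ≥0 := (eLpNorm (smoothGrad φ) 2 volume).toNNReal with hB
  have hBe : (B : ℝ≥0∞) = eLpNorm (smoothGrad φ) 2 volume := ENNReal.coe_toNNReal hm.2.ne
  -- The modulus |φ| is itself a member: it has the same L^p norms and no larger gradient.
  have hne : (energyClass N L R (fun p => ∫ x, ‖φ x‖ ^ p) B).Nonempty := by
    refine ⟨⟨fun x => ‖φ x‖, hu.continuous⟩, ⟨hu, fun x => norm_nonneg (φ x), fun x hx => ?_⟩,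
      fun p _ => rfl, ?_⟩
    · simp [hR x hx]
    · rw [hBe]
      refine eLpNorm_mono fun x => ?_
      refine (le_of_eq (norm_smoothGrad_real _ x)).trans ?_
      exact (norm_fderiv_norm_le (hφ.differentiable (by simp) x)).trans
        (norm_fderiv_le_norm_smoothGrad φ x)
  obtain ⟨v, ⟨⟨hv1, hv2, hv3⟩, hvI, hvB⟩, hrad⟩ := exists_radial_mem_energyClass hN hR0 hne
  have hvc : HasCompactSupport v :=
    HasCompactSupport.intro (isCompact_closedBall (0 : Rn N) R) fun x hx => hv3 x (by
      rw [mem_closedBall_zero_iff, not_le] at hx; exact hx.le)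
  set V : Rn N → 𝕜 := fun x => (v x : 𝕜) with hV
  set G : Rn N → EuclideanSpace 𝕜 (Fin N) := fun x =>
    WithLp.toLp 2 fun i => ((smoothGrad v x i : ℝ) : 𝕜) with hG
  have hVc : Continuous V := RCLike.continuous_ofReal.comp v.continuous
  have hVm : MemLp V 2 volume := hVc.memLp_of_hasCompactSupport
    (hvc.comp_left (g := fun x : ℝ => (x : 𝕜)) (by simp))
  have hGn : ∀ x, ‖G x‖ = ‖smoothGrad v x‖ := fun x => by
    rw [EuclideanSpace.norm_eq, EuclideanSpace.norm_eq]
    simp [hG]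
  have hvm := memLp_smoothGrad_of_lipschitz hv1 hv3
  have hGc : Continuous fun z : EuclideanSpace ℝ (Fin N) =>
      (WithLp.toLp 2 fun i => ((z i : ℝ) : 𝕜) : EuclideanSpace 𝕜 (Fin N)) :=
    (PiLp.continuous_toLp 2 _).comp (continuous_pi fun i =>
      RCLike.continuous_ofReal.comp (EuclideanSpace.proj (𝕜 := ℝ) i).continuous)
  have hGm : MemLp G 2 volume :=
    hvm.of_le (hGc.comp_aestronglyMeasurable hvm.1) (Eventually.of_forall fun x => (hGn x).le)
  have hweak : HasWeakGradient V G := by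
    intro ψ hψ hψc i
    have h := hasWeakGradient_of_lipschitz hv1 ψ hψ hψc i
    have e1 : ∀ x, fderiv ℝ ψ x (EuclideanSpace.single i 1) • V x =
        ((fderiv ℝ ψ x (EuclideanSpace.single i 1) • v x : ℝ) : 𝕜) := fun x => by
      simp [hV, RCLike.real_smul_eq_coe_mul]
    have e2 : ∀ x, ψ x • G x i = ((ψ x • smoothGrad v x i : ℝ) : 𝕜) := fun x => by
      simp [hG, RCLike.real_smul_eq_coe_mul]
    simp only [e1, e2]
    rw [integral_ofReal, integral_ofReal, h]
    simp
  refine ⟨H1.ofMemLp V G hVm hGm hweak, ?_, fun p hp => ?_, ?_⟩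
  -- The radial profile is the restriction of v to a coordinate axis.
  · refine ⟨fun r => (v (r • unitVec (⟨0, hN⟩ : Fin N)) : 𝕜), (H1.fn_ofMemLp _ _ _).trans
      (Eventually.of_forall fun x => ?_)⟩
    simp only [hV]
    congr 1
    refine hrad _ _ ?_
    rw [norm_smul]
    simp
  · have hI : ∫ x, v x ^ p = ∫ x, ‖φ x‖ ^ p := hvI p hp
    rw [H1.normLp_ofMemLp, H1.lpNorm_rpow hVm.1 hp,
      H1.lpNorm_rpow hφ.continuous.aestronglyMeasurable hp, ← hI]
    congr 1
    refine integral_congr_ae (Eventually.of_forall fun x => ?_)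
    simp [hV, abs_of_nonneg (hv2 x)]
  · rw [H1.normGrad_ofMemLp, ← toReal_eLpNorm hGm.1, ← toReal_eLpNorm hm.1]
    refine ENNReal.toReal_mono hm.2.ne ?_
    rw [← hBe]
    refine le_trans (le_of_eq ?_) hvB
    exact eLpNorm_congr_norm_ae (Eventually.of_forall hGn)

/-- Every function in `H¹` has, up to a small error, a radial competitor. -/
theorem H1.exists_radial (hN : 0 < N) (u : H1 𝕜 N) {ε : ℝ} (hε : 0 < ε) :
    ∃ w v : H1 𝕜 N, ‖w - u‖ < ε ∧ v.IsRadial ∧ (∀ p, 0 < p → v.normLp p = w.normLp p) ∧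
      v.normGrad ≤ w.normGrad := by
  obtain ⟨φ, hφ, hc, h1, h2⟩ := u.exists_smooth_approx (ε := ε / 3) (by positivity)
  obtain ⟨v, hv1, hv2, hv3⟩ := exists_radial_of_smooth hN hφ hc
  set w := H1.ofSmooth φ hφ hc with hw
  have hwf : w.fn =ᵐ[volume] φ := H1.fn_ofMemLp _ _ _
  have hwg : w.grad =ᵐ[volume] smoothGrad φ := H1.grad_ofMemLp _ _ _
  refine ⟨w, v, ?_, hv1, fun p hp => ?_, ?_⟩
  · refine lt_of_le_of_lt (H1.norm_le _) ?_
    have a1 : (w - u).normLp 2 ≤ ε / 3 := by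
      have e : (w - u).fn =ᵐ[volume] φ - u.fn := by
        filter_upwards [H1.fn_sub w u, hwf] with x k1 k2
        rw [k1, Pi.sub_apply, Pi.sub_apply, k2]
      rw [H1.normLp, lpNorm_congr_ae e, ← toReal_eLpNorm
        (hφ.continuous.aestronglyMeasurable.sub u.memLp_fn.1)]
      exact ENNReal.toReal_le_of_le_ofReal (by positivity) (by simpa using h1)
    have a2 : (w - u).normGrad ≤ ε / 3 := by
      have e : (w - u).grad =ᵐ[volume] smoothGrad φ - u.grad := by
        filter_upwards [H1.grad_sub w u, hwg] with x k1 k2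
        rw [k1, Pi.sub_apply, Pi.sub_apply, k2]
      rw [H1.normGrad, lpNorm_congr_ae e, ← toReal_eLpNorm
        ((continuous_smoothGrad (hφ.of_le (by simp))).aestronglyMeasurable.sub u.memLp_grad.1)]
      exact ENNReal.toReal_le_of_le_ofReal (by positivity) h2
    linarith
  · rw [hv2 p hp, H1.normLp, lpNorm_congr_ae hwf]
  · rw [H1.normGrad, H1.normGrad, lpNorm_congr_ae hwg]
    exact hv3

end Competitor

end NormalizedNLS

end

noncomputable section
namespace NormalizedNLS
open Filter Topology

/-! ### The threshold mass -/

/-! ### Relations between the exponents -/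

section Exponents

variable {N : ℕ} {q : ℝ}

theorem critExp_sub_two (hN : 3 ≤ N) : critExp N - 2 = α₁ N := by
  have hN' : (3 : ℝ) ≤ N := by exact_mod_cast hN
  have : (N : ℝ) - 2 ≠ 0 := by linarith
  rw [critExp, α₁]
  field_simp
  ring

theorem α₁_pos (hN : 3 ≤ N) : 0 < α₁ N := by
  have hN' : (3 : ℝ) ≤ N := by exact_mod_cast hN
  exact div_pos (by norm_num) (by linarith)

theorem mul_sub_two_lt (hN : 3 ≤ N) (hq' : q < 2 + 4 / (N : ℝ)) : (N : ℝ) * (q - 2) < 4 := by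
  have hN' : (3 : ℝ) ≤ N := by exact_mod_cast hN
  have h : q - 2 < 4 / N := by linarith
  rw [lt_div_iff₀ (by linarith)] at h
  linarith

theorem α₀_neg (hN : 3 ≤ N) (hq' : q < 2 + 4 / (N : ℝ)) : α₀ N q < 0 := by
  have := mul_sub_two_lt hN hq'
  rw [α₀]
  linarith

theorem α₂_pos (hN : 3 ≤ N) (hq : 2 < q) (hq' : q < 2 + 4 / (N : ℝ)) : 0 < α₂ N q := by
  have := mul_sub_two_lt hN hq'
  rw [α₂]
  linarith

theorem lt_critExp (hN : 3 ≤ N) (hq' : q < 2 + 4 / (N : ℝ)) : q < critExp N := by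
  have hN' : (3 : ℝ) ≤ N := by exact_mod_cast hN
  have h1 := critExp_sub_two hN
  have h2 : 4 / (N : ℝ) < α₁ N := by
    rw [α₁]
    exact div_lt_div_of_pos_left (by norm_num) (by linarith) (by linarith)
  linarith

/-- This is the power of c₀ in ρ₀^{α₁/2}. The potential term carries the same power, so at (c₀, ρ₀)
the two terms add up to K c₀^{2/N}. -/
theorem α₂_mul_α₁ (hN : 3 ≤ N) (hq' : q < 2 + 4 / (N : ℝ)) :
    α₂ N q * (α₁ N / 2) / (α₁ N - α₀ N q) = 2 / N := by
  have hN' : (3 : ℝ) ≤ N := by exact_mod_cast hN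
  have h1 : (N : ℝ) - 2 ≠ 0 := by linarith
  have h2 : α₁ N - α₀ N q ≠ 0 := by linarith [α₁_pos hN, α₀_neg hN hq']
  rw [div_eq_div_iff h2 (by linarith), α₂, α₁, α₀]
  field_simp
  ring

end Exponents

/-! ### The energy barrier at the gradient level ρ₀ -/

section Threshold

variable {𝕜 : Type*} [RCLike 𝕜] {N : ℕ} {q μ : ℝ}

theorem critExp_mul_sobolevConst_pos (hN : 3 ≤ N) :
    0 < critExp N * sobolevConst 𝕜 N ^ (critExp N / 2) := by
  have := critExp_pos hN
  have := (sobolevConst_spec 𝕜 hN).1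
  positivity

theorem gagliardoNirenbergConst_term_pos (hN : 3 ≤ N) (hq : 2 < q) (hq' : q < 2 + 4 / (N : ℝ))
    (hμ : 0 < μ) : 0 < μ / q * gagliardoNirenbergConst 𝕜 N q ^ q := by
  have := (gagliardoNirenbergConst_spec (𝕜 := 𝕜) hN hq.le (lt_critExp hN hq').le).1
  positivity

theorem constB_pos (hN : 3 ≤ N) (hq : 2 < q) (hq' : q < 2 + 4 / (N : ℝ)) (hμ : 0 < μ) :
    0 < constB 𝕜 N μ q := by
  have h1 := critExp_mul_sobolevConst_pos (𝕜 := 𝕜) hN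
  have h2 := gagliardoNirenbergConst_term_pos (𝕜 := 𝕜) hN hq hq' hμ
  have h3 : 0 < -(α₀ N q / α₁ N) := neg_pos.2 (div_neg_of_neg_of_pos (α₀_neg hN hq') (α₁_pos hN))
  rw [constB]
  positivity

theorem constK_pos (hN : 3 ≤ N) (hq : 2 < q) (hq' : q < 2 + 4 / (N : ℝ)) (hμ : 0 < μ) :
    0 < constK 𝕜 N μ q := by
  have h1 := critExp_mul_sobolevConst_pos (𝕜 := 𝕜) hN
  have h2 := gagliardoNirenbergConst_term_pos (𝕜 := 𝕜) hN hq hq' hμ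
  have h3 := constB_pos (𝕜 := 𝕜) hN hq hq' hμ
  rw [constK]
  positivity

theorem c₀_pos (hN : 3 ≤ N) (hq : 2 < q) (hq' : q < 2 + 4 / (N : ℝ)) (hμ : 0 < μ) :
    0 < c₀ 𝕜 N μ q := by
  have := constK_pos (𝕜 := 𝕜) hN hq hq' hμ
  rw [c₀]
  positivity

theorem ρ₀_pos (hN : 3 ≤ N) (hq : 2 < q) (hq' : q < 2 + 4 / (N : ℝ)) (hμ : 0 < μ) :
    0 < ρ₀ 𝕜 N μ q := by
  have := constB_pos (𝕜 := 𝕜) hN hq hq' hμ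
  have := c₀_pos (𝕜 := 𝕜) hN hq hq' hμ
  rw [ρ₀]
  positivity

/-- At the threshold mass the maximum of the lower bound of the energy is zero. -/
theorem threshold_eq (hN : 3 ≤ N) (hq : 2 < q) (hq' : q < 2 + 4 / (N : ℝ)) (hμ : 0 < μ) :
    μ / q * gagliardoNirenbergConst 𝕜 N q ^ q * ρ₀ 𝕜 N μ q ^ (α₀ N q / 2) *
      c₀ 𝕜 N μ q ^ (α₂ N q / 2) +
    1 / (critExp N * sobolevConst 𝕜 N ^ (critExp N / 2)) * ρ₀ 𝕜 N μ q ^ (α₁ N / 2) = 1 / 2 := by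
  have hB := constB_pos (𝕜 := 𝕜) hN hq hq' hμ
  have hK := constK_pos (𝕜 := 𝕜) hN hq hq' hμ
  have hc := c₀_pos (𝕜 := 𝕜) hN hq hq' hμ
  have hN' : (3 : ℝ) ≤ N := by exact_mod_cast hN
  have hne : α₁ N - α₀ N q ≠ 0 := by linarith [α₁_pos hN, α₀_neg hN hq']
  have hpow : ∀ x : ℝ, ρ₀ 𝕜 N μ q ^ (x / 2) = constB 𝕜 N μ q ^ (x / (α₁ N - α₀ N q)) *
      c₀ 𝕜 N μ q ^ (α₂ N q * (x / 2) / (α₁ N - α₀ N q)) := by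
    intro x
    rw [ρ₀, Real.mul_rpow (by positivity) (by positivity), ← Real.rpow_mul hB.le,
      ← Real.rpow_mul hc.le]
    congr 2 <;> field_simp
  have h0 : c₀ 𝕜 N μ q ^ (α₂ N q * (α₀ N q / 2) / (α₁ N - α₀ N q)) * c₀ 𝕜 N μ q ^ (α₂ N q / 2) =
      c₀ 𝕜 N μ q ^ (2 / (N : ℝ)) := by
    rw [← Real.rpow_add hc, ← α₂_mul_α₁ hN hq']
    congr 1
    field_simp
    ring
  have hcK : c₀ 𝕜 N μ q ^ (2 / (N : ℝ)) = 1 / (2 * constK 𝕜 N μ q) := by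
    rw [c₀, ← Real.rpow_mul (by positivity)]
    have : (N : ℝ) / 2 * (2 / N) = 1 := by field_simp
    rw [this, Real.rpow_one]
  rw [hpow, hpow, α₂_mul_α₁ hN hq']
  calc _ = μ / q * gagliardoNirenbergConst 𝕜 N q ^ q *
        constB 𝕜 N μ q ^ (α₀ N q / (α₁ N - α₀ N q)) *
        (c₀ 𝕜 N μ q ^ (α₂ N q * (α₀ N q / 2) / (α₁ N - α₀ N q)) * c₀ 𝕜 N μ q ^ (α₂ N q / 2)) +
        1 / (critExp N * sobolevConst 𝕜 N ^ (critExp N / 2)) *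
          constB 𝕜 N μ q ^ (α₁ N / (α₁ N - α₀ N q)) * c₀ 𝕜 N μ q ^ (2 / (N : ℝ)) := by ring
    _ = constK 𝕜 N μ q * c₀ 𝕜 N μ q ^ (2 / (N : ℝ)) := by rw [h0, constK]; ring
    _ = 1 / 2 := by rw [hcK]; field_simp

/-- The energy is bounded below in terms of the mass and the gradient norm. -/
theorem le_F (hN : 3 ≤ N) (hq : 2 < q) (hq' : q < 2 + 4 / (N : ℝ)) (hμ : 0 < μ) {c : ℝ}
    {u : H1 𝕜 N} (hu : u ∈ S 𝕜 N c) :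
    1 / 2 * u.normGrad ^ 2 - μ / q * gagliardoNirenbergConst 𝕜 N q ^ q *
        (u.normGrad ^ 2) ^ (N * (q - 2) / 4) * c ^ (α₂ N q / 2) -
      1 / (critExp N * sobolevConst 𝕜 N ^ (critExp N / 2)) * (u.normGrad ^ 2) ^ (critExp N / 2) ≤
    F μ q u := by
  obtain rfl : u.normLp 2 ^ 2 = c := hu
  obtain ⟨hC, hGN⟩ := gagliardoNirenbergConst_spec (𝕜 := 𝕜) hN hq.le (lt_critExp hN hq').le
  have hS := (sobolevConst_spec 𝕜 hN).1
  have hr := critExp_pos hN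
  have hA := u.normGrad_nonneg
  have hn := u.normLp_nonneg 2
  have hsq : ∀ {x : ℝ}, 0 ≤ x → ∀ y : ℝ, (x ^ 2) ^ y = x ^ (2 * y) := fun hx y => by
    rw [← Real.rpow_natCast, ← Real.rpow_mul hx]; norm_num
  have e1 : gnExp N q * q = 2 * (N * (q - 2) / 4) := by
    rw [gnExp]; field_simp; ring
  have e2 : (1 - gnExp N q) * q = 2 * (α₂ N q / 2) := by
    rw [sub_mul, e1, α₂]; ring
  have h1 : u.normLp q ^ q ≤ gagliardoNirenbergConst 𝕜 N q ^ q *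
      (u.normGrad ^ 2) ^ (N * (q - 2) / 4) * (u.normLp 2 ^ 2) ^ (α₂ N q / 2) := by
    calc u.normLp q ^ q ≤ (gagliardoNirenbergConst 𝕜 N q * u.normGrad ^ gnExp N q *
          u.normLp 2 ^ (1 - gnExp N q)) ^ q :=
          Real.rpow_le_rpow (u.normLp_nonneg q) (hGN u) (by linarith)
      _ = _ := by
          rw [Real.mul_rpow (by positivity) (by positivity), Real.mul_rpow hC.le (by positivity),
            ← Real.rpow_mul hA, ← Real.rpow_mul hn, hsq hA, hsq hn]
          rw [e1, e2]
  have h2 : u.normLp (critExp N) ^ critExp N ≤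
      1 / sobolevConst 𝕜 N ^ (critExp N / 2) * (u.normGrad ^ 2) ^ (critExp N / 2) := by
    have h := Real.rpow_le_rpow (by positivity) (u.sobolev hN)
      (show 0 ≤ critExp N / 2 by positivity)
    rw [Real.mul_rpow hS.le (by positivity), hsq (u.normLp_nonneg _),
      mul_div_cancel₀ _ (two_ne_zero)] at h
    rw [one_div, inv_mul_eq_div, le_div_iff₀ (by positivity)]
    linarith
  have h1' := mul_le_mul_of_nonneg_left h1 (show 0 ≤ μ / q by positivity)
  have h2' := mul_le_mul_of_nonneg_left h2 (show 0 ≤ 1 / critExp N by positivity)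
  have e : 1 / critExp N * (1 / sobolevConst 𝕜 N ^ (critExp N / 2) *
      (u.normGrad ^ 2) ^ (critExp N / 2)) = 1 / (critExp N * sobolevConst 𝕜 N ^ (critExp N / 2)) *
      (u.normGrad ^ 2) ^ (critExp N / 2) := by
    rw [← mul_assoc, one_div_mul_one_div]
  rw [e] at h2'
  rw [F]
  linarith

/-- Below the threshold mass the energy is uniformly positive where `‖∇u‖₂² = ρ₀`. -/
theorem exists_barrier (hN : 3 ≤ N) (hq : 2 < q) (hq' : q < 2 + 4 / (N : ℝ)) (hμ : 0 < μ)
    {c : ℝ} (hc : 0 < c) (hc' : c < c₀ 𝕜 N μ q) :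
    ∃ κ > 0, ∀ u ∈ S 𝕜 N c, u.normGrad ^ 2 = ρ₀ 𝕜 N μ q → κ ≤ F μ q u := by
  have hG := gagliardoNirenbergConst_term_pos (𝕜 := 𝕜) hN hq hq' hμ
  have hρ := ρ₀_pos (𝕜 := 𝕜) hN hq hq' hμ
  have hα₂ := α₂_pos hN hq hq'
  have hlt : c ^ (α₂ N q / 2) < c₀ 𝕜 N μ q ^ (α₂ N q / 2) :=
    Real.rpow_lt_rpow hc.le hc' (by positivity)
  have h := threshold_eq (𝕜 := 𝕜) hN hq hq' hμ
  -- The constant is ρ₀ (f(c, ρ₀) − f(c₀, ρ₀)), where f(c₀, ρ₀) = 0: only the mass factor of the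
  -- potential term changes between c and c₀.
  refine ⟨μ / q * gagliardoNirenbergConst 𝕜 N q ^ q * ρ₀ 𝕜 N μ q ^ (N * (q - 2) / 4) *
    (c₀ 𝕜 N μ q ^ (α₂ N q / 2) - c ^ (α₂ N q / 2)),
    mul_pos (by positivity) (sub_pos.2 hlt), fun u hu hA => ?_⟩
  refine le_trans (le_of_eq ?_) (le_F hN hq hq' hμ hu)
  have hadd : ∀ y : ℝ, ρ₀ 𝕜 N μ q ^ (1 + y) = ρ₀ 𝕜 N μ q * ρ₀ 𝕜 N μ q ^ y := fun y => by
    rw [Real.rpow_add hρ, Real.rpow_one]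
  have e1 : ρ₀ 𝕜 N μ q ^ (N * (q - 2) / 4) = ρ₀ 𝕜 N μ q * ρ₀ 𝕜 N μ q ^ (α₀ N q / 2) := by
    rw [← hadd]
    congr 1
    rw [α₀]
    ring
  have e2 : ρ₀ 𝕜 N μ q ^ (critExp N / 2) = ρ₀ 𝕜 N μ q * ρ₀ 𝕜 N μ q ^ (α₁ N / 2) := by
    rw [← hadd, ← critExp_sub_two hN]
    congr 1
    ring
  rw [hA, e1, e2]
  linear_combination ρ₀ 𝕜 N μ q * h

theorem bddBelow_V (hN : 3 ≤ N) (hq : 2 < q) (hq' : q < 2 + 4 / (N : ℝ)) (hμ : 0 < μ)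
    {c : ℝ} (hc : 0 < c) : BddBelow (F μ q '' V 𝕜 N μ q c) := by
  refine ⟨-(μ / q * gagliardoNirenbergConst 𝕜 N q ^ q * ρ₀ 𝕜 N μ q ^ (N * (q - 2) / 4) *
    c ^ (α₂ N q / 2)) - 1 / (critExp N * sobolevConst 𝕜 N ^ (critExp N / 2)) *
      ρ₀ 𝕜 N μ q ^ (critExp N / 2), ?_⟩
  rintro _ ⟨u, ⟨hu, hA⟩, rfl⟩
  have hG := gagliardoNirenbergConst_term_pos (𝕜 := 𝕜) hN hq hq' hμ
  have hD := critExp_mul_sobolevConst_pos (𝕜 := 𝕜) hN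
  have hr := critExp_pos hN
  have hN' : (3 : ℝ) ≤ N := by exact_mod_cast hN
  have h := le_F hN hq hq' hμ hu
  have h1 : (u.normGrad ^ 2) ^ (N * (q - 2) / 4) ≤ ρ₀ 𝕜 N μ q ^ (N * (q - 2) / 4) :=
    Real.rpow_le_rpow (sq_nonneg _) hA.le
      (div_nonneg (mul_nonneg (by linarith) (by linarith)) (by norm_num))
  have h2 : (u.normGrad ^ 2) ^ (critExp N / 2) ≤ ρ₀ 𝕜 N μ q ^ (critExp N / 2) :=
    Real.rpow_le_rpow (sq_nonneg _) hA.le (by positivity)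
  have h1' := mul_le_mul_of_nonneg_right (mul_le_mul_of_nonneg_left h1 hG.le)
    (show 0 ≤ c ^ (α₂ N q / 2) by positivity)
  have h2' := mul_le_mul_of_nonneg_left h2 (one_div_pos.2 hD).le
  nlinarith [sq_nonneg u.normGrad]

end Threshold

end NormalizedNLS

end

noncomputable section
namespace NormalizedNLS
open Filter Topology

/-! ### Position of a point relative to the two critical points of the fibre -/

namespace FiberShape

variable {p r A a b s₁ s₂ s : ℝ}

theorem eq_or_eq (h : FiberShape p r A a b s₁ s₂) (hs : 0 < s) (hQ : fiberQ p r A a b s = 0) :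
    s = s₁ ∨ s = s₂ := by
  rcases lt_trichotomy s s₁ with h1 | h1 | h1
  · exact absurd hQ (h.neg_left s hs h1).ne
  · exact Or.inl h1
  rcases lt_trichotomy s s₂ with h2 | h2 | h2
  · exact absurd hQ (h.pos_mid s h1 h2).ne'
  · exact Or.inr h2
  · exact absurd hQ (h.neg_right s h2).ne

theorem lt_right_of_fiberQ_pos (h : FiberShape p r A a b s₁ s₂) (hp : 0 < p) (hr : 0 < r)
    (hQ : 0 < fiberQ p r A a b s) : s < s₂ := by
  by_contra! hs
  rcases hs.eq_or_lt with rfl | hs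
  · exact hQ.ne' (h.fiberQ_right hp hr)
  · exact (h.neg_right s hs).not_gt hQ

theorem left_lt_of_fiber_pos (h : FiberShape p r A a b s₁ s₂) (hp : 0 < p) (hr : 0 < r)
    (hs : 0 < s) (hF : 0 < fiber p r A a b s) : s₁ < s := by
  by_contra! hle
  exact (h.fiber_neg hp hr hs hle).not_gt hF

theorem right_lt_of_fiber_pos (h : FiberShape p r A a b s₁ s₂) (hp : 0 < p) (hr : 0 < r)
    (hs : 0 < s) (hF : 0 < fiber p r A a b s) (hQ : fiberQ p r A a b s < 0) : s₂ < s := by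
  have h1 := h.left_lt_of_fiber_pos hp hr hs hF
  by_contra! hle
  rcases hle.eq_or_lt with rfl | hlt
  · exact hQ.ne (h.fiberQ_right hp hr)
  · exact (h.pos_mid s h1 hlt).not_gt hQ

/-- A point of negative energy to the left of a point of positive energy lies to the left of the
maximum point. -/
theorem lt_right_of_fiber_neg (h : FiberShape p r A a b s₁ s₂) (hp : 0 < p) (hr : 0 < r) {t : ℝ}
    (hts : t < s) (ht : fiber p r A a b t < 0) (hF : 0 < fiber p r A a b s) : t < s₂ := by
  by_contra! hle
  have := (h.strictAntiOn_right hp hr) hle (hle.trans hts.le) hts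
  linarith

/-- A point of negative energy to the right of a point of positive energy lies to the right of the
maximum point. -/
theorem right_lt_of_fiber_neg (h : FiberShape p r A a b s₁ s₂) (hp : 0 < p) (hr : 0 < r) {t : ℝ}
    (hs : 0 < s) (hst : s < t) (ht : fiber p r A a b t < 0) (hF : 0 < fiber p r A a b s) :
    s₂ < t := by
  have h1 := h.left_lt_of_fiber_pos hp hr hs hF
  by_contra! hle
  have := (h.strictMonoOn_mid hp hr) ⟨h1.le, hst.le.trans hle⟩ ⟨(h1.trans hst).le, hle⟩ hst
  linarith

end FiberShape

/-! ### Energy and Pohozaev functional along dilations -/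

/-- The range of the parameters: dimension at least three, mass subcritical power, focusing. -/
structure Admissible (N : ℕ) (q μ : ℝ) : Prop where
  dim : 3 ≤ N
  two_lt : 2 < q
  lt : q < 2 + 4 / (N : ℝ)
  pos : 0 < μ

/-- The exponent of `s` in the potential energy of the dilation by `s`. -/
def dilExp (N : ℕ) (q : ℝ) : ℝ := N * (q - 2) / 2

section Dilation

variable {𝕜 : Type*} [RCLike 𝕜] {N : ℕ} {q μ c : ℝ}

namespace Admissible

theorem lt_critExp (h : Admissible N q μ) : q < critExp N :=
  NormalizedNLS.lt_critExp h.dim h.lt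

theorem two_lt_critExp (h : Admissible N q μ) : 2 < critExp N := critExp_pos h.dim

theorem critExp_pos (h : Admissible N q μ) : 0 < critExp N := two_pos.trans h.two_lt_critExp

theorem dilExp_pos (h : Admissible N q μ) : 0 < dilExp N q := by
  have hN : (3 : ℝ) ≤ N := by exact_mod_cast h.dim
  have := h.two_lt
  exact div_pos (mul_pos (by linarith) (by linarith)) two_pos

theorem dilExp_lt_two (h : Admissible N q μ) : dilExp N q < 2 := by
  have := mul_sub_two_lt h.dim h.lt
  rw [dilExp]
  linarith

end Admissible

namespace H1

/-- The coefficient of the potential energy. -/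
def potential (μ q : ℝ) (u : H1 𝕜 N) : ℝ := μ / q * u.normLp q ^ q

/-- The coefficient of the critical energy. -/
def critical (u : H1 𝕜 N) : ℝ := 1 / critExp N * u.normLp (critExp N) ^ critExp N

/-- The energy of the dilation of `u` by `s`. -/
def energyFiber (μ q : ℝ) (u : H1 𝕜 N) : ℝ → ℝ :=
  fiber (dilExp N q) (critExp N) (u.normGrad ^ 2) (potential μ q u) u.critical

/-- The Pohozaev functional of the dilation of `u` by `s`. -/
def pohozaevFiber (μ q : ℝ) (u : H1 𝕜 N) : ℝ → ℝ :=
  fiberQ (dilExp N q) (critExp N) (u.normGrad ^ 2) (potential μ q u) u.critical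

/-- `s₁` and `s₂` are the minimum point and the maximum point of the energy on the fibre of `u`. -/
abbrev HasShape (μ q : ℝ) (u : H1 𝕜 N) (s₁ s₂ : ℝ) : Prop :=
  FiberShape (dilExp N q) (critExp N) (u.normGrad ^ 2) (potential μ q u) u.critical s₁ s₂

theorem F_eq_energyFiber_one (u : H1 𝕜 N) : F μ q u = energyFiber μ q u 1 := by
  simp only [F, energyFiber, fiber, potential, critical, Real.one_rpow]
  ring

theorem normGrad_dil_sq {s : ℝ} (hs : 0 < s) (u : H1 𝕜 N) :
    (dil s u).normGrad ^ 2 = u.normGrad ^ 2 * s ^ 2 := by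
  rw [normGrad_dil hs]; ring

theorem potential_dil (h : Admissible N q μ) {s : ℝ} (hs : 0 < s) (u : H1 𝕜 N) :
    potential μ q (dil s u) = potential μ q u * s ^ dilExp N q := by
  have hq := h.two_lt
  rw [potential, potential, normLp_dil hs (by linarith), Real.mul_rpow (by positivity)
    (u.normLp_nonneg _), ← Real.rpow_mul hs.le]
  have : ((N : ℝ) / 2 - N / q) * q = dilExp N q := by rw [dilExp]; field_simp
  rw [this]
  ring

theorem critical_dil (h : Admissible N q μ) {s : ℝ} (hs : 0 < s) (u : H1 𝕜 N) :
    (dil s u).critical = u.critical * s ^ critExp N := by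
  have hr := h.critExp_pos
  have hN : (3 : ℝ) ≤ N := by exact_mod_cast h.dim
  have hN2 : (N : ℝ) - 2 ≠ 0 := by linarith
  rw [critical, critical, normLp_dil hs hr, Real.mul_rpow (by positivity)
    (u.normLp_nonneg _), ← Real.rpow_mul hs.le]
  have : ((N : ℝ) / 2 - N / critExp N) * critExp N = critExp N := by
    rw [sub_mul, div_mul_cancel₀ _ hr.ne', critExp]
    field_simp
    ring
  rw [this]
  ring

theorem F_dil (h : Admissible N q μ) {s : ℝ} (hs : 0 < s) (u : H1 𝕜 N) :
    F μ q (dil s u) = energyFiber μ q u s := by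
  rw [F_eq_energyFiber_one, energyFiber, normGrad_dil_sq hs, potential_dil h hs, critical_dil h hs]
  simp only [energyFiber, fiber, Real.one_rpow]
  ring

theorem Q_eq_pohozaevFiber_one (h : Admissible N q μ) (u : H1 𝕜 N) :
    Q μ q u = pohozaevFiber μ q u 1 := by
  have hr := h.critExp_pos
  have hq := h.two_lt
  simp only [Q, pohozaevFiber, fiberQ, potential, critical, Real.one_rpow, γ, dilExp]
  field_simp

theorem Q_dil (h : Admissible N q μ) {s : ℝ} (hs : 0 < s) (u : H1 𝕜 N) :
    Q μ q (dil s u) = pohozaevFiber μ q u s := by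
  rw [Q_eq_pohozaevFiber_one h, pohozaevFiber, normGrad_dil_sq hs, potential_dil h hs,
    critical_dil h hs]
  simp only [pohozaevFiber, fiberQ, Real.one_rpow]
  ring

theorem dil_mem_S {s : ℝ} (hs : 0 < s) {u : H1 𝕜 N} (hu : u ∈ S 𝕜 N c) : dil s u ∈ S 𝕜 N c := by
  change (dil s u).normLp 2 ^ 2 = c
  rw [normLp_two_dil hs]
  exact hu

theorem continuous_potential (h : Admissible N q μ) :
    Continuous fun u : H1 𝕜 N => potential μ q u := by
  have h1 := continuous_normLp (𝕜 := 𝕜) h.dim h.two_lt.le h.lt_critExp.le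
  exact continuous_const.mul (h1.rpow_const fun _ => Or.inr (two_pos.trans h.two_lt).le)

theorem continuous_critical (h : Admissible N q μ) :
    Continuous fun u : H1 𝕜 N => u.critical := by
  have h1 := continuous_normLp (𝕜 := 𝕜) h.dim h.two_lt_critExp.le le_rfl
  exact continuous_const.mul (h1.rpow_const fun _ => Or.inr h.critExp_pos.le)

theorem continuous_energyFiber (h : Admissible N q μ) (s : ℝ) :
    Continuous fun u : H1 𝕜 N => energyFiber μ q u s := by
  have h1 := continuous_potential (𝕜 := 𝕜) h
  have h2 := continuous_critical (𝕜 := 𝕜) h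
  have h3 := continuous_normGrad (𝕜 := 𝕜) (N := N)
  unfold energyFiber fiber
  fun_prop

theorem continuous_pohozaevFiber (h : Admissible N q μ) (s : ℝ) :
    Continuous fun u : H1 𝕜 N => pohozaevFiber μ q u s := by
  have h1 := continuous_potential (𝕜 := 𝕜) h
  have h2 := continuous_critical (𝕜 := 𝕜) h
  have h3 := continuous_normGrad (𝕜 := 𝕜) (N := N)
  unfold pohozaevFiber fiberQ
  fun_prop

theorem continuous_F (h : Admissible N q μ) : Continuous fun u : H1 𝕜 N => F μ q u := by
  simpa only [F_eq_energyFiber_one] using continuous_energyFiber (𝕜 := 𝕜) h 1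

theorem normLp_two_pos (hc : 0 < c) {u : H1 𝕜 N} (hu : u ∈ S 𝕜 N c) : 0 < u.normLp 2 := by
  refine (u.normLp_nonneg 2).lt_of_ne' fun h0 => ?_
  have : u.normLp 2 ^ 2 = c := hu
  rw [h0] at this
  simp at this
  linarith

theorem normLp_pos (hN : 3 ≤ N) (hc : 0 < c) {u : H1 𝕜 N} (hu : u ∈ S 𝕜 N c) {p : ℝ}
    (hp : 2 ≤ p) (hp' : p ≤ critExp N) : 0 < u.normLp p := by
  refine (u.normLp_nonneg p).lt_of_ne' fun h0 => ?_
  have hz := (lpNorm_eq_zero (u.memLp hN hp hp') (by simp; linarith)).1 h0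
  refine (normLp_two_pos hc hu).ne' ?_
  rw [normLp, lpNorm_congr_ae hz]
  simp

theorem normGrad_pos (hN : 3 ≤ N) (hc : 0 < c) {u : H1 𝕜 N} (hu : u ∈ S 𝕜 N c) :
    0 < u.normGrad := by
  refine u.normGrad_nonneg.lt_of_ne' fun h0 => ?_
  have h1 := u.sobolev hN
  have h2 := normLp_pos hN hc hu (critExp_pos hN).le le_rfl
  have h3 := (sobolevConst_spec 𝕜 hN).1
  rw [h0] at h1
  have : 0 < sobolevConst 𝕜 N * u.normLp (critExp N) ^ 2 := by positivity
  linarith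

theorem potential_pos (h : Admissible N q μ) (hc : 0 < c) {u : H1 𝕜 N} (hu : u ∈ S 𝕜 N c) :
    0 < potential μ q u := by
  have h1 := normLp_pos h.dim hc hu h.two_lt.le h.lt_critExp.le
  have h2 := h.pos
  have h3 := h.two_lt
  rw [potential]
  positivity

theorem critical_pos (h : Admissible N q μ) (hc : 0 < c) {u : H1 𝕜 N} (hu : u ∈ S 𝕜 N c) :
    0 < u.critical := by
  have h1 := normLp_pos h.dim hc hu h.two_lt_critExp.le le_rfl
  have h2 := h.critExp_pos
  rw [critical]
  positivity

/-- Below the threshold mass every fibre has positive energy where it crosses `‖∇u‖₂² = ρ₀`. -/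
theorem exists_hasShape (h : Admissible N q μ) (hc : 0 < c) (hc' : c < c₀ 𝕜 N μ q) {u : H1 𝕜 N}
    (hu : u ∈ S 𝕜 N c) : ∃ s₀ s₁ s₂, 0 < s₀ ∧ u.normGrad ^ 2 * s₀ ^ 2 = ρ₀ 𝕜 N μ q ∧
      0 < energyFiber μ q u s₀ ∧ HasShape μ q u s₁ s₂ := by
  obtain ⟨κ, hκ, hbar⟩ := exists_barrier h.dim h.two_lt h.lt h.pos hc hc'
  have hA : 0 < u.normGrad ^ 2 := pow_pos (normGrad_pos h.dim hc hu) 2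
  have hρ := ρ₀_pos (𝕜 := 𝕜) h.dim h.two_lt h.lt h.pos
  -- The scale at which the dilated function has squared gradient norm exactly ρ₀.
  set s₀ := √(ρ₀ 𝕜 N μ q / u.normGrad ^ 2) with hs
  have hs₀ : 0 < s₀ := Real.sqrt_pos.2 (by positivity)
  have hgrad : u.normGrad ^ 2 * s₀ ^ 2 = ρ₀ 𝕜 N μ q := by
    rw [hs, Real.sq_sqrt (by positivity), mul_div_cancel₀ _ hA.ne']
  have hpos : 0 < energyFiber μ q u s₀ := by
    rw [← F_dil h hs₀]
    exact hκ.trans_le (hbar _ (dil_mem_S hs₀ hu) (by rw [normGrad_dil_sq hs₀, hgrad]))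
  obtain ⟨s₁, s₂, hshape⟩ := exists_fiberShape h.dilExp_pos h.dilExp_lt_two h.two_lt_critExp
    (potential_pos h hc hu) (critical_pos h hc hu) hs₀ hpos
  exact ⟨s₀, s₁, s₂, hs₀, hgrad, hpos, hshape⟩

end H1

end Dilation

/-! ### The levels -/

section Levels

open H1

variable {𝕜 : Type*} [RCLike 𝕜] {N : ℕ} {q μ c : ℝ}

/-- The energy is negative up to s₁ and positive at s₀, so s₁ < s₀, and the gradient norm grows with
the scale. -/
theorem HasShape.dil_mem_V (h : Admissible N q μ) {u : H1 𝕜 N} (hu : u ∈ S 𝕜 N c)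
    {s₀ s₁ s₂ : ℝ} (hs₀ : 0 < s₀) (hρ : u.normGrad ^ 2 * s₀ ^ 2 = ρ₀ 𝕜 N μ q)
    (hpos : 0 < energyFiber μ q u s₀) (hA : 0 < u.normGrad) (hs : HasShape μ q u s₁ s₂) :
    dil s₁ u ∈ V 𝕜 N μ q c := by
  refine ⟨dil_mem_S hs.pos hu, ?_⟩
  have h1 : s₁ < s₀ := hs.left_lt_of_fiber_pos h.dilExp_pos h.critExp_pos hs₀ hpos
  have h2 := hs.pos
  rw [normGrad_dil_sq hs.pos, ← hρ]
  gcongr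

theorem HasShape.F_dil_left_neg (h : Admissible N q μ) {u : H1 𝕜 N} {s₁ s₂ : ℝ}
    (hs : HasShape μ q u s₁ s₂) : F μ q (dil s₁ u) < 0 := by
  rw [F_dil h hs.pos]
  exact hs.fiber_neg h.dilExp_pos h.critExp_pos hs.pos le_rfl

theorem exists_mem_S (hN : 3 ≤ N) (hc : 0 < c) : (S 𝕜 N c).Nonempty := by
  obtain ⟨u, hu, -⟩ := H1.exists_pos 𝕜 N hN
  refine ⟨((√c / u.normLp 2 : ℝ) : 𝕜) • u, ?_⟩
  change (_ • u : H1 𝕜 N).normLp 2 ^ 2 = c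
  rw [normLp_smul, RCLike.norm_ofReal, abs_of_nonneg (by positivity), div_mul_cancel₀ _ hu.ne',
    Real.sq_sqrt hc.le]

theorem m_neg (h : Admissible N q μ) (hc : 0 < c) (hc' : c < c₀ 𝕜 N μ q) : m 𝕜 N μ q c < 0 := by
  obtain ⟨u, hu⟩ := exists_mem_S (𝕜 := 𝕜) h.dim hc
  obtain ⟨s₀, s₁, s₂, hs₀, hρ, hpos, hs⟩ := exists_hasShape h hc hc' hu
  have hV := HasShape.dil_mem_V h hu hs₀ hρ hpos (normGrad_pos h.dim hc hu) hs
  exact (csInf_le (bddBelow_V h.dim h.two_lt h.lt h.pos hc) ⟨_, hV, rfl⟩).trans_lt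
    (HasShape.F_dil_left_neg h hs)

/-- Since m(c) < 0, the level 2m(c) lies strictly below the infimum over V(c), so E_c is disjoint
from V(c). -/
theorem le_normGrad_sq_of_mem_E (h : Admissible N q μ) (hc : 0 < c) (hc' : c < c₀ 𝕜 N μ q)
    {u : H1 𝕜 N} (hu : u ∈ E 𝕜 N μ q c) : ρ₀ 𝕜 N μ q ≤ u.normGrad ^ 2 := by
  by_contra! hlt
  have h1 := m_neg h hc hc'
  have h2 : m 𝕜 N μ q c ≤ F μ q u :=
    csInf_le (bddBelow_V h.dim h.two_lt h.lt h.pos hc) ⟨u, ⟨hu.1, hlt⟩, rfl⟩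
  linarith [hu.2]

/-- A point of `Λ⁺` is the maximum of the energy on its fibre. -/
theorem energyFiber_le_of_mem_Λplus (h : Admissible N q μ) (hc : 0 < c) (hc' : c < c₀ 𝕜 N μ q)
    {u : H1 𝕜 N} (hu : u ∈ Λplus 𝕜 N μ q c) {s : ℝ} (hs : 0 < s) :
    energyFiber μ q u s ≤ F μ q u := by
  obtain ⟨⟨huS, hQ⟩, hF⟩ := hu
  obtain ⟨s₀, s₁, s₂, hs₀, hρ, hpos, hshape⟩ := exists_hasShape h hc hc' huS
  rw [Q_eq_pohozaevFiber_one h] at hQ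
  rw [F_eq_energyFiber_one] at hF ⊢
  obtain rfl | rfl := hshape.eq_or_eq one_pos hQ
  · exact absurd hF (hshape.fiber_neg h.dilExp_pos h.critExp_pos one_pos le_rfl).not_gt
  · exact hshape.fiber_le h.dilExp_pos h.critExp_pos hs one_pos hF

theorem HasShape.dil_mem_Λplus (h : Admissible N q μ) {u : H1 𝕜 N} (hu : u ∈ S 𝕜 N c)
    {s₀ s₁ s₂ : ℝ} (hs₀ : 0 < s₀) (hpos : 0 < energyFiber μ q u s₀)
    (hs : HasShape μ q u s₁ s₂) : dil s₂ u ∈ Λplus 𝕜 N μ q c := by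
  have hs₂ : 0 < s₂ := hs.pos.trans hs.lt
  refine ⟨⟨dil_mem_S hs₂ hu, ?_⟩, ?_⟩
  · rw [Q_dil h hs₂]
    exact hs.fiberQ_right h.dilExp_pos h.critExp_pos
  · rw [F_dil h hs₂]
    exact hpos.trans_le (hs.fiber_le h.dilExp_pos h.critExp_pos hs₀ hs₀ hpos)

theorem Λplus_nonempty (h : Admissible N q μ) (hc : 0 < c) (hc' : c < c₀ 𝕜 N μ q) :
    (Λplus 𝕜 N μ q c).Nonempty := by
  obtain ⟨u, hu⟩ := exists_mem_S (𝕜 := 𝕜) h.dim hc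
  obtain ⟨s₀, s₁, s₂, hs₀, hρ, hpos, hs⟩ := exists_hasShape h hc hc' hu
  exact ⟨_, HasShape.dil_mem_Λplus h hu hs₀ hpos hs⟩

theorem bddBelow_Λplus : BddBelow (F μ q '' Λplus 𝕜 N μ q c) :=
  ⟨0, by rintro _ ⟨u, hu, rfl⟩; exact hu.2.le⟩

/-- A point of `Λ⁻` has small gradient. -/
theorem mem_V_of_mem_Λminus (h : Admissible N q μ) (hc : 0 < c) (hc' : c < c₀ 𝕜 N μ q)
    {u : H1 𝕜 N} (hu : u ∈ Λminus 𝕜 N μ q c) : u ∈ V 𝕜 N μ q c := by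
  obtain ⟨⟨huS, hQ⟩, hF⟩ := hu
  obtain ⟨s₀, s₁, s₂, hs₀, hρ, hpos, hs⟩ := exists_hasShape h hc hc' huS
  rw [Q_eq_pohozaevFiber_one h] at hQ
  rw [F_eq_energyFiber_one] at hF
  have hA := normGrad_pos h.dim hc huS
  refine ⟨huS, ?_⟩
  obtain rfl | rfl := hs.eq_or_eq one_pos hQ
  · have h1 : 1 < s₀ := hs.left_lt_of_fiber_pos h.dilExp_pos h.critExp_pos hs₀ hpos
    rw [← hρ]
    exact lt_mul_of_one_lt_right (by positivity) (one_lt_pow₀ h1 two_ne_zero)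
  · have := hpos.trans_le (hs.fiber_le h.dilExp_pos h.critExp_pos hs₀ hs₀ hpos)
    exact absurd hF this.not_gt

theorem Γ0_subset_Γ (h : Admissible N q μ) (hc : 0 < c) (hc' : c < c₀ 𝕜 N μ q) :
    Γ0 𝕜 N μ q c ⊆ Γ 𝕜 N μ q c := fun _ hg =>
  ⟨fun t => (hg.1 t).1, ⟨mem_V_of_mem_Λminus h hc hc' hg.2.1, hg.2.1.2⟩, hg.2.2⟩

/-- Every path of `Γ` crosses `Λ⁺`. -/
theorem exists_mem_Λplus_of_mem_Γ (h : Admissible N q μ) (hc : 0 < c) (hc' : c < c₀ 𝕜 N μ q)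
    {g : C(ℝ≥0, H1 𝕜 N)} (hg : g ∈ Γ 𝕜 N μ q c) : ∃ t, g t ∈ Λplus 𝕜 N μ q c := by
  obtain ⟨hS, ⟨hV, hF0⟩, t₁, ht₁⟩ := hg
  have hp := h.dilExp_pos
  have hr := h.critExp_pos
  -- These are the times with s₂ > 1, and `U₂` those with s₂ < 1. Written as unions of strict
  -- inequalities at fixed scales they are visibly open, so continuity of s₂ is not needed. Positive
  -- energy in `U₂` excludes the scales below s₁, where the Pohozaev functional is negative too.
  set U₁ : Set ℝ≥0 := ⋃ s ∈ Ioi (1 : ℝ), {t | 0 < pohozaevFiber μ q (g t) s} with hU₁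
  set U₂ : Set ℝ≥0 := ⋃ s ∈ Ioo (0 : ℝ) 1,
    {t | 0 < energyFiber μ q (g t) s} ∩ {t | pohozaevFiber μ q (g t) s < 0} with hU₂
  have hO₁ : IsOpen U₁ := isOpen_biUnion fun s _ =>
    isOpen_lt continuous_const ((continuous_pohozaevFiber h s).comp g.continuous)
  have hO₂ : IsOpen U₂ := isOpen_biUnion fun s _ =>
    (isOpen_lt continuous_const ((continuous_energyFiber h s).comp g.continuous)).inter
      (isOpen_lt ((continuous_pohozaevFiber h s).comp g.continuous) continuous_const)
  have hmem₁ : ∀ t s₁ s₂, HasShape μ q (g t) s₁ s₂ → 1 < s₂ → t ∈ U₁ := by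
    intro t s₁ s₂ hs h1
    obtain ⟨s, hs1, hs2⟩ := exists_between (max_lt h1 hs.lt)
    exact mem_biUnion (show s ∈ Ioi (1 : ℝ) from (le_max_left _ _).trans_lt hs1)
      (hs.pos_mid s ((le_max_right _ _).trans_lt hs1) hs2)
  have hmem₂ : ∀ t s₀ s₁ s₂, 0 < s₀ → 0 < energyFiber μ q (g t) s₀ →
      HasShape μ q (g t) s₁ s₂ → s₂ < 1 → t ∈ U₂ := by
    intro t s₀ s₁ s₂ hs₀ hpos hs h1
    have hs₂ : 0 < energyFiber μ q (g t) s₂ := hpos.trans_le (hs.fiber_le hp hr hs₀ hs₀ hpos)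
    have hev : ∀ᶠ s in 𝓝[>] s₂, 0 < energyFiber μ q (g t) s :=
      ((continuous_fiber hp hr).tendsto s₂).mono_left nhdsWithin_le_nhds (lt_mem_nhds hs₂)
    obtain ⟨s, hs3, hs4⟩ := (hev.and (Ioo_mem_nhdsGT h1)).exists
    exact mem_biUnion (show s ∈ Ioo (0 : ℝ) 1 from
      ⟨(hs.pos.trans hs.lt).trans hs4.1, hs4.2⟩) ⟨hs3, hs.neg_right s hs4.1⟩
  -- In V(c) the barrier scale satisfies s₀ > 1, and negative energy to the left of s₀ places the
  -- scale 1 before s₂.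
  have h0 : (0 : ℝ≥0) ∈ U₁ := by
    obtain ⟨s₀, s₁, s₂, hs₀, hρ, hpos, hs⟩ := exists_hasShape h hc hc' (hS 0)
    refine hmem₁ 0 s₁ s₂ hs ?_
    rw [F_eq_energyFiber_one] at hF0
    refine hs.lt_right_of_fiber_neg hp hr ?_ hF0 hpos
    have hA := hV.2
    rw [← hρ] at hA
    have hA0 : 0 < (g 0).normGrad ^ 2 := pow_pos (normGrad_pos h.dim hc (hS 0)) 2
    have h2 : 1 < s₀ ^ 2 := (lt_mul_iff_one_lt_right hA0).1 hA
    exact (one_lt_sq_iff₀ hs₀.le).1 h2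
  -- In E_c the barrier scale satisfies s₀ < 1, and negative energy to the right of s₀ places the
  -- scale 1 beyond s₂.
  have h1 : t₁ ∈ U₂ := by
    obtain ⟨s₀, s₁, s₂, hs₀, hρ, hpos, hs⟩ := exists_hasShape h hc hc' (hS t₁)
    refine hmem₂ t₁ s₀ s₁ s₂ hs₀ hpos hs ?_
    have hE := ht₁ t₁ le_rfl
    have hF1 : F μ q (g t₁) < 0 := hE.2.trans (by linarith [m_neg h hc hc'])
    rw [F_eq_energyFiber_one] at hF1
    refine hs.right_lt_of_fiber_neg hp hr hs₀ ?_ hF1 hpos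
    have hA := le_normGrad_sq_of_mem_E h hc hc' hE
    have hA0 : 0 < (g t₁).normGrad ^ 2 := pow_pos (normGrad_pos h.dim hc (hS t₁)) 2
    have h2 : s₀ ≤ 1 := by
      by_contra! hlt
      have := lt_mul_of_one_lt_right hA0 (one_lt_pow₀ hlt two_ne_zero)
      linarith
    refine h2.lt_of_ne ?_
    rintro rfl
    exact hF1.not_gt hpos
  by_contra! hno
  have hcover : (univ : Set ℝ≥0) ⊆ U₁ ∪ U₂ := by
    intro t _
    obtain ⟨s₀, s₁, s₂, hs₀, hρ, hpos, hs⟩ := exists_hasShape h hc hc' (hS t)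
    rcases lt_trichotomy s₂ 1 with h2 | rfl | h2
    · exact Or.inr (hmem₂ t s₀ s₁ s₂ hs₀ hpos hs h2)
    -- If s₂ = 1, the point itself is the maximum of its fibre, hence belongs to Λ⁺.
    · refine absurd ⟨⟨hS t, ?_⟩, ?_⟩ (hno t)
      · rw [Q_eq_pohozaevFiber_one h]
        exact hs.fiberQ_right hp hr
      · rw [F_eq_energyFiber_one]
        exact hpos.trans_le (hs.fiber_le hp hr hs₀ hs₀ hpos)
    · exact Or.inl (hmem₁ t s₁ s₂ hs h2)
  obtain ⟨t, -, ht1, ht2⟩ := isPreconnected_univ U₁ U₂ hO₁ hO₂ hcover ⟨0, mem_univ _, h0⟩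
    ⟨t₁, mem_univ _, h1⟩
  obtain ⟨s₀, s₁, s₂, hs₀, hρ, hpos, hs⟩ := exists_hasShape h hc hc' (hS t)
  simp only [hU₁, hU₂, mem_iUnion] at ht1 ht2
  obtain ⟨s, hs1, hQ⟩ := ht1
  obtain ⟨s', hs', hF', hQ'⟩ := ht2
  have h3 : s < s₂ := hs.lt_right_of_fiberQ_pos hp hr hQ
  have h4 : s₂ < s' := hs.right_lt_of_fiber_pos hp hr hs'.1 hF' hQ'
  exact absurd (hs'.2.trans hs1) (h3.trans h4).not_gt

/-- The energy attains its maximum on every path of `Γ`. -/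
theorem exists_max_of_mem_Γ (h : Admissible N q μ) (hc : 0 < c) (hc' : c < c₀ 𝕜 N μ q)
    {g : C(ℝ≥0, H1 𝕜 N)} (hg : g ∈ Γ 𝕜 N μ q c) :
    ∃ t₀ : ℝ≥0, ∀ t : ℝ≥0, F μ q (g t) ≤ F μ q (g t₀) := by
  obtain ⟨t', ht'⟩ := exists_mem_Λplus_of_mem_Γ h hc hc' hg
  obtain ⟨-, -, t₁, ht₁⟩ := hg
  have hneg : ∀ t ≥ t₁, F μ q (g t) < 0 := fun t ht =>
    (ht₁ t ht).2.trans (by linarith [m_neg h hc hc'])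
  have ht'₁ : t' ≤ t₁ := by
    by_contra! hlt
    exact (hneg t' hlt.le).not_gt ht'.2
  -- After t₁ the energy is negative, whereas it is positive at the crossing of Λ⁺; the supremum is
  -- therefore attained on a compact interval.
  obtain ⟨t₀, -, hmax⟩ := (isCompact_Icc (a := (0 : ℝ≥0)) (b := t₁)).exists_isMaxOn
    ⟨0, le_rfl, zero_le⟩ ((continuous_F h).comp g.continuous).continuousOn
  refine ⟨t₀, fun t => ?_⟩
  rcases le_total t t₁ with ht | ht
  · exact hmax ⟨zero_le, ht⟩
  · exact (hneg t ht).le.trans (ht'.2.le.trans (hmax ⟨zero_le, ht'₁⟩))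

theorem le_of_mem_pathMaxima (h : Admissible N q μ) (hc : 0 < c) (hc' : c < c₀ 𝕜 N μ q) {x : ℝ}
    (hx : x ∈ pathMaxima μ q (Γ 𝕜 N μ q c)) : sInf (F μ q '' Λplus 𝕜 N μ q c) ≤ x := by
  obtain ⟨g, hg, rfl⟩ := hx
  obtain ⟨t, ht⟩ := exists_mem_Λplus_of_mem_Γ h hc hc' hg
  obtain ⟨t₀, ht₀⟩ := exists_max_of_mem_Γ h hc hc' hg
  exact (csInf_le bddBelow_Λplus ⟨_, ht, rfl⟩).trans
    (le_ciSup (f := fun t => F μ q (g t)) ⟨_, by rintro _ ⟨t, rfl⟩; exact ht₀ t⟩ t)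

/-- Radial functions of the same mass with almost no greater gradient and almost no smaller
potential energies. -/
theorem exists_radial_mem_S (h : Admissible N q μ) (hc : 0 < c) {u : H1 𝕜 N} (hu : u ∈ S 𝕜 N c)
    {δ : ℝ} (hδ : 0 < δ) : ∃ v ∈ S 𝕜 N c, v.IsRadial ∧ v.normGrad ^ 2 ≤ u.normGrad ^ 2 + δ ∧
      potential μ q u - δ ≤ potential μ q v ∧ u.critical - δ ≤ v.critical := by
  have hn := normLp_two_pos hc hu
  have hq := h.two_lt
  have hr := h.critExp_pos
  -- The factor restoring mass c. It has modulus 1 at u and is continuous there, so the perturbation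
  -- costs at most δ near u; since v has the mass of w, the same factor serves both.
  set k : H1 𝕜 N → 𝕜 := fun w => ((√c / w.normLp 2 : ℝ) : 𝕜) with hk
  have hku : ‖k u‖ = 1 := by
    have : u.normLp 2 ^ 2 = c := hu
    rw [hk, RCLike.norm_ofReal, ← this, Real.sqrt_sq hn.le, div_self hn.ne', abs_one]
  have hkc : ContinuousAt (fun w => ‖k w‖) u := by
    refine (RCLike.continuous_ofReal.continuousAt.comp ?_).norm
    exact continuousAt_const.div continuous_normLp_two.continuousAt hn.ne'
  have hA : Tendsto (fun w => (‖k w‖ * w.normGrad) ^ 2) (𝓝 u) (𝓝 (u.normGrad ^ 2)) := by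
    have := (hkc.tendsto.mul (continuous_normGrad.tendsto u)).pow 2
    simpa only [hku, one_mul] using this
  have hL : ∀ x y : ℝ, 2 ≤ x → x ≤ critExp N → Tendsto (fun w => y * (‖k w‖ * w.normLp x) ^ x) (𝓝 u)
      (𝓝 (y * u.normLp x ^ x)) := by
    intro x y hx hx'
    have := ((hkc.tendsto.mul ((continuous_normLp (𝕜 := 𝕜) h.dim hx hx').tendsto u)).rpow_const
      (p := x) (Or.inr (by linarith))).const_mul y
    simpa only [hku, one_mul] using this
  have ev : ∀ᶠ w in 𝓝 u, 0 < w.normLp 2 ∧ (‖k w‖ * w.normGrad) ^ 2 ≤ u.normGrad ^ 2 + δ ∧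
      potential μ q u - δ ≤ μ / q * (‖k w‖ * w.normLp q) ^ q ∧
      u.critical - δ ≤ 1 / critExp N * (‖k w‖ * w.normLp (critExp N)) ^ critExp N := by
    filter_upwards [continuous_normLp_two.continuousAt.eventually (lt_mem_nhds hn),
      hA.eventually (ge_mem_nhds (show u.normGrad ^ 2 < u.normGrad ^ 2 + δ by linarith)),
      (hL q (μ / q) h.two_lt.le h.lt_critExp.le).eventually
        (le_mem_nhds (show potential μ q u - δ < _ from sub_lt_self _ hδ)),
      (hL (critExp N) (1 / critExp N) h.two_lt_critExp.le le_rfl).eventually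
        (le_mem_nhds (show u.critical - δ < _ from sub_lt_self _ hδ))]
      with w h1 h2 h3 h4 using ⟨h1, h2, h3, h4⟩
  obtain ⟨ε, hε, hball⟩ := Metric.eventually_nhds_iff.1 ev
  obtain ⟨w, v, hwu, hrad, hvw, hgrad⟩ := exists_radial (by have := h.dim; omega) u hε
  obtain ⟨hw0, hw1, hw2, hw3⟩ := hball (by rwa [dist_eq_norm])
  have hk0 : ‖k w‖ * w.normLp 2 = √c := by
    rw [hk, RCLike.norm_ofReal, abs_of_nonneg (by positivity), div_mul_cancel₀ _ hw0.ne']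
  refine ⟨k w • v, ?_, hrad.smul _, ?_, ?_, ?_⟩
  · change (k w • v).normLp 2 ^ 2 = c
    rw [normLp_smul, hvw 2 two_pos, hk0, Real.sq_sqrt hc.le]
  · rw [normGrad_smul]
    refine le_trans ?_ hw1
    have := v.normGrad_nonneg
    gcongr
  · rwa [potential.eq_1 μ q (_ • v), normLp_smul, hvw q (by linarith)]
  · rwa [critical.eq_1 (_ • v), normLp_smul, hvw _ hr]

/-- The dilations of a radial function give a path of `Γ⁰`. -/
theorem exists_mem_Γ0 (h : Admissible N q μ) (hc : 0 < c) (hc' : c < c₀ 𝕜 N μ q) {v : H1 𝕜 N}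
    (hv : v ∈ S 𝕜 N c) (hrad : v.IsRadial) :
    ∃ g ∈ Γ0 𝕜 N μ q c, ∀ t, ∃ s, 0 < s ∧ F μ q (g t) = energyFiber μ q v s := by
  obtain ⟨s₀, s₁, s₂, hs₀, hρ, hpos, hs⟩ := exists_hasShape h hc hc' hv
  have hs0 : ∀ t : ℝ≥0, 0 < s₁ + (t : ℝ) := fun t => add_pos_of_pos_of_nonneg hs.pos t.2
  -- Starting the dilations at s₁ puts the initial point in Λ⁻ and keeps all scales positive.
  refine ⟨⟨fun t => dil (s₁ + (t : ℝ)) v, continuous_iff_continuousAt.2 fun t => ?_⟩,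
    ⟨fun t => ⟨dil_mem_S (hs0 t) hv, hrad.dil _⟩, ?_, ?_⟩, fun t => ⟨_, hs0 t, F_dil h (hs0 t) v⟩⟩
  · exact ContinuousAt.comp (f := fun t : ℝ≥0 => s₁ + (t : ℝ)) (continuousAt_dil v (hs0 t))
      (by fun_prop)
  · change dil (s₁ + ((0 : ℝ≥0) : ℝ)) v ∈ _
    rw [NNReal.coe_zero, add_zero]
    refine ⟨⟨dil_mem_S hs.pos hv, ?_⟩, HasShape.F_dil_left_neg h hs⟩
    rw [Q_dil h hs.pos]
    exact hs.fiberQ_left h.dilExp_pos h.critExp_pos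
  · obtain ⟨T, hT⟩ := eventually_atTop.1 ((tendsto_fiber_atBot (p := dilExp N q)
      (A := v.normGrad ^ 2) h.two_lt_critExp (potential_pos h hc hv).le
      (critical_pos h hc hv)).eventually (eventually_lt_atBot (2 * m 𝕜 N μ q c)))
    refine ⟨T.toNNReal, fun t ht => ⟨dil_mem_S (hs0 t) hv, ?_⟩⟩
    change F μ q (dil (s₁ + (t : ℝ)) v) < _
    rw [F_dil h (hs0 t)]
    refine hT _ ?_
    have h1 : T ≤ t := Real.toNNReal_le_iff_le_coe.1 ht
    linarith [hs.pos]

theorem Γ0_nonempty (h : Admissible N q μ) (hc : 0 < c) (hc' : c < c₀ 𝕜 N μ q) :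
    (Γ0 𝕜 N μ q c).Nonempty := by
  obtain ⟨u, hu⟩ := exists_mem_S (𝕜 := 𝕜) h.dim hc
  obtain ⟨v, hv, hrad, -⟩ := exists_radial_mem_S h hc hu one_pos
  obtain ⟨g, hg, -⟩ := exists_mem_Γ0 h hc hc' hv hrad
  exact ⟨g, hg⟩

theorem bddBelow_pathMaxima (h : Admissible N q μ) (hc : 0 < c) (hc' : c < c₀ 𝕜 N μ q) :
    BddBelow (pathMaxima μ q (Γ 𝕜 N μ q c)) :=
  ⟨_, fun _ => le_of_mem_pathMaxima h hc hc'⟩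

/-- The energies on the dilation path of a radial competitor are values of its fibre. They exceed
the fibre maximum of u, which is F_μ(u) because u lies in Λ⁺, by at most ε. -/
theorem M0_le_sInf_Λplus (h : Admissible N q μ) (hc : 0 < c) (hc' : c < c₀ 𝕜 N μ q) :
    M0 𝕜 N μ q c ≤ sInf (F μ q '' Λplus 𝕜 N μ q c) := by
  refine le_csInf ((Λplus_nonempty h hc hc').image _) ?_
  rintro _ ⟨u, hu, rfl⟩
  refine le_of_forall_pos_le_add fun ε hε => ?_
  have huS := hu.1.1
  obtain ⟨δ, hδ, hle⟩ := exists_fiber_le_add h.dilExp_pos h.two_lt_critExp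
    (pow_pos (normGrad_pos h.dim hc huS) 2) (critical_pos h hc huS) hu.2.le hε
    fun s hs => energyFiber_le_of_mem_Λplus h hc hc' hu hs
  obtain ⟨v, hv, hrad, h1, h2, h3⟩ := exists_radial_mem_S h hc huS hδ
  obtain ⟨g, hg, hgs⟩ := exists_mem_Γ0 h hc hc' hv hrad
  refine (csInf_le ((bddBelow_pathMaxima h hc hc').mono (image_mono (Γ0_subset_Γ h hc hc')))
    ⟨g, hg, rfl⟩).trans (ciSup_le fun t => ?_)
  obtain ⟨s, hs, hF⟩ := hgs t
  rw [hF]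
  exact hle _ _ _ h1 h2 h3 (potential_pos h hc hv).le s hs

theorem sInf_Λplus_le_M (h : Admissible N q μ) (hc : 0 < c) (hc' : c < c₀ 𝕜 N μ q) :
    sInf (F μ q '' Λplus 𝕜 N μ q c) ≤ M 𝕜 N μ q c :=
  le_csInf (((Γ0_nonempty h hc hc').mono (Γ0_subset_Γ h hc hc')).image _)
    fun _ => le_of_mem_pathMaxima h hc hc'

theorem M_le_M0 (h : Admissible N q μ) (hc : 0 < c) (hc' : c < c₀ 𝕜 N μ q) :
    M 𝕜 N μ q c ≤ M0 𝕜 N μ q c :=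
  csInf_le_csInf (bddBelow_pathMaxima h hc hc') ((Γ0_nonempty h hc hc').image _)
    (image_mono (Γ0_subset_Γ h hc hc'))

end Levels

end NormalizedNLS

end

theorem proposition1p9 {𝕜 : Type*} [RCLike 𝕜] (N : ℕ) (hN : 3 ≤ N) (q μ : ℝ) (hq : 2 < q)
    (hq' : q < 2 + 4 / (N : ℝ)) (hμ : 0 < μ) :
    0 < c₀ 𝕜 N μ q ∧
    ∀ c : ℝ, 0 < c → c < c₀ 𝕜 N μ q →
      -- the three levels are well defined: all maxima are attained, and all infima are infima of
      -- nonempty sets of real numbers which are bounded below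
      ((Γ0 𝕜 N μ q c).Nonempty ∧
        Γ0 𝕜 N μ q c ⊆ Γ 𝕜 N μ q c ∧
        (∀ h ∈ Γ 𝕜 N μ q c, ∃ t₀ : ℝ≥0, ∀ t : ℝ≥0,
          F μ q (h t) ≤ F μ q (h t₀)) ∧
        BddBelow (pathMaxima μ q (Γ 𝕜 N μ q c)) ∧
        (Λplus 𝕜 N μ q c).Nonempty ∧
        BddBelow (F μ q '' Λplus 𝕜 N μ q c)) ∧
      M0 𝕜 N μ q c ≤ M 𝕜 N μ q c ∧
      M0 𝕜 N μ q c = M 𝕜 N μ q c ∧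
      M 𝕜 N μ q c =
        sInf (F μ q '' Λplus 𝕜 N μ q c) := by
  refine ⟨c₀_pos hN hq hq' hμ, fun c hc hc' => ?_⟩
  have h : Admissible N q μ := ⟨hN, hq, hq', hμ⟩
  -- The three inequalities M⁰ ≤ inf F_μ(Λ⁺) ≤ M ≤ M⁰ close a cycle.
  have h1 := M0_le_sInf_Λplus (𝕜 := 𝕜) h hc hc'
  have h2 := sInf_Λplus_le_M (𝕜 := 𝕜) h hc hc'
  have h3 := M_le_M0 (𝕜 := 𝕜) h hc hc'
  exact ⟨⟨Γ0_nonempty h hc hc', Γ0_subset_Γ h hc hc', fun g hg => exists_max_of_mem_Γ h hc hc' hg,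
    bddBelow_pathMaxima h hc hc', Λplus_nonempty h hc hc', bddBelow_Λplus⟩, h1.trans h2,
    (h1.trans h2).antisymm h3, (h3.trans h1).antisymm h2⟩
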